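/- **Setting.** Fix $0<T<1$ and $p>16$; $l>0$ is a large real number. All logarithms are natural. *The space $Y$.* The hexagons $m_1\gamma'+m_2\gamma''+\{\xi\in\mathbb R^2: |\xi_1|,|\xi_2|,|\xi_1-\xi_2|\le 1\}$, $m\in\mathbb Z^2$, $\gamma'=(2,1)$, $\gamma''=(1,2)$, tile the plane. At each vertex of the tiling put a chart $\{(x,y,z)\in\mathbb C^3: |v_0|<T^l\}$, $v_0:=xyz$. The three edges at a vertex correspond to the three coordinates, edges in directions $\pm(1,0),\pm(0,1),\pm(1,1)$ corresponding to $x,y,z$. The charts at the two ends of an $x$-edge are glued where $x\ne0$ by $(x,y,z)\mapsto(T^{-2}x^{-1},\,Txz,\,Txy)$, and along $y$- and $z$-edges by $(x,y,z)\mapsto (Tyz,\,T^{-2}y^{-1},\,Txy)$ and $(x,y,z)\mapsto(Tyz,\,Txz,\,T^{-2}z^{-1})$. This gives the part $|v_0|<T^l$ of a toric variety of infinite type $\tilde Y$. The lattice $\Gamma_B=\mathbb Z\gamma'\oplus\mathbb Z\gamma''$ acts on it by translating vertices and keeping coordinates, so that in one chart $-\gamma'$ and $-\gamma''$ act by $(x,y,z)\mapsto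 (T^3v_0x,\,y,\,T^{-3}v_0^{-1}z)$ and $(x,y,z)\mapsto(x,\,T^3v_0y,\,T^{-3}v_0^{-1}z)$. Let $Y$ be the quotient by $\Gamma_B$; $v_0$ descends to $v_0:Y\to\mathbb C$. *Notation.* For $\{a,b,c\}=\{x,y,z\}$ let $$g_{bc}=\log\big((1+|Tb|^2)(1+|Tc|^2)(1+|T^2bc|^2)\big),\qquad \phi_a=\log\frac{1+|Ta|^2}{1+|T^2bc|^2}.$$ *Bump functions.* For $K>0$ call $(\alpha_3,\alpha_4,\alpha_5,\alpha_6)$ *admissible* if they are smooth nondecreasing functions on $\mathbb R$ such that - $\alpha_3=\frac23$ and $\alpha_5=0$ on $(-\infty,2T^{2+l/2}]$, and $\alpha_3=\alpha_5=1$ on $[\frac12T^{2+l/2-2l/p},\infty)$; - $\alpha_4$ is odd, $\alpha_4=0$ on $[0,2T^{3/2+3l/4}]$, and $\alpha_4=\frac12$ on $[\frac12T^{2+3l/4-2l/p},\infty)$; - $\alpha_6(t)=0$ for $t\le\log(2T^{l/8-l/p})$ and $\alpha_6(t)=1$ for $t\ge\log(\frac12T^{l/8-2l/p})$; - $|t\alpha_i'(t)|\le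 K/l$ and $|t(t\alpha_i'(t))'|\le K/l^2$ for $t>0$, $i=3,4,5$; and $|\alpha_6'|\le K/l$, $|\alpha_6''|\le K/l^2$. *The form $\omega$.* Around a vertex define $F$ on the sector $|a|\ge|b|\ge|c|$, for each ordering $(a,b,c)$ of the coordinates, as follows. - If $|b|\le T^{l/8-l/p}|a|$: $F=g_{bc}+\alpha_3(d)d+\alpha_4(\theta)\alpha_5(d)\theta$, where $d=\phi_a-\frac12(\phi_b+\phi_c)$ and $\theta=\phi_b-\phi_c$. - If $T^{l/8-l/p}|a|<|b|\le T^{l/8-2l/p}|a|$: $F=g_{bc}-\alpha_6\phi_b+\alpha_3(d)d+\frac12\alpha_5(d)(\phi_b-\phi_c-\alpha_6\phi_b)$, where $\alpha_6=\alpha_6(\log|b|-\log|a|)$ and $d=\phi_a-\frac12(\phi_b+\phi_c)+\frac32\alpha_6\phi_b$. - If $|b|>T^{l/8-2l/p}|a|$: $F=g_{bc}-\phi_b+\alpha_3(d)d-\frac12\alpha_5(d)\phi_c$, where $d=\phi_a+\phi_b-\frac12\phi_c$. (So $F=\frac13(g_{xy}+g_{xz}+g_{yz})$ near the vertex, and $F$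 is the potential $g_{ab}$ of $\mathbb{CP}^2(3\text{ points})$ in the interior of each tile.) For $C\in\mathbb R$ let $\omega$ be the 2-form on $Y$ that equals $\frac{i}{2\pi}\partial\bar\partial\big(F+C|xyz|^2\big)$ on the polydisc $|Tx|,|Ty|,|Tz|\le1$ of every chart. **Lemma.** For all $0<T<1$ and $p>16$ there is $K_0$ such that for every $K\ge K_0$ there is $l_0$ such that for every $l\ge l_0$: admissible bump functions exist, and for any admissible bump functions there is $C_0$ such that for every $C\ge C_0$ the 2-form $\omega$ exists, is unique, and the following hold. 1. $Y$ is a complex manifold (Hausdorff and second countable), the projection of the charts to $Y$ being a local homeomorphism, and $\omega$ is a symplectic form on $Y$: it is smooth, closed and non-degenerate. 2. $\omega$ makes $v_0:Y\to\mathbb C$ a symplectic fibration: over $0<|v_0|<T^l$ the map $v_0$ is a submersion and a smooth fibre bundle with fibre the torus $\mathbb R^4/\mathbb Z^4$, and $\omega$ restricts to a non-degenerate form on $\ker dv_0$ at every point where $dv_0\neq0$, in particular along every fibre $v_0=c\ne0$. -/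

import Mathlib

noncomputable section

namespace BananaMirror

/-! ### The complex threefold `Y` -/

/-- The affine space `ℂ³` of toric coordinates `(x, y, z)` at a vertex of the polytope. -/
abbrev C3 := Fin 3 → ℂ

/-- The superpotential `v₀ = xyz` in toric coordinates. -/
def v0 (q : C3) : ℂ := q 0 * q 1 * q 2

/-- The part `|v₀| < T ^ l` of a toric chart. -/
def chartDomain (T l : ℝ) : Set C3 := {q | ‖v0 q‖ < T ^ l}

/-- The transition map between the toric charts at the two ends of an edge of the polytope; the
index `0`, `1` or `2` says whether the edge is the `x`-, the `y`- or the `z`-axis of the chart.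
For the `x`-axis it is `(x, y, z) ↦ (T⁻² x⁻¹, T v₀ y⁻¹, T v₀ z⁻¹) = (T⁻² x⁻¹, T x z, T x y)`. -/
def edgeMap (T : ℝ) (i : Fin 3) (q : C3) : C3 :=
  ![![((T : ℂ) ^ 2 * q 0)⁻¹, T * q 0 * q 2, T * q 0 * q 1],
    ![T * q 1 * q 2, ((T : ℂ) ^ 2 * q 1)⁻¹, T * q 0 * q 1],
    ![T * q 1 * q 2, T * q 0 * q 2, ((T : ℂ) ^ 2 * q 2)⁻¹]] i

/-- The vertices of the polytope, that is, of the tiling of the plane by the hexagons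
`m₁ γ' + m₂ γ'' + {(ξ₁, ξ₂) | |ξ₁|, |ξ₂|, |ξ₁ - ξ₂| ≤ 1}`, `γ' = (2, 1)`, `γ'' = (1, 2)`.
`((m₁, m₂), false)` is the lower left vertex `m₁ γ' + m₂ γ'' + (-1, -1)` of the tile `(m₁, m₂)`,
whose edges have directions `(1, 0)`, `(0, 1)`, `(-1, -1)`;
`((m₁, m₂), true)` is the vertex `m₁ γ' + m₂ γ'' + (0, -1)` of the same tile. -/
abbrev Vertex := (ℤ × ℤ) × Bool

/-- The edge in direction `i` from `(m, false)` ends at `(m + edgeShift i, true)`. -/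
def edgeShift : Fin 3 → ℤ × ℤ := ![(0, 0), (-1, 1), (-1, 0)]

/-- The points of the disjoint union of the charts `{|v₀| < T ^ l} ⊆ ℂ³` at all vertices. -/
abbrev ChartPoint (T l : ℝ) := {P : Vertex × C3 // P.2 ∈ chartDomain T l}

/-- The identifications that produce `Y`: the toric gluings along the edges, which give the part
`|v₀| < T ^ l` of the toric variety of infinite type `Ỹ`, and the action of the lattice
`Γ_B = ℤ γ' ⊕ ℤ γ''`, which sends the point with coordinates `q` at a vertex to the point with the
same coordinates at the translated vertex. -/
inductive Glue (T l : ℝ) : ChartPoint T l → ChartPoint T l → Prop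
  | edge (m : ℤ × ℤ) (i : Fin 3) (q : C3) (hq : q ∈ chartDomain T l) (hi : q i ≠ 0)
      (hq' : edgeMap T i q ∈ chartDomain T l) :
      Glue T l ⟨((m, false), q), hq⟩ ⟨((m + edgeShift i, true), edgeMap T i q), hq'⟩
  | deck (γ m : ℤ × ℤ) (b : Bool) (q : C3) (hq : q ∈ chartDomain T l) :
      Glue T l ⟨((m, b), q), hq⟩ ⟨((m + γ, b), q), hq⟩

/-- The space `Y`, the quotient by `Γ_B` of the part `|v₀| < T ^ l` of `Ỹ`. -/
def Y (T l : ℝ) : Type := Quot (Glue T l)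

instance (T l : ℝ) : TopologicalSpace (Y T l) := inferInstanceAs (TopologicalSpace (Quot (Glue T l)))

/-- The projection of the charts onto `Y`. -/
def Y.mk {T l : ℝ} (P : ChartPoint T l) : Y T l := Quot.mk _ P

theorem v0_edgeMap {T : ℝ} (hT : 0 < T) (i : Fin 3) (q : C3) (hi : q i ≠ 0) :
    v0 (edgeMap T i q) = v0 q := by
  have hT' : (T : ℂ) ≠ 0 := by exact_mod_cast hT.ne'
  fin_cases i <;> simp [v0, edgeMap] at hi ⊢ <;> field_simp

/-- The superpotential `v₀ : Y → ℂ`. -/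
def superpotential {T : ℝ} (hT : 0 < T) (l : ℝ) : Y T l → ℂ :=
  Quot.lift (fun P => v0 P.1.2) (by
    rintro _ _ (⟨m, i, q, hq, hi, hq'⟩ | ⟨γ, m, b, q, hq⟩)
    · exact (v0_edgeMap hT i q hi).symm
    · rfl)

/-! ### Two-forms on `Y` and symplectic fibrations -/

/-- A family of two-forms, one on each chart; only the values on `chartDomain` matter. -/
abbrev FormFamily := Vertex → C3 → C3 [⋀^Fin 2]→L[ℝ] ℝ

/-- The family `ω` is a smooth two-form on `Y`: its members are smooth, they are pulled back to each
other by the transition maps along the edges, and they are invariant under `Γ_B`. -/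
structure IsTwoForm (T l : ℝ) (ω : FormFamily) : Prop where
  smooth : ∀ v, ContDiffOn ℝ (⊤ : ℕ∞) (ω v) (chartDomain T l)
  edge : ∀ (m : ℤ × ℤ) (i : Fin 3), ∀ q ∈ chartDomain T l, q i ≠ 0 →
    ω (m, false) q = (ω (m + edgeShift i, true) (edgeMap T i q)).compContinuousLinearMap
      (fderiv ℝ (edgeMap T i) q)
  deck : ∀ (γ m : ℤ × ℤ) (b : Bool), ∀ q ∈ chartDomain T l, ω (m + γ, b) q = ω (m, b) q

/-- The projection of the charts makes `Y` a complex manifold (the charts are the local inverses of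
the projection, and the transition maps are generated by the monomial maps `edgeMap`). -/
structure IsManifoldQuotient (T l : ℝ) : Prop where
  isLocalHomeomorph : IsLocalHomeomorph (Y.mk : ChartPoint T l → Y T l)
  hausdorff : T2Space (Y T l)
  secondCountable : SecondCountableTopology (Y T l)

/-- `ω` is a symplectic form on `Y`. -/
structure IsSymplectic (T l : ℝ) (ω : FormFamily) : Prop where
  isTwoForm : IsTwoForm T l ω
  closed : ∀ v, ∀ q ∈ chartDomain T l, extDeriv (ω v) q = 0
  nondegenerate : ∀ v, ∀ q ∈ chartDomain T l, ∀ a : C3, a ≠ 0 → ∃ b : C3, ω v q ![a, b] ≠ 0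

/-- Over `0 < |c| < T ^ l`, the superpotential is a smooth fibre bundle with fibre the torus
`ℝ⁴ / ℤ⁴`. A local trivialisation over `W` is given as a smooth family `Ψ w : ℝ⁴ → v₀⁻¹(w)`, `w ∈ W`,
of `ℤ⁴`-periodic maps that induces a bijection `W × ℝ⁴ / ℤ⁴ → v₀⁻¹(W)` and has bijective
derivative everywhere; it is written in the chart at one vertex, since the part `v₀ ≠ 0` of `Y` lies
in the image of that chart. -/
def IsSmoothTorusBundle {T : ℝ} (hT : 0 < T) (l : ℝ) : Prop :=
  ∀ c : ℂ, c ≠ 0 → ‖c‖ < T ^ l →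
    ∃ (W : Set ℂ) (Ψ : ℂ × (Fin 4 → ℝ) → C3)
      (hΨ : ∀ w ∈ W, ∀ t, Ψ (w, t) ∈ chartDomain T l),
      IsOpen W ∧ c ∈ W ∧
      (∀ w ∈ W, ∀ t, v0 (Ψ (w, t)) = w) ∧
      ContDiffOn ℝ (⊤ : ℕ∞) Ψ (W ×ˢ Set.univ) ∧
      (∀ w ∈ W, ∀ t, Function.Bijective (fderiv ℝ Ψ (w, t))) ∧
      (∀ y : Y T l, superpotential hT l y ∈ W →
        ∃ (w : ℂ) (hw : w ∈ W) (t : Fin 4 → ℝ), Y.mk ⟨((0, false), Ψ (w, t)), hΨ w hw t⟩ = y) ∧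
      (∀ (w : ℂ) (hw : w ∈ W) (s t : Fin 4 → ℝ),
        Y.mk ⟨((0, false), Ψ (w, s)), hΨ w hw s⟩ = Y.mk ⟨((0, false), Ψ (w, t)), hΨ w hw t⟩ ↔
          ∃ n : Fin 4 → ℤ, ∀ j, s j - t j = n j)

/-- `(Y, ω)` is a symplectic manifold and `v₀` is a symplectic fibration on it: a smooth fibre bundle
over the punctured disc such that the fibres of `v₀` are symplectic with respect to `ω` (at all
points where `v₀` is regular, in particular along every fibre `v₀ = c ≠ 0`). The tangent space of
a fibre is the kernel of `dv₀`. -/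
structure IsSymplecticFibration {T : ℝ} (hT : 0 < T) (l : ℝ) (ω : FormFamily) : Prop where
  manifold : IsManifoldQuotient T l
  symplectic : IsSymplectic T l ω
  bundle : IsSmoothTorusBundle hT l
  submersive : ∀ q ∈ chartDomain T l, v0 q ≠ 0 → fderiv ℂ v0 q ≠ 0
  fibre_nondegenerate : ∀ v, ∀ q ∈ chartDomain T l, fderiv ℂ v0 q ≠ 0 →
    ∀ a : C3, fderiv ℂ v0 q a = 0 → a ≠ 0 →
      ∃ b : C3, fderiv ℂ v0 q b = 0 ∧ ω v q ![a, b] ≠ 0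

/-! ### The local Kähler potential -/

/-- The toric Kähler potential of `ℂP²(3 points)` in the toric coordinates number `b` and `c`:
`g = log ((1 + |T x_b|²) (1 + |T x_c|²) (1 + |T² x_b x_c|²))`. -/
def g (T : ℝ) (b c : Fin 3) (q : C3) : ℝ :=
  Real.log ((1 + ‖T * q b‖ ^ 2) * (1 + ‖T * q c‖ ^ 2) * (1 + ‖T ^ 2 * q b * q c‖ ^ 2))

/-- `φ_a = log ((1 + |T x_a|²) / (1 + |T² x_b x_c|²))` for `{a, b, c} = {0, 1, 2}`. -/
def phi (T : ℝ) (a b c : Fin 3) (q : C3) : ℝ :=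
  Real.log ((1 + ‖T * q a‖ ^ 2) / (1 + ‖T ^ 2 * q b * q c‖ ^ 2))

/-- The four bump functions. -/
structure Bumps where
  (α₃ α₄ α₅ α₆ : ℝ → ℝ)

/-- `f` is smooth and increases from the value `u` for `0 ≤ t ≤ s₀` to the value `v` for `s₁ ≤ t`,
and is constant also near the ends of `[s₀, s₁]`, namely within a factor `2` of them; its first
and second logarithmic derivatives are at most `K / l` and `K / l²`. -/
structure LogStep (f : ℝ → ℝ) (u v s₀ s₁ K l : ℝ) : Prop where
  smooth : ContDiff ℝ (⊤ : ℕ∞) f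
  mono : Monotone f
  low : ∀ t, 0 ≤ t → t ≤ 2 * s₀ → f t = u
  high : ∀ t, s₁ / 2 ≤ t → f t = v
  deriv_le : ∀ t, 0 < t → |t * deriv f t| ≤ K / l
  deriv2_le : ∀ t, 0 < t → |t * deriv (fun s => s * deriv f s) t| ≤ K / l ^ 2

/-- The requirements on the bump functions.
* `α₃` and `α₅`, functions of the radial coordinates `d ≈ |T x_a|²`, vary while `|x_a|` moves from
  `T^(l/4)` to `T^(l/4 - l/p)`.
* `α₄`, an odd function of the angular coordinates `θ ≈ |T x_b|² - |T x_c|²`, is `0` for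
  `T < |x_b / x_c|² < T⁻¹`, and is `1/2` once `|x_b|` is at least `T^(3l/8 - l/p)`.
* `α₆`, a function of `θ_II = log |x_b| - log |x_a|`, varies while `|x_b / x_a|` moves from
  `T^(l/8 - l/p)` to `T^(l/8 - 2l/p)`. -/
structure Bumps.Admissible (α : Bumps) (T p l K : ℝ) : Prop where
  step₃ : LogStep α.α₃ (2 / 3) 1 (T ^ (2 + l / 2)) (T ^ (2 + l / 2 - 2 * l / p)) K l
  neg₃ : ∀ t ≤ 0, α.α₃ t = 2 / 3
  step₅ : LogStep α.α₅ 0 1 (T ^ (2 + l / 2)) (T ^ (2 + l / 2 - 2 * l / p)) K l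
  neg₅ : ∀ t ≤ 0, α.α₅ t = 0
  step₄ : LogStep α.α₄ 0 (1 / 2) (T ^ (3 / 2 + 3 * l / 4)) (T ^ (2 + 3 * l / 4 - 2 * l / p)) K l
  odd₄ : ∀ t, α.α₄ (-t) = -α.α₄ t
  smooth₆ : ContDiff ℝ (⊤ : ℕ∞) α.α₆
  mono₆ : Monotone α.α₆
  low₆ : ∀ t, t ≤ Real.log (2 * T ^ (l / 8 - l / p)) → α.α₆ t = 0
  high₆ : ∀ t, Real.log (T ^ (l / 8 - 2 * l / p) / 2) ≤ t → α.α₆ t = 1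
  deriv_le₆ : ∀ t, |deriv α.α₆ t| ≤ K / l
  deriv2_le₆ : ∀ t, |deriv (deriv α.α₆) t| ≤ K / l ^ 2

/-- The potential in the regions where `x_a` dominates: for `a = 0, 1, 2` these are the regions I,
III and V, together with the regions along the coordinate axes, where `α₃ = α₅ = 1`. -/
def potentialI (α : Bumps) (T : ℝ) (a b c : Fin 3) (q : C3) : ℝ :=
  let d := phi T a b c q - (phi T b a c q + phi T c a b q) / 2
  let θ := phi T b a c q - phi T c a b q
  g T b c q + α.α₃ d * d + α.α₄ θ * α.α₅ d * θ

/-- The potential in the region where `x_a ≫ x_b ≫ x_c` and one moves from the region dominated by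
`x_a` towards the one where `x_a` and `x_b` are comparable: for `(a, b, c) = (0, 1, 2)` this is the
region IIA, for `(1, 0, 2)` the region IIC; the other four cases are obtained by symmetry. -/
def potentialIIA (α : Bumps) (T : ℝ) (a b c : Fin 3) (q : C3) : ℝ :=
  let α₆ := α.α₆ (Real.log ‖q b‖ - Real.log ‖q a‖)
  let d := phi T a b c q - (phi T b a c q + phi T c a b q) / 2 + 3 / 2 * α₆ * phi T b a c q
  g T b c q - α₆ * phi T b a c q + α.α₃ d * d
    + 1 / 2 * α.α₅ d * (phi T b a c q - phi T c a b q - α₆ * phi T b a c q)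

/-- The potential in the region where `x_a` and `x_b` are comparable and dominate `x_c`
(the region IIB for `{a, b} = {0, 1}`). -/
def potentialIIB (α : Bumps) (T : ℝ) (a b c : Fin 3) (q : C3) : ℝ :=
  let d := phi T a b c q + phi T b a c q - phi T c a b q / 2
  (g T b c q - phi T b a c q) + α.α₃ d * d - 1 / 2 * α.α₅ d * phi T c a b q

/-- The potential on the sector `|x_a| ≥ |x_b| ≥ |x_c|`. The remaining regions need no formula of
their own: where `α₃ = 2/3` and `α₅ = 0` all three formulas equal `(g_xy + g_xz + g_yz) / 3`, the
potential of region VII, and where `α₃ = α₅ = 1` (and `α₄ = 1/2`, in the first formula) they equal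
`g_ab`, the potential of the interior of a tile. -/
def sectorPotential (α : Bumps) (T p l : ℝ) (a b c : Fin 3) (q : C3) : ℝ :=
  if ‖q b‖ ≤ T ^ (l / 8 - l / p) * ‖q a‖ then potentialI α T a b c q
  else if ‖q b‖ ≤ T ^ (l / 8 - 2 * l / p) * ‖q a‖ then potentialIIA α T a b c q
  else potentialIIB α T a b c q

/-- The local Kähler potential `F` around a vertex: one formula for each order of
`|x|`, `|y|`, `|z|`. -/
def potential (α : Bumps) (T p l : ℝ) (q : C3) : ℝ :=
  if ‖q 1‖ ≤ ‖q 0‖ ∧ ‖q 2‖ ≤ ‖q 1‖ then sectorPotential α T p l 0 1 2 q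
  else if ‖q 2‖ ≤ ‖q 0‖ ∧ ‖q 1‖ ≤ ‖q 2‖ then sectorPotential α T p l 0 2 1 q
  else if ‖q 0‖ ≤ ‖q 1‖ ∧ ‖q 2‖ ≤ ‖q 0‖ then sectorPotential α T p l 1 0 2 q
  else if ‖q 2‖ ≤ ‖q 1‖ ∧ ‖q 0‖ ≤ ‖q 2‖ then sectorPotential α T p l 1 2 0 q
  else if ‖q 0‖ ≤ ‖q 2‖ ∧ ‖q 1‖ ≤ ‖q 0‖ then sectorPotential α T p l 2 0 1 q
  else sectorPotential α T p l 2 1 0 q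

/-- The real number `(i ∂∂̄ F)_q (a, b)`, where
`i ∂∂̄ F = i ∑ (∂²F / ∂z_j ∂z̄_k) dz_j ∧ dz̄_k`, in terms of the real second derivative `D²F`:
it is `(D²F(i a, b) - D²F(a, i b)) / 2`. -/
def iddbar (F : C3 → ℝ) (q a b : C3) : ℝ :=
  (fderiv ℝ (fderiv ℝ F) q (Complex.I • a) b - fderiv ℝ (fderiv ℝ F) q a (Complex.I • b)) / 2

/-- `ω` is the two-form on `Y` with local Kähler potential `F + C |xyz|²` around each vertex:
`ω = (i / 2π) ∂∂̄ (F + C |xyz|²)` on the polydisc `|Tx|, |Ty|, |Tz| ≤ 1` of every chart, that is,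
up to the middle of each edge. These polydiscs cover `Y`. -/
structure HasPotential (α : Bumps) (T p l C : ℝ) (ω : FormFamily) : Prop where
  isTwoForm : IsTwoForm T l ω
  eq : ∀ v, ∀ q ∈ chartDomain T l, (∀ i, ‖T * q i‖ ≤ 1) → ∀ a b : C3,
    ω v q ![a, b] =
      1 / (2 * Real.pi) * iddbar (fun q' => potential α T p l q' + C * ‖v0 q'‖ ^ 2) q a b

end BananaMirror

end

noncomputable section

namespace BananaMirror

open scoped ComplexConjugate ContDiff Topology
open Filter

/-! Gluing of the potential. Write `A`, `B`, `Γ` for `|T x_a|² ≥ |T x_b|² ≥ |T x_c|²` and `lg t =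
log (1 + t)`. Every sector formula combines the six functions `lg A`, `lg B`, `lg Γ`, `lg (BΓ)`, `lg
(AΓ)`, `lg (AB)` with bump functions as coefficients. Since `ABΓ = |T³ v₀|²` is tiny, the scales
separate (`exists_scales`): where two formulas meet, the bump functions that distinguish them are
constant. Hence `F` is smooth near the polydisc (`Setup.exists_region`,
`Setup.contDiffAt_potential`). An edge map changes `F` by `log |T x_a|²`
(`Setup.potential_edgeMap`), which is pluriharmonic, so `i ∂∂̄ F` is invariant.

Positivity. The bump functions vary slowly on a logarithmic scale, so up to errors of order `ε
|v|²`, `ε = K / l`, the Levi form of `F` is the same combination of the six Levi forms with the bump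
functions frozen (`HasLevi.step_mul`). The frozen coefficients are nonnegative, except possibly that
of `lg (AΓ)`; this one can be negative only where `A` is small, and there the Levi form of `lg (AΓ)`
is itself small (`Setup.radial`). The coefficients of `lg A` and `lg B` are bounded below, while
that of `lg Γ` may vanish. On `ker dv₀` this is harmless, because `x_c` is the smallest coordinate
and so `v_c` is bounded by `v_a` and `v_b` (`pos_of_kernel`); where `x_b = x_c = 0` all three
directions are controlled. Thus the Levi form is positive on `ker dv₀` (`Setup.levi_pos`). The Levi
form of `C |v₀|²` is `2 C |dv₀(v)|²`, and compactness yields a `C₀` from which on the sum is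
positive in all directions (`Setup.exists_const`). Then `ω(a, i a) > 0`, which gives nondegeneracy
on `ℂ³` and on the complex subspace `ker dv₀` alike.

Topology of `Y`. In the coordinates `X_i = T x_i`, with `u = X₀ X₁ X₂`, an edge map is `X_i ↦
X_i⁻¹`, `X_j ↦ u X_j⁻¹`. Paths of edges give the maps `X_j ↦ u ^ n_j * X_j ^ s` with `s = ±1` and `∑
n_j = 1 - s`, and all such exponents occur (`exists_word`). `Γ_B` acts on vertices without changing
coordinates, so two chart points are identified exactly when such a map, with `s` given by the types
of the vertices, relates them. The closed relations `monoGraph` extend these maps over `u = 0`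
without adding identifications (`exists_word_of_mem_monoGraph`) and form a locally finite family for
`|u| ≤ δ < 1`; this makes `Y` Hausdorff. Those with `s = 1`, `n ≠ 0` avoid the diagonal, which makes
the projection locally injective.

The form and the fibres. Every point reaches the closed polydisc along a path
(`exists_run_mem_polydisc`), so `ω` is unique, and it can be defined by transport along a path.
Independence of the path holds because, for `v₀ ≠ 0`, a monomial map between points of the polydisc
is given by a path of at most three edges inside the domain of smoothness (`exists_staysIn`); `v₀ =
0` follows by continuity. A fibre `v₀ ≠ 0` is `(ℂˣ / u ^ ℤ)²`, and a logarithm of `u` together with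
`2πi` is a real basis of `ℂ`, which gives the trivialisations (`torusMap`). -/

theorem two_le_infty : (2 : WithTop ℕ∞) ≤ ∞ := by
  exact WithTop.coe_le_coe.2 (le_top : (2 : ℕ∞) ≤ ⊤)

/-! ### The two-form `i ∂∂̄ F` -/

/-- Multiplication by `i`. -/
def mulI : C3 →L[ℝ] C3 := (Complex.I • ContinuousLinearMap.id ℂ C3).restrictScalars ℝ

@[simp] theorem mulI_apply (a : C3) : mulI a = Complex.I • a := rfl

/-- The one-form `- dF ∘ i / 2`, whose exterior derivative is `i ∂∂̄ F`. -/
def dcForm (F : C3 → ℝ) (q : C3) : C3 [⋀^Fin 1]→L[ℝ] ℝ :=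
  ContinuousAlternatingMap.ofSubsingletonLIE (𝕜 := ℝ) (E := C3) (F := ℝ) (0 : Fin 1)
    (-(1 / 2 : ℝ) • (fderiv ℝ F q).comp mulI)

/-- The two-form `i ∂∂̄ F`. -/
def iddbarForm (F : C3 → ℝ) : C3 → C3 [⋀^Fin 2]→L[ℝ] ℝ := extDeriv (dcForm F)

theorem dcForm_apply (F : C3 → ℝ) (q : C3) (v : Fin 1 → C3) :
    dcForm F q v = -(1 / 2) * fderiv ℝ F q (Complex.I • v 0) := by
  simp [dcForm, ContinuousAlternatingMap.ofSubsingletonLIE]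

theorem contDiffAt_dcForm {F : C3 → ℝ} {q : C3} {m n : WithTop ℕ∞} (hF : ContDiffAt ℝ n F q)
    (hmn : m + 1 ≤ n) : ContDiffAt ℝ m (dcForm F) q := by
  have h : ContDiffAt ℝ m (fun q => -(1 / 2 : ℝ) • (fderiv ℝ F q).comp mulI) q :=
    ((hF.fderiv_right hmn).clm_comp contDiffAt_const).const_smul _
  exact (ContinuousAlternatingMap.ofSubsingletonLIE (𝕜 := ℝ) (E := C3) (F := ℝ)
    (0 : Fin 1)).toContinuousLinearEquiv.contDiff.comp_contDiffAt q h

theorem contDiffAt_iddbarForm {F : C3 → ℝ} {q : C3} (hF : ContDiffAt ℝ ∞ F q) :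
    ContDiffAt ℝ ∞ (iddbarForm F) q := by
  unfold iddbarForm
  refine ((ContinuousAlternatingMap.alternatizeUncurryFinCLM ℝ C3 ℝ).contDiff.contDiffAt.comp q
    ((contDiffAt_dcForm (m := ∞) hF (by simp)).fderiv_right (m := ∞) (by simp)))

theorem extDeriv_iddbarForm {F : C3 → ℝ} {q : C3} (hF : ContDiffAt ℝ ∞ F q) :
    extDeriv (iddbarForm F) q = 0 :=
  extDeriv_extDeriv_apply (contDiffAt_dcForm (m := ∞) hF (by simp))
    (by rw [minSmoothness_of_isRCLikeNormedField]; exact two_le_infty)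

theorem iddbarForm_congr {F G : C3 → ℝ} {q : C3} (h : F =ᶠ[𝓝 q] G) :
    iddbarForm F q = iddbarForm G q := by
  refine Filter.EventuallyEq.extDeriv_eq ?_
  filter_upwards [h.eventuallyEq_nhds] with x hx
  simp only [dcForm, hx.fderiv_eq]

/-- The exterior derivative antisymmetrises `D²F (w, i v)`; symmetry of the second derivative puts
the result into the form of `iddbar`. -/
theorem iddbarForm_apply {F : C3 → ℝ} {q : C3} (hF : ContDiffAt ℝ 2 F q) (a b : C3) :
    iddbarForm F q ![a, b] = iddbar F q a b := by
  have h1 : DifferentiableAt ℝ (dcForm F) q :=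
    (contDiffAt_dcForm (m := 1) hF (by norm_num)).differentiableAt (by simp)
  have h2 : DifferentiableAt ℝ (fderiv ℝ F) q :=
    (hF.fderiv_right (m := 1) (by norm_num)).differentiableAt (by simp)
  have key : ∀ v w : C3, fderiv ℝ (fun x => -(1 / 2 : ℝ) * fderiv ℝ F x (Complex.I • v)) q w
      = -(1 / 2) * fderiv ℝ (fderiv ℝ F) q w (Complex.I • v) := by
    intro v w
    have := ((h2.hasFDerivAt.clm_apply (hasFDerivAt_const (Complex.I • v) q)).const_mul
      (-(1 / 2 : ℝ))).fderiv
    rw [this]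
    simp
  have hs : IsSymmSndFDerivAt ℝ F q := hF.isSymmSndFDerivAt (by simp)
  rw [iddbarForm, extDeriv_apply h1]
  simp only [dcForm_apply, Fin.removeNth, key, iddbar]
  simp
  rw [hs.eq b (Complex.I • a)]
  ring

/-- `F` is smooth and `Φ` is holomorphic near a point. -/
theorem iddbarForm_comp {F : C3 → ℝ} {Φ : C3 → C3} {q : C3} (hF : ContDiffAt ℝ ∞ F (Φ q))
    (hΦ : ContDiffAt ℂ ∞ Φ q) :
    iddbarForm (F ∘ Φ) q = (iddbarForm F (Φ q)).compContinuousLinearMap (fderiv ℝ Φ q) := by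
  have hΦr : ContDiffAt ℝ ∞ Φ q := hΦ.restrict_scalars ℝ
  have h1 : ∀ᶠ x in 𝓝 q, DifferentiableAt ℂ Φ x := by
    filter_upwards [(hΦ.of_le (m := 1) (by exact_mod_cast le_top)).eventually (by simp)] with x hx
    exact hx.differentiableAt (by simp)
  have h2 : ∀ᶠ x in 𝓝 q, DifferentiableAt ℝ F (Φ x) := by
    have : ∀ᶠ y in 𝓝 (Φ q), DifferentiableAt ℝ F y := by
      filter_upwards [(hF.of_le (m := 1) (by exact_mod_cast le_top)).eventually (by simp)] with x hx
      exact hx.differentiableAt (by simp)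
    exact hΦ.continuousAt.eventually this
  -- The derivative of `Φ` commutes with multiplication by `i`, so already the one-form is natural;
  -- the exterior derivative commutes with pullbacks.
  have : dcForm (F ∘ Φ) =ᶠ[𝓝 q]
      fun x => (dcForm F (Φ x)).compContinuousLinearMap (fderiv ℝ Φ x) := by
    filter_upwards [h1, h2] with x hx hx'
    ext v
    simp only [ContinuousAlternatingMap.compContinuousLinearMap_apply, dcForm_apply]
    rw [fderiv_comp x hx' (hx.restrictScalars ℝ)]
    simp [hx.fderiv_restrictScalars ℝ]
  rw [iddbarForm, this.extDeriv_eq, extDeriv_pullback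
    ((contDiffAt_dcForm (m := 1) hF (by rw [one_add_one_eq_two]; exact two_le_infty)).differentiableAt (by simp)) hΦr
      (by rw [minSmoothness_of_isRCLikeNormedField]; exact two_le_infty)]
  rfl

/-! ### The Levi form in a fixed direction -/

/-- The first derivatives of `f` at `q` along `a` and `i a` are the real and (up to sign) imaginary
part of `p`, and the Levi form of `f` at `q` takes the value `L` on `a`. -/
structure HasLevi (f : C3 → ℝ) (q a : C3) (p : ℂ) (L : ℝ) : Prop where
  contDiffAt : ContDiffAt ℝ 2 f q
  fderiv_re : fderiv ℝ f q a = p.re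
  fderiv_im : fderiv ℝ f q (Complex.I • a) = -p.im
  iddbar_eq : iddbar f q a (Complex.I • a) = L

theorem iddbar_diag (f : C3 → ℝ) (q a : C3) : iddbar f q a (Complex.I • a) =
    (fderiv ℝ (fderiv ℝ f) q (Complex.I • a) (Complex.I • a)
      + fderiv ℝ (fderiv ℝ f) q a a) / 2 := by
  simp [iddbar, smul_smul]

theorem _root_.ContDiffAt.eventually_differentiableAt {E F : Type*} [NormedAddCommGroup E]
    [NormedSpace ℝ E] [NormedAddCommGroup F] [NormedSpace ℝ F] {f : E → F} {q : E}
    (h : ContDiffAt ℝ 2 f q) : ∀ᶠ x in 𝓝 q, DifferentiableAt ℝ f x := by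
  filter_upwards [h.eventually (by simp)] with x hx
  exact hx.differentiableAt (by simp)

theorem _root_.ContDiffAt.differentiableAt_fderiv {E F : Type*} [NormedAddCommGroup E]
    [NormedSpace ℝ E] [NormedAddCommGroup F] [NormedSpace ℝ F] {f : E → F} {q : E}
    (h : ContDiffAt ℝ 2 f q) : DifferentiableAt ℝ (fderiv ℝ f) q :=
  (h.fderiv_right (m := 1) (by norm_num)).differentiableAt (by simp)

namespace HasLevi

variable {f g : C3 → ℝ} {q a : C3} {p p' : ℂ} {L L' : ℝ}

theorem congr (hf : HasLevi f q a p L) (h : g =ᶠ[𝓝 q] f) : HasLevi g q a p L := by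
  have h2 : fderiv ℝ g =ᶠ[𝓝 q] fderiv ℝ f := h.fderiv
  refine ⟨hf.1.congr_of_eventuallyEq h, ?_, ?_, ?_⟩
  · rw [h.fderiv_eq, hf.2]
  · rw [h.fderiv_eq, hf.3]
  · rw [iddbar, h2.fderiv_eq]; exact hf.4

theorem congr_val (hf : HasLevi f q a p L) (hp : p' = p) (hL : L' = L) : HasLevi f q a p' L' := by
  rw [hp, hL]; exact hf

/-- The cross terms of the second derivatives along `a` and `i a` are products of first derivatives,
and their sum is the real part of `p * conj p'`. -/
theorem mul (hf : HasLevi f q a p L) (hg : HasLevi g q a p' L') :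
    HasLevi (fun x => f x * g x) q a (f q * p' + g q * p)
      (f q * L' + g q * L + (p * conj p').re) := by
  have h1 : ∀ v, fderiv ℝ (fun x => f x * g x) q v = f q * fderiv ℝ g q v + g q * fderiv ℝ f q v := by
    intro v
    have := ((hf.1.differentiableAt (by simp)).hasFDerivAt.mul
      (hg.1.differentiableAt (by simp)).hasFDerivAt).fderiv
    change fderiv ℝ (f * g) q v = _
    rw [this]; simp
  have h2 : ∀ v, fderiv ℝ (fderiv ℝ (fun x => f x * g x)) q v v = f q * fderiv ℝ (fderiv ℝ g) q v v
      + g q * fderiv ℝ (fderiv ℝ f) q v v + 2 * (fderiv ℝ f q v * fderiv ℝ g q v) := by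
    intro v
    have e : fderiv ℝ (fun x => f x * g x) =ᶠ[𝓝 q]
        fun x => f x • fderiv ℝ g x + g x • fderiv ℝ f x := by
      filter_upwards [hf.1.eventually_differentiableAt, hg.1.eventually_differentiableAt] with x h h'
      exact (h.hasFDerivAt.mul h'.hasFDerivAt).fderiv
    have := (((hf.1.differentiableAt (by simp)).hasFDerivAt.smul
      hg.1.differentiableAt_fderiv.hasFDerivAt).add ((hg.1.differentiableAt (by simp)).hasFDerivAt.smul
      hf.1.differentiableAt_fderiv.hasFDerivAt)).fderiv
    rw [e.fderiv_eq]
    erw [this]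
    simp
    ring
  refine ⟨hf.1.mul hg.1, ?_, ?_, ?_⟩
  · rw [h1, hf.2, hg.2]; simp
  · rw [h1, hf.3, hg.3]; simp; ring
  · have e1 := hf.4
    have e2 := hg.4
    rw [iddbar_diag] at e1 e2 ⊢
    rw [h2, h2, ← e1, ← e2, hf.2, hg.2, hf.3, hg.3]
    simp
    ring

theorem add (hf : HasLevi f q a p L) (hg : HasLevi g q a p' L') :
    HasLevi (fun x => f x + g x) q a (p + p') (L + L') := by
  have hd := hf.1.differentiableAt (n := 2) (by simp)
  have hd' := hg.1.differentiableAt (n := 2) (by simp)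
  have e : fderiv ℝ (fun x => f x + g x) =ᶠ[𝓝 q] fun x => fderiv ℝ f x + fderiv ℝ g x := by
    filter_upwards [hf.1.eventually_differentiableAt, hg.1.eventually_differentiableAt] with x h h'
    exact (h.hasFDerivAt.add h'.hasFDerivAt).fderiv
  refine ⟨hf.1.add hg.1, ?_, ?_, ?_⟩
  · rw [e.eq_of_nhds]; simp [hf.2, hg.2]
  · rw [e.eq_of_nhds]; simp [hf.3, hg.3]; ring
  · have e1 := hf.4
    have e2 := hg.4
    rw [iddbar_diag] at e1 e2 ⊢
    have := (hf.1.differentiableAt_fderiv.hasFDerivAt.add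
      hg.1.differentiableAt_fderiv.hasFDerivAt).fderiv
    rw [e.fderiv_eq, ← e1, ← e2]
    erw [this]
    simp
    ring

theorem const (c : ℝ) : HasLevi (fun _ => c) q a 0 0 := by
  refine ⟨contDiffAt_const, by simp, by simp, ?_⟩
  rw [iddbar_diag]
  simp

theorem const_mul (c : ℝ) (hf : HasLevi f q a p L) :
    HasLevi (fun x => c * f x) q a (c * p) (c * L) :=
  ((const c).mul hf).congr_val (by simp) (by simp)

theorem sub (hf : HasLevi f q a p L) (hg : HasLevi g q a p' L') :
    HasLevi (fun x => f x - g x) q a (p - p') (L - L') := by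
  have := (hf.add (hg.const_mul (-1))).congr_val (p' := p - p') (L' := L - L')
    (by push_cast; ring) (by ring)
  exact this.congr (Eventually.of_forall fun x => by ring)

theorem comp {h : ℝ → ℝ} (hh : ContDiffAt ℝ 2 h (f q)) (hf : HasLevi f q a p L) :
    HasLevi (fun x => h (f x)) q a (deriv h (f q) * p)
      (deriv h (f q) * L + deriv (deriv h) (f q) * (‖p‖ ^ 2 / 2)) := by
  have hd := hf.1.differentiableAt (n := 2) (by simp)
  have e : fderiv ℝ (fun x => h (f x)) =ᶠ[𝓝 q] fun x => deriv h (f x) • fderiv ℝ f x := by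
    filter_upwards [hf.1.eventually_differentiableAt,
      hf.1.continuousAt.eventually hh.eventually_differentiableAt] with x h1 h2
    exact (h2.hasDerivAt.comp_hasFDerivAt x h1.hasFDerivAt).fderiv
  have hh2 : DifferentiableAt ℝ (deriv h) (f q) := by
    have := hh.differentiableAt_fderiv
    exact this.clm_apply (differentiableAt_const 1)
  have h2 : ∀ v, fderiv ℝ (fderiv ℝ (fun x => h (f x))) q v v
      = deriv h (f q) * fderiv ℝ (fderiv ℝ f) q v v
        + deriv (deriv h) (f q) * (fderiv ℝ f q v) ^ 2 := by
    intro v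
    have := ((hh2.hasDerivAt.comp_hasFDerivAt q hd.hasFDerivAt).smul
      hf.1.differentiableAt_fderiv.hasFDerivAt).fderiv
    rw [e.fderiv_eq]
    erw [this]
    simp
    ring
  refine ⟨hh.comp q hf.1, ?_, ?_, ?_⟩
  · rw [e.eq_of_nhds]; simp [hf.2]
  · rw [e.eq_of_nhds]; simp [hf.3]
  · have e1 := hf.4
    rw [iddbar_diag] at e1 ⊢
    rw [h2, h2, ← e1, hf.2, hf.3, ← Complex.normSq_eq_norm_sq, Complex.normSq_apply]
    ring

end HasLevi

/-- The Levi form of the absolute value squared of a holomorphic function. -/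
theorem hasLevi_norm_sq {h : C3 → ℂ} {q : C3} (hh : ContDiffAt ℂ 2 h q) (a : C3) :
    HasLevi (fun x => ‖h x‖ ^ 2) q a (2 * conj (h q) * fderiv ℂ h q a)
      (2 * ‖fderiv ℂ h q a‖ ^ 2) := by
  have hr : ContDiffAt ℝ 2 h q := hh.restrict_scalars ℝ
  have hd : ∀ᶠ x in 𝓝 q, DifferentiableAt ℂ h x := by
    filter_upwards [hh.eventually (by simp)] with x hx
    exact hx.differentiableAt (by simp)
  have hdd : DifferentiableAt ℂ (fderiv ℂ h) q :=
    (hh.fderiv_right (m := 1) (by norm_num)).differentiableAt (by simp)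
  have hfun : (fun x => ‖h x‖ ^ 2) = fun x => (h x).re * (h x).re + (h x).im * (h x).im := by
    funext x
    rw [← Complex.normSq_eq_norm_sq, Complex.normSq_apply]
  -- A real linear function of a holomorphic function is pluriharmonic, as `D²h (i a, i a) = -D²h
  -- (a, a)`. In `|h|² = (re h)² + (im h)²` only the cross terms of the product rule survive.
  have base : ∀ (ℓ : ℂ →L[ℝ] ℝ), HasLevi (fun x => ℓ (h x)) q a
      (ℓ (fderiv ℂ h q a) - Complex.I * ℓ (Complex.I * fderiv ℂ h q a)) 0 := by
    intro ℓ
    have e : fderiv ℝ (fun x => ℓ (h x)) =ᶠ[𝓝 q]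
        fun x => ℓ.comp ((fderiv ℂ h x).restrictScalars ℝ) := by
      filter_upwards [hd] with x hx
      exact (ℓ.hasFDerivAt.comp x (hx.hasFDerivAt.restrictScalars ℝ)).fderiv
    refine ⟨ℓ.contDiff.contDiffAt.comp q hr, ?_, ?_, ?_⟩
    · rw [e.eq_of_nhds]; simp
    · rw [e.eq_of_nhds]; simp
    · rw [iddbar_diag, e.fderiv_eq]
      have h3 : ∀ v : C3, fderiv ℝ (fun x => ℓ.comp ((fderiv ℂ h x).restrictScalars ℝ)) q v v
          = ℓ (fderiv ℂ (fderiv ℂ h) q v v) := by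
        intro v
        have h4 : HasFDerivAt (fun x => (fderiv ℂ h x).restrictScalars ℝ)
            ((ContinuousLinearMap.restrictScalarsL ℂ C3 ℂ ℝ ℝ).comp
              ((fderiv ℂ (fderiv ℂ h) q).restrictScalars ℝ)) q :=
          (ContinuousLinearMap.restrictScalarsL ℂ C3 ℂ ℝ ℝ).hasFDerivAt.comp q
            (hdd.hasFDerivAt.restrictScalars ℝ)
        have := ((hasFDerivAt_const ℓ q).clm_comp h4).fderiv
        rw [this]
        simp
      rw [h3, h3]
      simp [← mul_assoc]
  rw [hfun]
  refine (((base Complex.reCLM).mul (base Complex.reCLM)).add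
    ((base Complex.imCLM).mul (base Complex.imCLM))).congr_val ?_ ?_
  · apply Complex.ext <;> simp <;> ring
  · rw [← Complex.normSq_eq_norm_sq, Complex.normSq_apply]
    simp
    ring

end BananaMirror
end

noncomputable section

namespace BananaMirror

open scoped ContDiff Topology
open Filter

/-! ### Existence of admissible bump functions -/

/-- Both derivatives are continuous and vanish outside `[0, 1]`. -/
theorem exists_bound_smoothTransition : ∃ M : ℝ, 0 < M ∧
    (∀ t, |deriv Real.smoothTransition t| ≤ M) ∧
    ∀ t, |deriv (deriv Real.smoothTransition) t| ≤ M := by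
  have hc : ContDiff ℝ ∞ Real.smoothTransition := Real.smoothTransition.contDiff (n := ⊤)
  have h1 : ContDiff ℝ ∞ (deriv Real.smoothTransition) :=
    ((contDiff_succ_iff_deriv (n := ∞)).1 (by simpa using hc)).2.2
  have h2 : ContDiff ℝ ∞ (deriv (deriv Real.smoothTransition)) :=
    ((contDiff_succ_iff_deriv (n := ∞)).1 (by simpa using h1)).2.2
  have e0 : ∀ t : ℝ, t < 0 → Real.smoothTransition =ᶠ[𝓝 t] fun _ => 0 := by
    intro t ht
    filter_upwards [eventually_lt_nhds ht] with s hs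
    exact Real.smoothTransition.zero_of_nonpos hs.le
  have e1 : ∀ t : ℝ, 1 < t → Real.smoothTransition =ᶠ[𝓝 t] fun _ => 1 := by
    intro t ht
    filter_upwards [eventually_gt_nhds ht] with s hs
    exact Real.smoothTransition.one_of_one_le hs.le
  have d1 : ∀ t : ℝ, t < 0 ∨ 1 < t → deriv Real.smoothTransition =ᶠ[𝓝 t] fun _ => 0 := by
    rintro t (ht | ht)
    · exact (e0 t ht).deriv.trans (Eventually.of_forall fun _ => by simp)
    · exact (e1 t ht).deriv.trans (Eventually.of_forall fun _ => by simp)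
  obtain ⟨M₁, hM₁⟩ := isCompact_Icc.exists_bound_of_continuousOn
    (h1.continuous.continuousOn (s := Set.Icc (0 : ℝ) 1))
  obtain ⟨M₂, hM₂⟩ := isCompact_Icc.exists_bound_of_continuousOn
    (h2.continuous.continuousOn (s := Set.Icc (0 : ℝ) 1))
  refine ⟨max 1 (max M₁ M₂), by positivity, fun t => ?_, fun t => ?_⟩
  · by_cases ht : t ∈ Set.Icc (0 : ℝ) 1
    · exact (hM₁ t ht).trans (by simp)
    · have : t < 0 ∨ 1 < t := by
        by_contra! h; exact ht h
      rw [(d1 t this).eq_of_nhds]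
      simp
  · by_cases ht : t ∈ Set.Icc (0 : ℝ) 1
    · exact (hM₂ t ht).trans (by simp)
    · have : t < 0 ∨ 1 < t := by
        by_contra! h; exact ht h
      rw [(d1 t this).deriv_eq]
      simp

/-- The profile is `Real.smoothTransition` in the variable `τ = log (t / (2 s₀)) / Λ`, for which `t
d/dt = Λ⁻¹ d/dτ`. Here `Λ` is the logarithmic length of `[2 s₀, s₁ / 2]`, so each logarithmic
derivative gains a factor `1 / Λ ≤ 1 / (lam * l)`. -/
theorem exists_logStep {M : ℝ} (hM1 : ∀ t, |deriv Real.smoothTransition t| ≤ M)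
    (hM2 : ∀ t, |deriv (deriv Real.smoothTransition) t| ≤ M) {u v s₀ s₁ K l lam : ℝ}
    (huv : u ≤ v) (huv' : v ≤ u + 1) (hs₀ : 0 < s₀) (hs₁ : 0 < s₁) (hl : 0 < l) (hlam : 0 < lam)
    (hlog : lam * l ≤ Real.log (s₁ / (4 * s₀))) (hK : M / lam ≤ K) (hK2 : M / lam ^ 2 ≤ K) :
    ∃ f, LogStep f u v s₀ s₁ K l ∧ ∀ t ≤ 2 * s₀, f t = u := by
  set Λ := Real.log (s₁ / (4 * s₀)) with hΛ
  have hΛ0 : 0 < Λ := lt_of_lt_of_le (by positivity) hlog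
  set τ : ℝ → ℝ := fun t => Real.log (t / (2 * s₀)) / Λ with hτ
  set f : ℝ → ℝ := fun t => if t ≤ 2 * s₀ then u else u + (v - u) * Real.smoothTransition (τ t)
    with hf
  have hlow : ∀ t ≤ 2 * s₀, f t = u := fun t ht => by simp [hf, ht]
  have hpos : ∀ t, 0 < t → f t = u + (v - u) * Real.smoothTransition (τ t) := by
    intro t ht
    by_cases h : t ≤ 2 * s₀
    · rw [hlow t h, Real.smoothTransition.zero_of_nonpos]
      · ring
      · apply div_nonpos_of_nonpos_of_nonneg _ hΛ0.le
        exact Real.log_nonpos (by positivity) (by rw [div_le_one (by positivity)]; exact h)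
    · simp [hf, h]
  have hdτ : ∀ t, 0 < t → HasDerivAt τ (1 / (t * Λ)) t := by
    intro t ht
    have := (((hasDerivAt_id t).div_const (2 * s₀)).log (by simp; constructor <;> positivity)).div_const Λ
    refine this.congr_deriv ?_
    simp
    field_simp
  have hST : ContDiff ℝ ∞ Real.smoothTransition := Real.smoothTransition.contDiff (n := ⊤)
  have hST1 : ContDiff ℝ ∞ (deriv Real.smoothTransition) :=
    ((contDiff_succ_iff_deriv (n := ∞)).1 (by simpa using hST)).2.2
  have hd : ∀ t, 0 < t → t * deriv f t = (v - u) / Λ * deriv Real.smoothTransition (τ t) := by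
    intro t ht
    have e : f =ᶠ[𝓝 t] fun t => u + (v - u) * Real.smoothTransition (τ t) := by
      filter_upwards [eventually_gt_nhds ht] with s hs using hpos s hs
    have h1 : HasDerivAt Real.smoothTransition (deriv Real.smoothTransition (τ t)) (τ t) :=
      (hST.differentiable (by simp) _).hasDerivAt
    have := ((h1.comp t (hdτ t ht)).const_mul (v - u)).const_add u
    rw [e.deriv_eq]
    erw [this.deriv]
    field_simp
  have hd2 : ∀ t, 0 < t → t * deriv (fun s => s * deriv f s) t
      = (v - u) / Λ ^ 2 * deriv (deriv Real.smoothTransition) (τ t) := by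
    intro t ht
    have e : (fun s => s * deriv f s) =ᶠ[𝓝 t]
        fun t => (v - u) / Λ * deriv Real.smoothTransition (τ t) := by
      filter_upwards [eventually_gt_nhds ht] with s hs using hd s hs
    have h1 : HasDerivAt (deriv Real.smoothTransition) (deriv (deriv Real.smoothTransition) (τ t))
        (τ t) := (hST1.differentiable (by simp) _).hasDerivAt
    have := (h1.comp t (hdτ t ht)).const_mul ((v - u) / Λ)
    rw [e.deriv_eq]
    erw [this.deriv]
    field_simp
  have hvu : |v - u| ≤ 1 := by rw [abs_of_nonneg (by linarith)]; linarith
  have hM0 : 0 ≤ M := (abs_nonneg _).trans (hM1 0)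
  refine ⟨f, ⟨?_, ?_, fun t _ ht => hlow t ht, ?_, ?_, ?_⟩, hlow⟩
  · rw [contDiff_iff_contDiffAt]
    intro t
    by_cases ht : t < 2 * s₀
    · refine (contDiffAt_const (c := u)).congr_of_eventuallyEq ?_
      filter_upwards [eventually_lt_nhds ht] with s hs using hlow s hs.le
    · have ht0 : 0 < t := by linarith
      have : ContDiffAt ℝ ∞ (fun t => u + (v - u) * Real.smoothTransition (τ t)) t := by
        have h1 : ContDiffAt ℝ ∞ τ t := by
          refine ContDiffAt.div_const (ContDiffAt.log (by fun_prop) ?_) _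
          positivity
        exact contDiffAt_const.add (contDiffAt_const.mul (hST.contDiffAt.comp t h1))
      refine this.congr_of_eventuallyEq ?_
      filter_upwards [eventually_gt_nhds ht0] with s hs using hpos s hs
  · intro s t hst
    by_cases hs : s ≤ 2 * s₀
    · rw [hlow s hs]
      by_cases ht : t ≤ 2 * s₀
      · rw [hlow t ht]
      · rw [hpos t (by linarith)]
        have := Real.smoothTransition.nonneg (τ t)
        nlinarith
    · have hs0 : 0 < s := by linarith
      rw [hpos s hs0, hpos t (by linarith)]
      have h1 : τ s ≤ τ t := by
        apply div_le_div_of_nonneg_right _ hΛ0.le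
        apply Real.log_le_log (by positivity)
        gcongr
      have := Real.smoothTransition.monotone h1
      nlinarith
  · intro t ht
    rw [hpos t (by linarith), Real.smoothTransition.one_of_one_le]
    · ring
    · rw [hτ, one_le_div hΛ0, hΛ]
      apply Real.log_le_log (by positivity)
      rw [div_le_div_iff₀ (by positivity) (by positivity)]
      nlinarith
  · intro t ht
    rw [hd t ht, abs_mul, abs_div, abs_of_pos hΛ0]
    calc |v - u| / Λ * |deriv Real.smoothTransition (τ t)| ≤ 1 / (lam * l) * M := by
          gcongr
          exact hM1 _
      _ = M / lam / l := by field_simp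
      _ ≤ K / l := by gcongr
  · intro t ht
    rw [hd2 t ht, abs_mul, abs_div, abs_of_pos (pow_pos hΛ0 2)]
    calc |v - u| / Λ ^ 2 * |deriv (deriv Real.smoothTransition) (τ t)| ≤ 1 / (lam * l) ^ 2 * M := by
          gcongr
          exact hM2 _
      _ = M / lam ^ 2 / l ^ 2 := by field_simp
      _ ≤ K / l ^ 2 := by gcongr

/-- The odd function `f t - f (-t)` agrees with `f` for `t > 0`, because `f` vanishes on the
negative axis. -/
theorem exists_oddStep {f : ℝ → ℝ} {v s₀ s₁ K l : ℝ} (hs₀ : 0 < s₀) (hs₁ : 0 < s₁)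
    (hf : LogStep f 0 v s₀ s₁ K l) (hlow : ∀ t ≤ 2 * s₀, f t = 0) :
    ∃ h, LogStep h 0 v s₀ s₁ K l ∧ ∀ t, h (-t) = -h t := by
  have hp : ∀ t, 0 < t → f t - f (-t) = f t := fun t ht => by
    rw [hlow (-t) (by linarith), sub_zero]
  have he : ∀ t, 0 < t → (fun t => f t - f (-t)) =ᶠ[𝓝 t] f := fun t ht => by
    filter_upwards [eventually_gt_nhds ht] with s hs using hp s hs
  refine ⟨fun t => f t - f (-t), ⟨?_, ?_, ?_, ?_, ?_, ?_⟩, fun t => by simp⟩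
  · exact hf.smooth.sub (hf.smooth.comp contDiff_neg)
  · intro s t hst
    have h1 := hf.mono hst
    have h2 := hf.mono (neg_le_neg hst)
    simp only
    linarith
  · intro t ht h2
    rw [hlow t h2, hlow (-t) (by linarith), sub_zero]
  · intro t ht
    rw [hp t (by linarith), hf.high t ht]
  · intro t ht
    rw [(he t ht).deriv_eq]
    exact hf.deriv_le t ht
  · intro t ht
    have : (fun s => s * deriv (fun t => f t - f (-t)) s) =ᶠ[𝓝 t] fun s => s * deriv f s := by
      filter_upwards [(he t ht).deriv] with s hs
      rw [hs]
    rw [this.deriv_eq]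
    exact hf.deriv2_le t ht

theorem exists_angularStep {M : ℝ} (hM1 : ∀ t, |deriv Real.smoothTransition t| ≤ M)
    (hM2 : ∀ t, |deriv (deriv Real.smoothTransition) t| ≤ M) {a b K l lam : ℝ}
    (hl : 0 < l) (hlam : 0 < lam)
    (hlog : lam * l ≤ b - a) (hK : M / lam ≤ K) (hK2 : M / lam ^ 2 ≤ K) :
    ∃ f : ℝ → ℝ, ContDiff ℝ (⊤ : ℕ∞) f ∧ Monotone f ∧ (∀ t ≤ a, f t = 0) ∧ (∀ t, b ≤ t → f t = 1) ∧
      (∀ t, |deriv f t| ≤ K / l) ∧ ∀ t, |deriv (deriv f) t| ≤ K / l ^ 2 := by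
  set Λ := b - a
  have hΛ0 : 0 < Λ := lt_of_lt_of_le (by positivity) hlog
  have hST : ContDiff ℝ ∞ Real.smoothTransition := Real.smoothTransition.contDiff (n := ⊤)
  have hST1 : ContDiff ℝ ∞ (deriv Real.smoothTransition) :=
    ((contDiff_succ_iff_deriv (n := ∞)).1 (by simpa using hST)).2.2
  have hτ : ∀ t, HasDerivAt (fun t => (t - a) / Λ) (1 / Λ) t := fun t =>
    ((hasDerivAt_id t).sub_const a).div_const Λ
  have hd : deriv (fun t => Real.smoothTransition ((t - a) / Λ))
      = fun t => deriv Real.smoothTransition ((t - a) / Λ) * (1 / Λ) := by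
    funext t
    exact ((hST.differentiable (by simp) _).hasDerivAt.comp t (hτ t)).deriv
  have hd2 : ∀ t, deriv (deriv (fun t => Real.smoothTransition ((t - a) / Λ))) t
      = deriv (deriv Real.smoothTransition) ((t - a) / Λ) * (1 / Λ) * (1 / Λ) := by
    intro t
    rw [hd]
    exact (((hST1.differentiable (by simp) _).hasDerivAt.comp t (hτ t)).mul_const (1 / Λ)).deriv
  have hM0 : 0 ≤ M := (abs_nonneg _).trans (hM1 0)
  refine ⟨fun t => Real.smoothTransition ((t - a) / Λ), ?_, ?_, ?_, ?_, ?_, ?_⟩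
  · exact hST.comp (by fun_prop)
  · intro s t hst
    exact Real.smoothTransition.monotone (by gcongr)
  · intro t ht
    exact Real.smoothTransition.zero_of_nonpos
      (div_nonpos_of_nonpos_of_nonneg (by linarith) hΛ0.le)
  · intro t ht
    exact Real.smoothTransition.one_of_one_le ((one_le_div hΛ0).2 (by simp only [Λ]; linarith))
  · intro t
    rw [hd, abs_mul, abs_of_pos (by positivity : 0 < 1 / Λ)]
    calc |deriv Real.smoothTransition ((t - a) / Λ)| * (1 / Λ) ≤ M * (1 / (lam * l)) := by
          gcongr
          exact hM1 _
      _ = M / lam / l := by field_simp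
      _ ≤ K / l := by gcongr
  · intro t
    rw [hd2, abs_mul, abs_mul, abs_of_pos (by positivity : 0 < 1 / Λ)]
    calc |deriv (deriv Real.smoothTransition) ((t - a) / Λ)| * (1 / Λ) * (1 / Λ)
          ≤ M * (1 / (lam * l)) * (1 / (lam * l)) := by
          gcongr
          exact hM2 _
      _ = M / lam ^ 2 / l ^ 2 := by field_simp
      _ ≤ K / l ^ 2 := by gcongr

theorem exists_admissible {T p : ℝ} (hT0 : 0 < T) (hT1 : T < 1) (hp : 0 < p) :
    ∃ K₀ : ℝ, 0 < K₀ ∧ ∀ K ≥ K₀, ∃ l₀ : ℝ, ∀ l ≥ l₀, ∃ α : Bumps, α.Admissible T p l K := by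
  obtain ⟨M, hM0, hM1, hM2⟩ := exists_bound_smoothTransition
  have hlogT : Real.log T < 0 := Real.log_neg hT0 hT1
  -- In this unit the three kinds of transition have logarithmic lengths `4 lam l`, `4 lam l - p
  -- lam` and `2 lam l`, each minus `log 4`. All are at least `lam l` once `lam l ≥ log 4 + p lam`.
  set lam := -Real.log T / (2 * p) with hlam
  have hlam0 : 0 < lam := div_pos (by linarith) (by positivity)
  have hlamp : -Real.log T = 2 * p * lam := by rw [hlam]; field_simp
  refine ⟨max (M / lam) (M / lam ^ 2), by positivity, fun K hK => ?_⟩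
  have hK1 := (le_max_left _ _).trans hK
  have hK2 := (le_max_right _ _).trans hK
  refine ⟨max 1 ((Real.log 4 + p * lam) / lam), fun l hl => ?_⟩
  have hl1 : 1 ≤ l := (le_max_left _ _).trans hl
  have hl2 : Real.log 4 + p * lam ≤ l * lam := by
    have := (le_max_right _ _).trans hl
    rwa [div_le_iff₀ hlam0] at this
  have hl0 : 0 < l := by linarith
  have logpow : ∀ x y : ℝ, Real.log (T ^ x / (4 * T ^ y)) = (y - x) * (2 * p * lam) - Real.log 4 := by
    intro x y
    rw [Real.log_div (by positivity) (by positivity), Real.log_mul (by positivity) (by positivity),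
      Real.log_rpow hT0, Real.log_rpow hT0, ← hlamp]
    ring
  have h4 : 0 < Real.log 4 := Real.log_pos (by norm_num)
  have hlp : 2 * l / p * (2 * p * lam) = 4 * (l * lam) := by field_simp; ring
  have hrad : lam * l ≤ Real.log (T ^ (2 + l / 2 - 2 * l / p) / (4 * T ^ (2 + l / 2))) := by
    rw [logpow]
    have : (2 + l / 2 - (2 + l / 2 - 2 * l / p)) * (2 * p * lam) = 4 * (l * lam) := by
      rw [← hlp]; ring
    rw [this]
    nlinarith
  have hang : lam * l ≤
      Real.log (T ^ (2 + 3 * l / 4 - 2 * l / p) / (4 * T ^ (3 / 2 + 3 * l / 4))) := by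
    rw [logpow]
    have : (3 / 2 + 3 * l / 4 - (2 + 3 * l / 4 - 2 * l / p)) * (2 * p * lam)
        = 4 * (l * lam) - p * lam := by
      rw [← hlp]; ring
    rw [this]
    nlinarith
  have hsix : lam * l ≤ Real.log (T ^ (l / 8 - 2 * l / p) / 2) - Real.log (2 * T ^ (l / 8 - l / p)) := by
    rw [← Real.log_div (by positivity) (by positivity)]
    have e : T ^ (l / 8 - 2 * l / p) / 2 / (2 * T ^ (l / 8 - l / p))
        = T ^ (l / 8 - 2 * l / p) / (4 * T ^ (l / 8 - l / p)) := by
      field_simp; norm_num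
    rw [e, logpow]
    have : (l / 8 - l / p - (l / 8 - 2 * l / p)) * (2 * p * lam) = 2 * (l * lam) := by
      have : (l / 8 - l / p - (l / 8 - 2 * l / p)) = l / p := by ring
      rw [this]; field_simp
    rw [this]
    nlinarith
  obtain ⟨f₃, hf₃, hn₃⟩ := exists_logStep hM1 hM2 (u := 2 / 3) (v := 1) (by norm_num) (by norm_num)
    (Real.rpow_pos_of_pos hT0 _) (Real.rpow_pos_of_pos hT0 _) hl0 hlam0 hrad hK1 hK2
  obtain ⟨f₅, hf₅, hn₅⟩ := exists_logStep hM1 hM2 (u := 0) (v := 1) (by norm_num) (by norm_num)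
    (Real.rpow_pos_of_pos hT0 _) (Real.rpow_pos_of_pos hT0 _) hl0 hlam0 hrad hK1 hK2
  obtain ⟨f₄, hf₄, hn₄⟩ := exists_logStep hM1 hM2 (u := 0) (v := 1 / 2) (by norm_num) (by norm_num)
    (Real.rpow_pos_of_pos hT0 _) (Real.rpow_pos_of_pos hT0 _) hl0 hlam0 hang hK1 hK2
  obtain ⟨h₄, hh₄, hodd⟩ := exists_oddStep (Real.rpow_pos_of_pos hT0 _) (Real.rpow_pos_of_pos hT0 _)
    hf₄ hn₄
  obtain ⟨f₆, h61, h62, h63, h64, h65, h66⟩ := exists_angularStep hM1 hM2 hl0 hlam0 hsix hK1 hK2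
  have hpos : 0 < T ^ (2 + l / 2) := Real.rpow_pos_of_pos hT0 _
  exact ⟨⟨f₃, h₄, f₅, f₆⟩, hf₃, fun t ht => hn₃ t (by linarith), hf₅,
    fun t ht => hn₅ t (by linarith), hh₄, hodd, h61, h62, h63, h64, h65, h66⟩

end BananaMirror
end

noncomputable section

namespace BananaMirror

open scoped ContDiff Topology
open Filter

/-! ### The scales on which the bump functions vary -/

/-- The relations between the scales `k₁, k₂` (of the quotients of two coordinates), `s₀, s₁` (of
the radial coordinates), `r₀, r₁` (of the angular coordinates) and `u` (of `|T³ v₀|²`). -/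
structure Scales (k₁ k₂ s₀ s₁ r₀ r₁ u : ℝ) : Prop where
  k₁_pos : 0 < k₁
  k₁_le : k₁ ≤ k₂ / 10 ^ 12
  k₂_le : k₂ ≤ 1 / 10 ^ 12
  s₀_pos : 0 < s₀
  s₀_le : s₀ ≤ s₁ / 10 ^ 12
  s₁_le : s₁ ≤ 1 / 10 ^ 12
  r₀_pos : 0 < r₀
  r₁_eq : r₁ = k₁ ^ 2 * s₀
  u_le : u ≤ s₀ * r₁ ^ 2 / 10 ^ 12
  u_le' : u ≤ s₀ * r₀ ^ 2

theorem exists_scales {T p : ℝ} (hT0 : 0 < T) (hT1 : T < 1) (hp : 16 < p) :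
    ∃ l₀ : ℝ, ∀ l ≥ l₀, Scales (T ^ (l / 8 - l / p)) (T ^ (l / 8 - 2 * l / p)) (T ^ (2 + l / 2))
      (T ^ (2 + l / 2 - 2 * l / p)) (T ^ (3 / 2 + 3 * l / 4)) (T ^ (2 + 3 * l / 4 - 2 * l / p))
      (T ^ (6 + 2 * l)) := by
  -- `p > 16` makes `1/8 - 2/p` positive, so that even the larger quotient `k₂` tends to zero. `l /
  -- p` is the smallest gap between exponents that has to produce a factor `10 ^ 12`.
  set c : ℝ := min (1 / 8 - 2 / p) (1 / p) with hc
  have hp0 : 0 < p := by linarith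
  have hcpos : 0 < c := by
    refine lt_min ?_ (by positivity)
    have : 2 / p < 1 / 8 := by rw [div_lt_iff₀ hp0]; linarith
    linarith
  have hlim : Tendsto (fun l : ℝ => T ^ (c * l)) atTop (𝓝 0) :=
    (tendsto_rpow_atTop_of_base_lt_one T (by linarith) hT1).comp
      (tendsto_id.const_mul_atTop hcpos)
  obtain ⟨l₀, hl₀⟩ := (hlim.eventually_le_const (by norm_num : (0 : ℝ) < 1 / 10 ^ 12)).exists_forall_of_atTop
  refine ⟨max l₀ 0, fun l hl => ?_⟩
  have hl0 : 0 ≤ l := (le_max_right _ _).trans hl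
  have hsmall := hl₀ l ((le_max_left _ _).trans hl)
  have hc1 : c * l ≤ l / 8 - 2 * l / p := by
    calc c * l ≤ (1 / 8 - 2 / p) * l := by gcongr; exact min_le_left _ _
      _ = _ := by ring
  have hc2 : c * l ≤ l / p := by
    calc c * l ≤ (1 / p) * l := by gcongr; exact min_le_right _ _
      _ = _ := by ring
  have hc0 : 0 ≤ c * l := by positivity
  have small : ∀ x : ℝ, c * l ≤ x → T ^ x ≤ 1 / 10 ^ 12 := fun x hx =>
    (Real.rpow_le_rpow_of_exponent_ge hT0 hT1.le hx).trans hsmall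
  have ratio : ∀ x y : ℝ, y + c * l ≤ x → T ^ x ≤ T ^ y / 10 ^ 12 := by
    intro x y hxy
    have : T ^ x = T ^ (x - y) * T ^ y := by rw [← Real.rpow_add hT0]; ring_nf
    rw [this]
    have h1 := small (x - y) (by linarith)
    have h2 : 0 < T ^ y := Real.rpow_pos_of_pos hT0 _
    calc T ^ (x - y) * T ^ y ≤ (1 / 10 ^ 12) * T ^ y := by gcongr
      _ = _ := by ring
  have e1 : 2 * l / p = 2 * (l / p) := by ring
  refine ⟨Real.rpow_pos_of_pos hT0 _, ratio _ _ (by linarith), small _ hc1,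
    Real.rpow_pos_of_pos hT0 _, ratio _ _ (by linarith), small _ (by linarith),
    Real.rpow_pos_of_pos hT0 _, ?_, ?_, ?_⟩
  · rw [← Real.rpow_natCast, ← Real.rpow_mul hT0.le, ← Real.rpow_add hT0]
    congr 1; push_cast; ring
  · rw [← Real.rpow_natCast (T ^ (2 + 3 * l / 4 - 2 * l / p)), ← Real.rpow_mul hT0.le,
      ← Real.rpow_add hT0]
    apply ratio
    push_cast
    linarith
  · rw [← Real.rpow_natCast (T ^ (3 / 2 + 3 * l / 4)), ← Real.rpow_mul hT0.le,
      ← Real.rpow_add hT0]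
    apply Real.rpow_le_rpow_of_exponent_ge hT0 hT1.le
    push_cast
    linarith

/-- A smooth function that increases from `u` to `v` between `2 s₀` and `s₁ / 2`, with bounds for
its first two derivatives. -/
structure Step (f : ℝ → ℝ) (u v s₀ s₁ ε : ℝ) : Prop where
  smooth : ContDiff ℝ ∞ f
  low : ∀ t ≤ 2 * s₀, f t = u
  high : ∀ t, s₁ / 2 ≤ t → f t = v
  ge : ∀ t, u ≤ f t
  le : ∀ t, f t ≤ v
  deriv_le : ∀ t, |t| * |deriv f t| ≤ ε
  deriv2_le : ∀ t, t ^ 2 * |deriv (deriv f) t| ≤ 2 * ε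

theorem _root_.ContDiff.deriv_infty {f : ℝ → ℝ} (hf : ContDiff ℝ ∞ f) : ContDiff ℝ ∞ (deriv f) :=
  ((contDiff_succ_iff_deriv (n := ∞)).1 (by simpa using hf)).2.2

/-- The second bound comes from `t² f'' = t (t f')' - t f'`. -/
theorem LogStep.deriv_bounds {f : ℝ → ℝ} {u v s₀ s₁ K l : ℝ} (hf : LogStep f u v s₀ s₁ K l)
    (hl : 1 ≤ l) (hK : 0 ≤ K) {t : ℝ} (ht : 0 < t) :
    |t| * |deriv f t| ≤ K / l ∧ t ^ 2 * |deriv (deriv f) t| ≤ 2 * (K / l) := by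
  have h1 := hf.deriv_le t ht
  have h2 := hf.deriv2_le t ht
  have hd : HasDerivAt (fun s => s * deriv f s) (1 * deriv f t + t * deriv (deriv f) t) t :=
    (hasDerivAt_id t).mul
      ((hf.smooth.deriv_infty.differentiable (by simp) t).hasDerivAt)
  rw [hd.deriv] at h2
  have h3 : K / l ^ 2 ≤ K / l := by
    apply div_le_div_of_nonneg_left hK (by linarith)
    nlinarith
  rw [abs_mul] at h1
  refine ⟨h1, ?_⟩
  have h4 : t ^ 2 * |deriv (deriv f) t|
      = |t * (1 * deriv f t + t * deriv (deriv f) t) - t * deriv f t| := by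
    rw [show t * (1 * deriv f t + t * deriv (deriv f) t) - t * deriv f t
      = t ^ 2 * deriv (deriv f) t by ring, abs_mul, abs_of_nonneg (sq_nonneg t)]
  rw [h4]
  refine (abs_sub _ _).trans ?_
  rw [abs_mul t (deriv f t)]
  linarith

theorem LogStep.step {f : ℝ → ℝ} {u v s₀ s₁ K l : ℝ} (hf : LogStep f u v s₀ s₁ K l)
    (hneg : ∀ t ≤ 0, f t = u) (hs₀ : 0 < s₀) (hl : 1 ≤ l) (hK : 0 ≤ K) :
    Step f u v s₀ s₁ (K / l) := by
  have hlow : ∀ t ≤ 2 * s₀, f t = u := fun t ht => by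
    rcases le_total t 0 with h | h
    · exact hneg t h
    · exact hf.low t h ht
  have hε : 0 ≤ K / l := by positivity
  have hz : ∀ t ≤ 0, deriv f =ᶠ[𝓝 t] fun _ => 0 := by
    intro t ht
    have : f =ᶠ[𝓝 t] fun _ => u := by
      filter_upwards [eventually_lt_nhds (show t < 2 * s₀ by linarith)] with s hs using hlow s hs.le
    exact this.deriv.trans (Eventually.of_forall fun _ => by simp)
  refine ⟨hf.smooth, hlow, hf.high, fun t => ?_, fun t => ?_,
    fun t => ?_, fun t => ?_⟩
  · rw [← hlow (min t 0) ((min_le_right _ _).trans (by linarith))]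
    exact hf.mono (min_le_left _ _)
  · rw [← hf.high (max t (s₁ / 2)) (le_max_right _ _)]
    exact hf.mono (le_max_left _ _)
  · rcases le_or_gt t 0 with h | h
    · rw [(hz t h).eq_of_nhds]; simpa using hε
    · exact (hf.deriv_bounds hl hK h).1
  · rcases le_or_gt t 0 with h | h
    · rw [(hz t h).deriv_eq]; simpa using hε
    · exact (hf.deriv_bounds hl hK h).2

/-- The properties of admissible bump functions in terms of the scales. -/
structure Bumps.Fits (α : Bumps) (k₁ k₂ s₀ s₁ r₀ r₁ ε : ℝ) : Prop where
  step₃ : Step α.α₃ (2 / 3) 1 s₀ s₁ ε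
  step₅ : Step α.α₅ 0 1 s₀ s₁ ε
  smooth₄ : ContDiff ℝ ∞ α.α₄
  odd₄ : ∀ t, α.α₄ (-t) = -α.α₄ t
  low₄ : ∀ t, |t| ≤ 2 * r₀ → α.α₄ t = 0
  high₄ : ∀ t, r₁ / 2 ≤ t → α.α₄ t = 1 / 2
  nonneg₄ : ∀ t, 0 ≤ t → 0 ≤ α.α₄ t
  le₄ : ∀ t, α.α₄ t ≤ 1 / 2
  deriv_le₄ : ∀ t, 0 < t → |t| * |deriv α.α₄ t| ≤ ε
  deriv2_le₄ : ∀ t, 0 < t → t ^ 2 * |deriv (deriv α.α₄) t| ≤ 2 * ε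
  smooth₆ : ContDiff ℝ ∞ α.α₆
  low₆ : ∀ t, t ≤ Real.log (2 * k₁) → α.α₆ t = 0
  high₆ : ∀ t, Real.log (k₂ / 2) ≤ t → α.α₆ t = 1
  nonneg₆ : ∀ t, 0 ≤ α.α₆ t
  le₆ : ∀ t, α.α₆ t ≤ 1
  deriv_le₆ : ∀ t, |deriv α.α₆ t| ≤ ε
  deriv2_le₆ : ∀ t, |deriv (deriv α.α₆) t| ≤ ε

theorem Bumps.Admissible.fits {α : Bumps} {T p l K : ℝ} (h : α.Admissible T p l K) (hT : 0 < T)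
    (hl : 1 ≤ l) (hK : 0 ≤ K) :
    α.Fits (T ^ (l / 8 - l / p)) (T ^ (l / 8 - 2 * l / p)) (T ^ (2 + l / 2))
      (T ^ (2 + l / 2 - 2 * l / p)) (T ^ (3 / 2 + 3 * l / 4)) (T ^ (2 + 3 * l / 4 - 2 * l / p))
      (K / l) := by
  have hpos : ∀ x : ℝ, 0 < T ^ x := fun x => Real.rpow_pos_of_pos hT x
  have hle : K / l ^ 2 ≤ K / l := by
    apply div_le_div_of_nonneg_left hK (by linarith)
    nlinarith
  have h40 : α.α₄ 0 = 0 := h.step₄.low 0 le_rfl (by have := hpos (3 / 2 + 3 * l / 4); linarith)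
  refine ⟨h.step₃.step h.neg₃ (hpos _) hl hK, h.step₅.step h.neg₅ (hpos _) hl hK, h.step₄.smooth,
    h.odd₄, fun t ht => ?_, h.step₄.high, fun t ht => ?_, fun t => ?_,
    fun t ht => (h.step₄.deriv_bounds hl hK ht).1,
    fun t ht => (h.step₄.deriv_bounds hl hK ht).2, h.smooth₆, h.low₆, h.high₆, fun t => ?_,
    fun t => ?_, h.deriv_le₆, fun t => (h.deriv2_le₆ t).trans hle⟩
  · rcases le_total 0 t with h0 | h0
    · exact h.step₄.low t h0 ((le_abs_self t).trans ht)
    · have := h.step₄.low (-t) (by linarith) ((neg_le_abs t).trans ht)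
      rw [h.odd₄] at this
      linarith
  · rw [← h40]; exact h.step₄.mono ht
  · rw [← h.step₄.high (max t (T ^ (2 + 3 * l / 4 - 2 * l / p) / 2)) (le_max_right _ _)]
    exact h.step₄.mono (le_max_left _ _)
  · rw [← h.low₆ (min t (Real.log (2 * T ^ (l / 8 - l / p)))) (min_le_right _ _)]
    exact h.mono₆ (min_le_left _ _)
  · rw [← h.high₆ (max t (Real.log (T ^ (l / 8 - 2 * l / p) / 2))) (le_max_right _ _)]
    exact h.mono₆ (le_max_left _ _)

/-! ### The potential as a function of `A = |T x|²`, `B = |T y|²`, `Γ = |T z|²` -/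

/-- The function `log (1 + t)`. -/
def lg (t : ℝ) : ℝ := Real.log (1 + t)

theorem lg_nonneg {t : ℝ} (ht : 0 ≤ t) : 0 ≤ lg t := Real.log_nonneg (by linarith)

theorem lg_le {t : ℝ} (ht : 0 ≤ t) : lg t ≤ t := by
  have := Real.log_le_sub_one_of_pos (show 0 < 1 + t by linarith)
  unfold lg; linarith

theorem le_lg {t : ℝ} (ht : 0 ≤ t) : t / (1 + t) ≤ lg t := by
  have := Real.one_sub_inv_le_log_of_pos (show 0 < 1 + t by linarith)
  have e : t / (1 + t) = 1 - (1 + t)⁻¹ := by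
    have : 1 + t ≠ 0 := by linarith
    field_simp; ring
  rw [e]; exact this

theorem le_lg_of_le {t c : ℝ} (ht : 0 ≤ t) (htc : t ≤ c) : t / (1 + c) ≤ lg t :=
  le_trans (div_le_div_of_nonneg_left ht (by linarith) (by linarith)) (le_lg ht)

theorem lg_mono {s t : ℝ} (hs : 0 ≤ s) (hst : s ≤ t) : lg s ≤ lg t :=
  Real.log_le_log (by linarith) (by linarith)

/-- `φ_a` in terms of `A`, `B`, `Γ`. -/
def ph (A B Γ : ℝ) : ℝ := lg A - lg (B * Γ)

/-- `g_bc` in terms of `B`, `Γ`. -/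
def gg (B Γ : ℝ) : ℝ := lg B + lg Γ + lg (B * Γ)

/-- The radial coordinate `d` in the first region. -/
def dI (A B Γ : ℝ) : ℝ := ph A B Γ - (ph B A Γ + ph Γ A B) / 2

/-- The potential in the first region. -/
def fI (α : Bumps) (A B Γ : ℝ) : ℝ :=
  gg B Γ + α.α₃ (dI A B Γ) * dI A B Γ
    + α.α₄ (ph B A Γ - ph Γ A B) * α.α₅ (dI A B Γ) * (ph B A Γ - ph Γ A B)

/-- The radial coordinate `d` in the region IIA; `σ` is the value of `α₆`. -/
def dIIA (σ A B Γ : ℝ) : ℝ := dI A B Γ + 3 / 2 * σ * ph B A Γ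

/-- The potential in the region IIA; `σ` is the value of `α₆`. -/
def fIIA (α : Bumps) (σ A B Γ : ℝ) : ℝ :=
  gg B Γ - σ * ph B A Γ + α.α₃ (dIIA σ A B Γ) * dIIA σ A B Γ
    + 1 / 2 * α.α₅ (dIIA σ A B Γ) * (ph B A Γ - ph Γ A B - σ * ph B A Γ)

/-- The radial coordinate `d` in the region IIB. -/
def dIIB (A B Γ : ℝ) : ℝ := ph A B Γ + ph B A Γ - ph Γ A B / 2

/-- The potential in the region IIB. -/
def fIIB (α : Bumps) (A B Γ : ℝ) : ℝ :=
  (gg B Γ - ph B A Γ) + α.α₃ (dIIB A B Γ) * dIIB A B Γ - 1 / 2 * α.α₅ (dIIB A B Γ) * ph Γ A B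

/-- The potential near the vertex. -/
def fVII (A B Γ : ℝ) : ℝ := (gg A B + gg A Γ + gg B Γ) / 3

section

variable {α : Bumps} {k₁ k₂ s₀ s₁ r₀ r₁ u ε A B Γ σ : ℝ}

theorem fI_of_low (hα : α.Fits k₁ k₂ s₀ s₁ r₀ r₁ ε) (hd : dI A B Γ ≤ 2 * s₀) :
    fI α A B Γ = fVII A B Γ := by
  rw [fI, hα.step₃.low _ hd, hα.step₅.low _ hd]
  simp only [dI, ph, gg, fVII]
  ring

theorem fIIA_of_low (hα : α.Fits k₁ k₂ s₀ s₁ r₀ r₁ ε) (hd : dIIA σ A B Γ ≤ 2 * s₀) :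
    fIIA α σ A B Γ = fVII A B Γ := by
  rw [fIIA, hα.step₃.low _ hd, hα.step₅.low _ hd]
  simp only [dIIA, dI, ph, gg, fVII]
  ring

theorem fIIB_of_low (hα : α.Fits k₁ k₂ s₀ s₁ r₀ r₁ ε) (hd : dIIB A B Γ ≤ 2 * s₀) :
    fIIB α A B Γ = fVII A B Γ := by
  rw [fIIB, hα.step₃.low _ hd, hα.step₅.low _ hd]
  simp only [dIIB, ph, gg, fVII]
  ring

theorem dI_le (hA : 0 ≤ A) (hB : 0 ≤ B) (hΓ : 0 ≤ Γ) : dI A B Γ ≤ A + A * (B + Γ) / 2 := by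
  have h1 := lg_le hA
  have h2 := lg_nonneg (mul_nonneg hB hΓ)
  have h3 := lg_nonneg hB
  have h4 := lg_nonneg hΓ
  have h5 := lg_le (mul_nonneg hA hB)
  have h6 := lg_le (mul_nonneg hA hΓ)
  simp only [dI, ph]
  linarith

theorem le_dI (hA : 0 ≤ A) (hB : 0 ≤ B) (hΓ : 0 ≤ Γ) :
    lg A - B * Γ - (B + Γ) / 2 ≤ dI A B Γ := by
  have h2 := lg_le (mul_nonneg hB hΓ)
  have h3 := lg_le hB
  have h4 := lg_le hΓ
  have h5 := lg_nonneg (mul_nonneg hA hB)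
  have h6 := lg_nonneg (mul_nonneg hA hΓ)
  simp only [dI, ph]
  linarith

theorem ph_le (hA : 0 ≤ A) (hB : 0 ≤ B) (hΓ : 0 ≤ Γ) : ph B A Γ ≤ B := by
  have h3 := lg_le hB
  have h6 := lg_nonneg (mul_nonneg hA hΓ)
  simp only [ph]
  linarith

theorem le_ph (hA : 0 ≤ A) (hB : 0 ≤ B) (hΓ : 0 ≤ Γ) : -(A * Γ) ≤ ph B A Γ := by
  have h3 := lg_nonneg hB
  have h6 := lg_le (mul_nonneg hA hΓ)
  simp only [ph]
  linarith

theorem dIIA_le (hA : 0 ≤ A) (hB : 0 ≤ B) (hΓ : 0 ≤ Γ) (hσ : 0 ≤ σ) (hσ1 : σ ≤ 1) :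
    dIIA σ A B Γ ≤ A + A * (B + Γ) / 2 + 3 / 2 * B := by
  have h1 := dI_le hA hB hΓ
  have h2 := ph_le hA hB hΓ
  have h3 : σ * ph B A Γ ≤ B := by nlinarith
  simp only [dIIA]
  linarith

theorem le_dIIA (hA : 0 ≤ A) (hB : 0 ≤ B) (hΓ : 0 ≤ Γ) (hσ : 0 ≤ σ) (hσ1 : σ ≤ 1) :
    lg A - B * Γ - (B + Γ) / 2 - 3 / 2 * (A * Γ) ≤ dIIA σ A B Γ := by
  have h1 := le_dI hA hB hΓ
  have h2 := le_ph hA hB hΓ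
  have h0 : 0 ≤ A * Γ := mul_nonneg hA hΓ
  have h3 : -(A * Γ) ≤ σ * ph B A Γ := by nlinarith
  simp only [dIIA]
  linarith

theorem dIIB_le (hA : 0 ≤ A) (hB : 0 ≤ B) (hΓ : 0 ≤ Γ) : dIIB A B Γ ≤ A + B + A * B / 2 := by
  have h1 := ph_le hB hA hΓ
  have h2 := ph_le hA hB hΓ
  have h3 := le_ph hA hΓ hB
  simp only [dIIB]
  linarith

theorem le_dIIB (hA : 0 ≤ A) (hB : 0 ≤ B) (hΓ : 0 ≤ Γ) :
    lg A + lg B - B * Γ - A * Γ - Γ / 2 ≤ dIIB A B Γ := by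
  have h3 := lg_le hΓ
  have h4 := lg_nonneg (mul_nonneg hA hB)
  have h5 := lg_le (mul_nonneg hA hΓ)
  have h6 := lg_le (mul_nonneg hB hΓ)
  simp only [dIIB, ph]
  linarith

/-- For small coordinates each version of the radial coordinate is at most `3 A`, so all of them
stay where the radial bump functions have their initial values. -/
theorem low_of_le (hS : Scales k₁ k₂ s₀ s₁ r₀ r₁ u) (hΓ : 0 ≤ Γ) (hΓB : Γ ≤ B) (hBA : B ≤ A)
    (hA : A ≤ s₀ / 2) : dI A B Γ ≤ 2 * s₀ ∧ dIIB A B Γ ≤ 2 * s₀ ∧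
      ∀ σ, 0 ≤ σ → σ ≤ 1 → dIIA σ A B Γ ≤ 2 * s₀ := by
  have hs := hS.s₀_pos
  have hs1 := hS.s₀_le
  have hs2 := hS.s₁_le
  have hB : 0 ≤ B := hΓ.trans hΓB
  have hA0 : 0 ≤ A := hB.trans hBA
  have hAs : A ≤ 1 / 10 := by linarith
  have e1 : A * (B + Γ) / 2 ≤ A / 10 := by nlinarith
  have e2 : A * B / 2 ≤ A / 10 := by nlinarith
  refine ⟨?_, ?_, fun σ hσ hσ1 => ?_⟩
  · have := dI_le hA0 hB hΓ; linarith
  · have := dIIB_le hA0 hB hΓ; linarith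
  · have := dIIA_le hA0 hB hΓ hσ hσ1; linarith

/-- The angular coordinate is bounded below by `log (1 + B) - log (1 + Γ)`. -/
theorem le_theta (hA : 0 ≤ A) (hΓ : 0 ≤ Γ) (hΓB : Γ ≤ B) :
    lg B - lg Γ ≤ ph B A Γ - ph Γ A B := by
  have := lg_mono (mul_nonneg hA hΓ) (mul_le_mul_of_nonneg_left hΓB hA)
  simp only [ph]
  linarith

/-- If `d ≤ 2 s₀`, both sides are the potential near the vertex. Otherwise `A ≥ s₀`, hence `B ≥ k₁²
s₀ = r₁`, and the bound on `ABΓ` makes `Γ` negligible against `r₁`. So `θ ≥ r₁ / 2` and `α₄` has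
reached the constant `1/2` that is built into the formula of the region IIA. -/
theorem fI_eq_fIIA (hS : Scales k₁ k₂ s₀ s₁ r₀ r₁ u) (hα : α.Fits k₁ k₂ s₀ s₁ r₀ r₁ ε)
    (hΓ : 0 ≤ Γ) (hΓB : Γ ≤ B) (hB1 : k₁ ^ 2 * A ≤ B) (hB2 : B ≤ 4 * k₁ ^ 2 * A) (hA64 : A ≤ 64)
    (hu : A * B * Γ ≤ 4 * u) : fI α A B Γ = fIIA α 0 A B Γ := by
  have hs := hS.s₀_pos
  have hk := hS.k₁_pos
  have hk2 : k₁ ^ 2 ≤ 1 / 10 ^ 12 := by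
    have h1 := hS.k₁_le
    have h2 := hS.k₂_le
    have h3 : k₁ ≤ 1 / 10 ^ 12 := by linarith
    nlinarith
  have hk0 : 0 < k₁ ^ 2 := by positivity
  have hB : 0 ≤ B := hΓ.trans hΓB
  have hA : 0 ≤ A := by
    by_contra! h
    nlinarith
  have hd : dIIA 0 A B Γ = dI A B Γ := by simp [dIIA]
  rcases le_or_gt (dI A B Γ) (2 * s₀) with h | h
  · rw [fI_of_low hα h, fIIA_of_low hα (hd.le.trans h)]
  · have h1 := dI_le hA hB hΓ
    have hBs : B ≤ 1 / 100 := by nlinarith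
    have hAs : s₀ ≤ A := by nlinarith
    have hBr : r₁ ≤ B := by rw [hS.r₁_eq]; nlinarith
    have hr : 0 < r₁ := by rw [hS.r₁_eq]; positivity
    have hΓr : Γ ≤ r₁ / 100 := by
      have hul := hS.u_le
      have h2 : s₀ * r₁ * Γ ≤ A * B * Γ := by gcongr
      have h3 : s₀ * r₁ * Γ ≤ s₀ * r₁ * (r₁ / 100) := by nlinarith [mul_pos hs (pow_pos hr 2)]
      exact le_of_mul_le_mul_left h3 (by positivity)
    have hθ : r₁ / 2 ≤ ph B A Γ - ph Γ A B := by
      have e1 := le_theta hA hΓ hΓB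
      have e2 := lg_le hΓ
      have e3 := le_lg_of_le hB hBs
      norm_num at e3
      linarith
    rw [fI, fIIA, hd, hα.high₄ _ hθ]
    ring

theorem fIIA_one : fIIA α 1 A B Γ = fIIB α A B Γ := by
  have hd : dIIA 1 A B Γ = dIIB A B Γ := by
    simp only [dIIA, dIIB, dI]; ring
  rw [fIIA, fIIB, hd]
  ring

theorem fIIB_symm : fIIB α A B Γ = fIIB α B A Γ := by
  have hd : dIIB A B Γ = dIIB B A Γ := by
    simp only [dIIB, ph]; rw [mul_comm A B]; ring
  rw [fIIB, fIIB, hd]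
  simp only [gg, ph, mul_comm A B]
  ring

theorem fI_symm (hα : α.Fits k₁ k₂ s₀ s₁ r₀ r₁ ε) : fI α A B Γ = fI α A Γ B := by
  have hd : dI A B Γ = dI A Γ B := by
    simp only [dI, ph]; rw [mul_comm Γ B]; ring
  rw [fI, fI, hd, show ph B A Γ - ph Γ A B = -(ph Γ A B - ph B A Γ) by ring, hα.odd₄]
  simp only [gg, mul_comm Γ B]
  ring

theorem fVII_symm : fVII A B Γ = fVII B A Γ := by
  simp only [fVII, gg, mul_comm A B]; ring

theorem fVII_symm' : fVII A B Γ = fVII A Γ B := by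
  simp only [fVII, gg, mul_comm B Γ]; ring

/-- In the interior of a tile all formulas agree with the potential of `ℂP²(3 points)`. -/
theorem tile (hS : Scales k₁ k₂ s₀ s₁ r₀ r₁ u) (hα : α.Fits k₁ k₂ s₀ s₁ r₀ r₁ ε)
    (hΓ : 0 ≤ Γ) (hBA : B ≤ A) (hA : 1 / 64 ≤ A) (hA64 : A ≤ 64)
    (hB : k₁ ^ 2 / 2 ^ 18 ≤ B) (hu : A * B * Γ ≤ 4 * u) :
    (B ≤ k₁ ^ 2 * A → fI α A B Γ = gg A B) ∧
      (B ≤ k₂ ^ 2 * A → ∀ σ, 0 ≤ σ → σ ≤ 1 → fIIA α σ A B Γ = gg A B) ∧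
      fIIB α A B Γ = gg A B := by
  have hs := hS.s₀_pos
  have hk := hS.k₁_pos
  have hk₁ := hS.k₁_le
  have hk₂ := hS.k₂_le
  have hs₀ := hS.s₀_le
  have hs₁ := hS.s₁_le
  have hk0 : 0 < k₁ ^ 2 := by positivity
  have hk₂s : k₂ ^ 2 ≤ 1 / 10 ^ 12 := by nlinarith
  have hk₁s : k₁ ^ 2 ≤ 1 / 10 ^ 12 := by nlinarith
  -- `A` and `B` are bounded below, so the bound on `ABΓ` makes `Γ` negligible against `k₁²`, in
  -- particular against `B`.
  have hΓ1 : Γ ≤ k₁ ^ 2 / 2 ^ 40 := by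
    have h1 : 1 / 64 * (k₁ ^ 2 / 2 ^ 18) * Γ ≤ A * B * Γ := by gcongr
    have hul := hS.u_le
    rw [hS.r₁_eq] at hul
    have h2 : s₀ * (k₁ ^ 2 * s₀) ^ 2 = k₁ ^ 2 * (k₁ ^ 2 * s₀ ^ 3) := by ring
    have h3 : s₀ ^ 3 ≤ 1 / 10 ^ 12 := by
      have : s₀ ≤ 1 / 10 ^ 12 := by linarith
      calc s₀ ^ 3 ≤ (1 / 10 ^ 12) ^ 3 := by gcongr
        _ ≤ _ := by norm_num
    have h4 : k₁ ^ 2 * s₀ ^ 3 ≤ k₁ ^ 2 * (1 / 10 ^ 12) := by gcongr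
    rw [h2] at hul
    have h5 : k₁ ^ 2 * (1 / 64 * (1 / 2 ^ 18) * Γ) ≤
        k₁ ^ 2 * (4 * (k₁ ^ 2 * (1 / 10 ^ 12)) / 10 ^ 12) := by
      calc k₁ ^ 2 * (1 / 64 * (1 / 2 ^ 18) * Γ) = 1 / 64 * (k₁ ^ 2 / 2 ^ 18) * Γ := by ring
        _ ≤ 4 * (k₁ ^ 2 * (k₁ ^ 2 * s₀ ^ 3) / 10 ^ 12) := by linarith
        _ ≤ 4 * (k₁ ^ 2 * (k₁ ^ 2 * (1 / 10 ^ 12)) / 10 ^ 12) := by gcongr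
        _ = _ := by ring
    have h6 := le_of_mul_le_mul_left h5 hk0
    linarith
  have hΓ2 : Γ ≤ 1 / 10 ^ 12 := by linarith
  have hB0 : 0 ≤ B := le_trans (by positivity) hB
  have hA0 : 0 ≤ A := by linarith
  have hΓB : Γ ≤ B := by linarith
  have hlA : 1 / 65 ≤ lg A := by
    refine le_trans ?_ (lg_mono (by norm_num) hA)
    have := le_lg (show (0 : ℝ) ≤ 1 / 64 by norm_num)
    norm_num at this ⊢
    exact this
  have hBΓ : B * Γ ≤ 1 / 1000 := by nlinarith
  have hAΓ : A * Γ ≤ 1 / 1000 := by nlinarith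
  refine ⟨fun hB1 => ?_, fun hB2 σ hσ hσ1 => ?_, ?_⟩
  · have hBs : B ≤ 1 / 1000 := by nlinarith
    have hd : s₁ / 2 ≤ dI A B Γ := by
      have := le_dI hA0 hB0 hΓ
      linarith
    have hθ : r₁ / 2 ≤ ph B A Γ - ph Γ A B := by
      have e1 := le_theta hA0 hΓ hΓB
      have e2 := lg_le hΓ
      have e3 := le_lg_of_le hB0 hBs
      norm_num at e3
      have : r₁ ≤ k₁ ^ 2 * (1 / 10 ^ 12) := by
        rw [hS.r₁_eq]; gcongr; linarith
      linarith
    rw [fI, hα.step₃.high _ hd, hα.step₅.high _ hd, hα.high₄ _ hθ]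
    simp only [dI, ph, gg]
    ring
  · have hBs : B ≤ 1 / 1000 := by nlinarith
    have hd : s₁ / 2 ≤ dIIA σ A B Γ := by
      have := le_dIIA hA0 hB0 hΓ hσ hσ1
      linarith
    rw [fIIA, hα.step₃.high _ hd, hα.step₅.high _ hd]
    simp only [dIIA, dI, ph, gg]
    ring
  · have hd : s₁ / 2 ≤ dIIB A B Γ := by
      have := le_dIIB hA0 hB0 hΓ
      have := lg_nonneg hB0
      linarith
    rw [fIIB, hα.step₃.high _ hd, hα.step₅.high _ hd]
    simp only [dIIB, ph, gg]
    ring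

/-- Near a coordinate axis away from the vertex only the angular bump function is present. -/
theorem fI_axis (hS : Scales k₁ k₂ s₀ s₁ r₀ r₁ u) (hα : α.Fits k₁ k₂ s₀ s₁ r₀ r₁ ε)
    (hB : 0 ≤ B) (hΓ : 0 ≤ Γ) (hBA : B ≤ 4 * k₁ ^ 2 * A) (hΓA : Γ ≤ 4 * k₁ ^ 2 * A)
    (hA : 1 / 64 ≤ A) (hA64 : A ≤ 64) :
    fI α A B Γ = lg A + (lg B + lg Γ + lg (A * B) + lg (A * Γ)) / 2
      + α.α₄ (ph B A Γ - ph Γ A B) * (ph B A Γ - ph Γ A B) := by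
  have hk := hS.k₁_pos
  have hk₁ := hS.k₁_le
  have hk₂ := hS.k₂_le
  have hs₁ := hS.s₁_le
  have hk₁s : k₁ ^ 2 ≤ 1 / 10 ^ 12 := by nlinarith
  have hBs : B ≤ 1 / 1000 := by nlinarith
  have hΓs : Γ ≤ 1 / 1000 := by nlinarith
  have hA0 : 0 ≤ A := by linarith
  have hlA : 1 / 65 ≤ lg A := by
    refine le_trans ?_ (lg_mono (by norm_num) hA)
    have := le_lg (show (0 : ℝ) ≤ 1 / 64 by norm_num)
    norm_num at this ⊢
    exact this
  have hd : s₁ / 2 ≤ dI A B Γ := by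
    have := le_dI hA0 hB hΓ
    have : B * Γ ≤ 1 / 1000 := by nlinarith
    linarith
  rw [fI, hα.step₃.high _ hd, hα.step₅.high _ hd]
  simp only [dI, ph, gg]
  ring

end

end BananaMirror
end

noncomputable section

namespace BananaMirror

open scoped ContDiff Topology
open Filter

/-! ### Formulas for the potential on open sets -/

/-- The function `|T x_a|²`. -/
def nsq (T : ℝ) (a : Fin 3) (q : C3) : ℝ := ‖(T : ℂ) * q a‖ ^ 2

theorem nsq_nonneg (T : ℝ) (a : Fin 3) (q : C3) : 0 ≤ nsq T a q := by unfold nsq; positivity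

theorem nsq_eq {T : ℝ} (hT : 0 < T) (a : Fin 3) (q : C3) : nsq T a q = (T * ‖q a‖) ^ 2 := by
  simp [nsq, abs_of_pos hT]

theorem nsq_le_iff {T : ℝ} (hT : 0 < T) (a b : Fin 3) (q : C3) {k : ℝ} (hk : 0 ≤ k) :
    nsq T b q ≤ k ^ 2 * nsq T a q ↔ ‖q b‖ ≤ k * ‖q a‖ := by
  rw [nsq_eq hT, nsq_eq hT, ← mul_pow, pow_le_pow_iff_left₀ (by positivity) (by positivity)
    (by norm_num), mul_left_comm, mul_le_mul_iff_right₀ hT]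

theorem nsq_le_nsq_iff {T : ℝ} (hT : 0 < T) (a b : Fin 3) (q : C3) :
    nsq T b q ≤ nsq T a q ↔ ‖q b‖ ≤ ‖q a‖ := by
  have := nsq_le_iff hT a b q (k := 1) zero_le_one
  simpa using this

theorem nsq_pos_iff {T : ℝ} (hT : 0 < T) (a : Fin 3) (q : C3) : 0 < nsq T a q ↔ q a ≠ 0 := by
  rw [nsq_eq hT, sq_pos_iff]
  simp [hT.ne']

theorem phi_eq (T : ℝ) (a b c : Fin 3) (q : C3) :
    phi T a b c q = ph (nsq T a q) (nsq T b q) (nsq T c q) := by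
  have e : ‖(T : ℂ) ^ 2 * q b * q c‖ ^ 2 = nsq T b q * nsq T c q := by
    simp only [nsq, ← mul_pow, ← norm_mul]
    ring_nf
  have h1 := nsq_nonneg T a q
  have h2 := mul_nonneg (nsq_nonneg T b q) (nsq_nonneg T c q)
  rw [phi, e]
  exact Real.log_div (by unfold nsq at h1; linarith) (by linarith)

theorem g_eq (T : ℝ) (b c : Fin 3) (q : C3) : g T b c q = gg (nsq T b q) (nsq T c q) := by
  have e : ‖(T : ℂ) ^ 2 * q b * q c‖ ^ 2 = nsq T b q * nsq T c q := by
    simp only [nsq, ← mul_pow, ← norm_mul]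
    ring_nf
  have h1 := nsq_nonneg T b q
  have h2 := nsq_nonneg T c q
  have h3 := mul_nonneg h1 h2
  rw [g, e, Real.log_mul, Real.log_mul]
  · rfl
  all_goals unfold nsq at *; positivity

theorem potentialI_eq (α : Bumps) (T : ℝ) (a b c : Fin 3) (q : C3) :
    potentialI α T a b c q = fI α (nsq T a q) (nsq T b q) (nsq T c q) := by
  simp only [potentialI, phi_eq, g_eq, fI, dI]

/-- The value of `α₆` that enters the potential in the region IIA. -/
def sig (α : Bumps) (a b : Fin 3) (q : C3) : ℝ := α.α₆ (Real.log ‖q b‖ - Real.log ‖q a‖)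

theorem potentialIIA_eq (α : Bumps) (T : ℝ) (a b c : Fin 3) (q : C3) :
    potentialIIA α T a b c q = fIIA α (sig α a b q) (nsq T a q) (nsq T b q) (nsq T c q) := by
  simp only [potentialIIA, phi_eq, g_eq, fIIA, dIIA, dI, sig]

theorem potentialIIB_eq (α : Bumps) (T : ℝ) (a b c : Fin 3) (q : C3) :
    potentialIIB α T a b c q = fIIB α (nsq T a q) (nsq T b q) (nsq T c q) := by
  simp only [potentialIIB, phi_eq, g_eq, fIIB, dIIB]

theorem potential_cases {α : Bumps} {T p l : ℝ} {q : C3} {R : ℝ → Prop}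
    (h : ∀ a b c : Fin 3, a ≠ b → a ≠ c → b ≠ c → ‖q b‖ ≤ ‖q a‖ → ‖q c‖ ≤ ‖q b‖ →
      R (sectorPotential α T p l a b c q)) : R (potential α T p l q) := by
  unfold potential
  split_ifs with h1 h2 h3 h4 h5
  · exact h 0 1 2 (by decide) (by decide) (by decide) h1.1 h1.2
  · exact h 0 2 1 (by decide) (by decide) (by decide) h2.1 h2.2
  · exact h 1 0 2 (by decide) (by decide) (by decide) h3.1 h3.2
  · exact h 1 2 0 (by decide) (by decide) (by decide) h4.1 h4.2
  · exact h 2 0 1 (by decide) (by decide) (by decide) h5.1 h5.2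
  · refine h 2 1 0 (by decide) (by decide) (by decide) ?_ ?_ <;> grind

/-- A product over the three coordinates, in any order. -/
theorem prod_of_ne {M : Type*} [CommMonoid M] (f : Fin 3 → M) {a b c : Fin 3} (hab : a ≠ b)
    (hac : a ≠ c) (hbc : b ≠ c) : f a * f b * f c = f 0 * f 1 * f 2 := by
  have : ({a, b, c} : Finset (Fin 3)) = Finset.univ := by
    revert a b c; decide
  have h := Fin.prod_univ_three f
  rw [← h, ← this, Finset.prod_insert (by simp [hab, hac]), Finset.prod_pair hbc, mul_assoc]

theorem forall_of_ne {R : Fin 3 → Prop} {a b c : Fin 3} (hab : a ≠ b) (hac : a ≠ c) (hbc : b ≠ c)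
    (ha : R a) (hb : R b) (hc : R c) (i : Fin 3) : R i := by
  have : ∀ a b c i : Fin 3, a ≠ b → a ≠ c → b ≠ c → i = a ∨ i = b ∨ i = c := by decide
  rcases this a b c i hab hac hbc with rfl | rfl | rfl <;> assumption

/-- A neighbourhood of the polydisc, on which the potential is smooth. -/
def bigDomain (T l : ℝ) : Set C3 := {q | ‖v0 q‖ < 2 * T ^ l ∧ ∀ i, ‖(T : ℂ) * q i‖ < 8}

theorem continuous_v0 : Continuous v0 := by unfold v0; fun_prop

theorem isOpen_bigDomain (T l : ℝ) : IsOpen (bigDomain T l) := by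
  have : bigDomain T l = {q | ‖v0 q‖ < 2 * T ^ l} ∩ ⋂ i, {q | ‖(T : ℂ) * q i‖ < 8} := by
    ext q; simp [bigDomain]
  rw [this]
  exact (isOpen_lt continuous_v0.norm continuous_const).inter
    (isOpen_iInter_of_finite fun i => isOpen_lt (by fun_prop) continuous_const)

theorem nsq_lt_of_mem {T l : ℝ} {q : C3} (hq : q ∈ bigDomain T l) (i : Fin 3) : nsq T i q < 64 := by
  have := hq.2 i
  unfold nsq
  nlinarith [norm_nonneg ((T : ℂ) * q i)]

theorem nsq_prod {T : ℝ} (q : C3) {a b c : Fin 3} (hab : a ≠ b) (hac : a ≠ c) (hbc : b ≠ c) :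
    nsq T a q * nsq T b q * nsq T c q = (T ^ 3 * ‖v0 q‖) ^ 2 := by
  rw [prod_of_ne (fun i => nsq T i q) hab hac hbc]
  simp only [nsq, v0, norm_mul, Complex.norm_real, Real.norm_eq_abs]
  rw [show ∀ x y z : ℝ, (|T| * x) ^ 2 * (|T| * y) ^ 2 * (|T| * z) ^ 2
    = (|T| ^ 2) ^ 3 * (x * y * z) ^ 2 by intros; ring, sq_abs]
  ring

theorem rpow_six_add {T : ℝ} (hT : 0 < T) (l : ℝ) : T ^ (6 + 2 * l) = (T ^ 3 * T ^ l) ^ 2 := by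
  rw [Real.rpow_add hT, mul_pow, ← Real.rpow_natCast (T ^ l), ← Real.rpow_mul hT.le]
  congr 1
  · rw [← pow_mul]; exact_mod_cast Real.rpow_natCast T 6
  · congr 1; push_cast; ring

theorem nsq_prod_le {T l : ℝ} (hT : 0 < T) {q : C3} (hq : q ∈ bigDomain T l) {a b c : Fin 3}
    (hab : a ≠ b) (hac : a ≠ c) (hbc : b ≠ c) :
    nsq T a q * nsq T b q * nsq T c q ≤ 4 * T ^ (6 + 2 * l) := by
  rw [nsq_prod q hab hac hbc, rpow_six_add hT]
  have h1 := hq.1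
  have : T ^ 3 * ‖v0 q‖ ≤ 2 * (T ^ 3 * T ^ l) := by nlinarith [pow_pos hT 3]
  calc (T ^ 3 * ‖v0 q‖) ^ 2 ≤ (2 * (T ^ 3 * T ^ l)) ^ 2 := by gcongr
    _ = _ := by ring

/-- The data of the theorem: the parameters are in the required range and the bump functions are
admissible, with derivatives of size `ε`. -/
structure Setup (α : Bumps) (T p l ε : ℝ) : Prop where
  pos : 0 < T
  scales : Scales (T ^ (l / 8 - l / p)) (T ^ (l / 8 - 2 * l / p)) (T ^ (2 + l / 2))
    (T ^ (2 + l / 2 - 2 * l / p)) (T ^ (3 / 2 + 3 * l / 4)) (T ^ (2 + 3 * l / 4 - 2 * l / p))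
    (T ^ (6 + 2 * l))
  fits : α.Fits (T ^ (l / 8 - l / p)) (T ^ (l / 8 - 2 * l / p)) (T ^ (2 + l / 2))
    (T ^ (2 + l / 2 - 2 * l / p)) (T ^ (3 / 2 + 3 * l / 4)) (T ^ (2 + 3 * l / 4 - 2 * l / p)) ε

theorem Scales.k₂_pos {k₁ k₂ s₀ s₁ r₀ r₁ u : ℝ} (h : Scales k₁ k₂ s₀ s₁ r₀ r₁ u) : 0 < k₂ := by
  have := h.k₁_pos
  have := h.k₁_le
  linarith

theorem Scales.sq_le {k₁ k₂ s₀ s₁ r₀ r₁ u : ℝ} (h : Scales k₁ k₂ s₀ s₁ r₀ r₁ u) :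
    4 * k₁ ^ 2 ≤ k₂ ^ 2 / 100 ∧ k₂ ^ 2 ≤ 1 / 100 := by
  have h1 := h.k₁_pos
  have h2 := h.k₁_le
  have h3 := h.k₂_le
  constructor
  · calc 4 * k₁ ^ 2 ≤ 4 * (k₂ / 10 ^ 12) ^ 2 := by gcongr
      _ ≤ _ := by nlinarith [sq_nonneg k₂]
  · have := h.k₂_pos
    nlinarith

namespace Setup

variable {α : Bumps} {T p l ε : ℝ} {q : C3} {a b c : Fin 3}

local notation "K₁" => (T ^ (l / 8 - l / p)) ^ 2
local notation "K₂" => (T ^ (l / 8 - 2 * l / p)) ^ 2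

theorem sectorPotential_eq (h : Setup α T p l ε) (a b c : Fin 3) (q : C3) :
    sectorPotential α T p l a b c q =
      if nsq T b q ≤ K₁ * nsq T a q then fI α (nsq T a q) (nsq T b q) (nsq T c q)
      else if nsq T b q ≤ K₂ * nsq T a q then
        fIIA α (sig α a b q) (nsq T a q) (nsq T b q) (nsq T c q)
      else fIIB α (nsq T a q) (nsq T b q) (nsq T c q) := by
  rw [sectorPotential]
  simp only [nsq_le_iff h.pos a b q h.scales.k₁_pos.le, nsq_le_iff h.pos a b q h.scales.k₂_pos.le,
    potentialI_eq, potentialIIA_eq, potentialIIB_eq]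

theorem sig_nonneg (h : Setup α T p l ε) (a b : Fin 3) (q : C3) : 0 ≤ sig α a b q := h.fits.nonneg₆ _

theorem sig_le_one (h : Setup α T p l ε) (a b : Fin 3) (q : C3) : sig α a b q ≤ 1 := h.fits.le₆ _

/-- Both coordinates have to be nonzero because `Real.log 0 = 0`. The factor `4` is the square of
the margin `2` in `low₆`. -/
theorem sig_eq_zero (h : Setup α T p l ε) (ha : 0 < nsq T a q) (hb : 0 < nsq T b q)
    (hab : nsq T b q ≤ 4 * K₁ * nsq T a q) : sig α a b q = 0 := by
  rw [nsq_pos_iff h.pos] at ha hb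
  have hk := h.scales.k₁_pos
  have : ‖q b‖ ≤ 2 * T ^ (l / 8 - l / p) * ‖q a‖ := by
    rw [← nsq_le_iff h.pos a b q (by positivity)]
    linarith
  apply h.fits.low₆
  rw [sub_le_iff_le_add, ← Real.log_mul (by positivity) (by simpa using ha)]
  exact Real.log_le_log (by simpa using hb) this

theorem sig_eq_one (h : Setup α T p l ε) (ha : 0 < nsq T a q) (hb : 0 < nsq T b q)
    (hab : K₂ * nsq T a q ≤ 4 * nsq T b q) : sig α a b q = 1 := by
  rw [nsq_eq h.pos, nsq_eq h.pos] at hab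
  rw [nsq_pos_iff h.pos] at ha hb
  have hk := h.scales.k₂_pos
  have hT := h.pos
  have : T ^ (l / 8 - 2 * l / p) / 2 * ‖q a‖ ≤ ‖q b‖ := by
    have h1 : (T * (T ^ (l / 8 - 2 * l / p) * ‖q a‖)) ^ 2 ≤ (T * (2 * ‖q b‖)) ^ 2 := by
      calc _ = K₂ * (T * ‖q a‖) ^ 2 := by ring
        _ ≤ _ := hab
        _ = _ := by ring
    have h2 := le_of_mul_le_mul_left (le_of_sq_le_sq h1 (by positivity)) hT
    linarith
  apply h.fits.high₆
  rw [le_sub_iff_add_le, ← Real.log_mul (by positivity) (by simpa using ha)]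
  exact Real.log_le_log (by have : 0 < ‖q a‖ := by simpa using ha
                            positivity) this

end Setup
end BananaMirror
end

noncomputable section

namespace BananaMirror

open scoped ContDiff Topology
open Filter

namespace Setup

variable {α : Bumps} {T p l ε : ℝ} {q : C3} {a b c : Fin 3}

local notation "K₁" => (T ^ (l / 8 - l / p)) ^ 2
local notation "K₂" => (T ^ (l / 8 - 2 * l / p)) ^ 2
local notation "S₀" => (T ^ (2 + l / 2))

theorem potential_eq_fVII (h : Setup α T p l ε) (hab : a ≠ b) (hac : a ≠ c) (hbc : b ≠ c)
    (ha : nsq T a q ≤ S₀ / 2) (hb : nsq T b q ≤ S₀ / 2) (hc : nsq T c q ≤ S₀ / 2) :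
    potential α T p l q = fVII (nsq T a q) (nsq T b q) (nsq T c q) := by
  have hall : ∀ i, nsq T i q ≤ S₀ / 2 := forall_of_ne hab hac hbc ha hb hc
  have hperm : ∀ a' b' c' : Fin 3, a' ≠ b' → a' ≠ c' → b' ≠ c' →
      fVII (nsq T a' q) (nsq T b' q) (nsq T c' q) = fVII (nsq T a q) (nsq T b q) (nsq T c q) := by
    have key : ∀ a' b' c' : Fin 3, a' ≠ b' → a' ≠ c' → b' ≠ c' →
        fVII (nsq T a' q) (nsq T b' q) (nsq T c' q)
          = fVII (nsq T 0 q) (nsq T 1 q) (nsq T 2 q) := by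
      intro a' b' c' h1 h2 h3
      fin_cases a' <;> fin_cases b' <;> fin_cases c' <;> simp at h1 h2 h3 ⊢
      · exact fVII_symm'
      · exact fVII_symm
      · rw [fVII_symm', fVII_symm]
      · rw [fVII_symm, fVII_symm']
      · rw [fVII_symm, fVII_symm', fVII_symm]
    intro a' b' c' h1 h2 h3
    rw [key _ _ _ h1 h2 h3, key _ _ _ hab hac hbc]
  refine potential_cases (R := fun r => r = _) fun a' b' c' h1 h2 h3 h4 h5 => ?_
  rw [← nsq_le_nsq_iff h.pos] at h4 h5
  obtain ⟨e1, e2, e3⟩ := low_of_le h.scales (nsq_nonneg T c' q) h5 h4 (hall a')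
  rw [h.sectorPotential_eq, ← hperm a' b' c' h1 h2 h3]
  split_ifs
  · exact fI_of_low h.fits e1
  · exact fIIA_of_low h.fits (e3 _ (h.sig_nonneg _ _ _) (h.sig_le_one _ _ _))
  · exact fIIB_of_low h.fits e2

theorem eq_or_swap {a b c b' c' : Fin 3} (hab : a ≠ b) (hac : a ≠ c) (hbc : b ≠ c) (h1 : a ≠ b')
    (h2 : a ≠ c') (h3 : b' ≠ c') : b' = b ∧ c' = c ∨ b' = c ∧ c' = b := by
  revert a b c b' c'; decide

theorem eq_of_ne {a b c a' : Fin 3} (hab : a ≠ b) (hac : a ≠ c) (hbc : b ≠ c) :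
    a' = a ∨ a' = b ∨ a' = c := by
  revert a b c a'; decide

/-- The bound `4 K₁` instead of `K₁` makes the regions overlap in open sets: in the margin the
definition uses the formula IIA, but `α₆` still vanishes and `fI_eq_fIIA` applies. The wall `|x_b| =
|x_c|` is crossed by `fI_symm`, that is, by the oddness of `α₄`. -/
theorem potential_eq_fI (h : Setup α T p l ε) (hq : q ∈ bigDomain T l) (hab : a ≠ b) (hac : a ≠ c)
    (hbc : b ≠ c) (hb : nsq T b q < 4 * K₁ * nsq T a q) (hc : nsq T c q < 4 * K₁ * nsq T a q) :
    potential α T p l q = fI α (nsq T a q) (nsq T b q) (nsq T c q) := by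
  have hS := h.scales
  obtain ⟨hk1, hk2⟩ := hS.sq_le
  have hb0 := nsq_nonneg T b q
  have hc0 := nsq_nonneg T c q
  have hk := pow_pos hS.k₁_pos 2
  have ha0 : 0 < nsq T a q := by
    by_contra! hn
    nlinarith
  have hba : nsq T b q < nsq T a q := by nlinarith
  have hca : nsq T c q < nsq T a q := by nlinarith
  refine potential_cases (R := fun r => r = _) fun a' b' c' h1 h2 h3 h4 h5 => ?_
  rw [← nsq_le_nsq_iff h.pos] at h4 h5
  have ha' : a' = a := by
    rcases eq_of_ne (a' := a) h1 h2 h3 with e | e | e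
    · exact e.symm
    · rcases eq_of_ne (a' := a') hab hac hbc with e' | e' | e'
      · exact e'
      · rw [← e, e'] at h4; linarith
      · rw [← e, e'] at h4; linarith
    · rcases eq_of_ne (a' := a') hab hac hbc with e' | e' | e'
      · exact e'
      · rw [← e] at h5; rw [e'] at h4; linarith
      · rw [← e] at h5; rw [e'] at h4; linarith
  subst ha'
  have key : ∀ b c : Fin 3, a' ≠ b → a' ≠ c → b ≠ c → nsq T c q ≤ nsq T b q →
      nsq T b q < 4 * K₁ * nsq T a' q → 0 ≤ nsq T b q →
      sectorPotential α T p l a' b c q = fI α (nsq T a' q) (nsq T b q) (nsq T c q) := by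
    intro b c hab hac hbc hcb hb hb0
    rw [h.sectorPotential_eq]
    split_ifs with i1 i2
    · rfl
    · push Not at i1
      rw [h.sig_eq_zero ha0 (lt_of_le_of_lt (by positivity) i1) hb.le]
      exact (fI_eq_fIIA hS h.fits (nsq_nonneg _ _ _) hcb i1.le hb.le (nsq_lt_of_mem hq a').le
        (nsq_prod_le h.pos hq hab hac hbc)).symm
    · exfalso
      nlinarith
  rcases eq_or_swap hab hac hbc h1 h2 h3 with ⟨rfl, rfl⟩ | ⟨rfl, rfl⟩
  · exact key _ _ h1 h2 h3 h5 hb hb0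
  · rw [key _ _ h1 h2 h3 h5 hc hc0, fI_symm h.fits]

theorem potential_eq_fIIA (h : Setup α T p l ε) (hab : a ≠ b)
    (hac : a ≠ c) (hbc : b ≠ c) (hb : K₁ * nsq T a q < nsq T b q)
    (hb' : nsq T b q < K₂ * nsq T a q) (hc : nsq T c q < nsq T b q) :
    potential α T p l q = fIIA α (sig α a b q) (nsq T a q) (nsq T b q) (nsq T c q) := by
  obtain ⟨hk1, hk2⟩ := h.scales.sq_le
  have hc0 := nsq_nonneg T c q
  have hba : nsq T b q < nsq T a q := by
    have := nsq_nonneg T a q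
    nlinarith
  refine potential_cases (R := fun r => r = _) fun a' b' c' h1 h2 h3 h4 h5 => ?_
  rw [← nsq_le_nsq_iff h.pos] at h4 h5
  have e : a' = a ∧ b' = b ∧ c' = c := by
    rcases eq_of_ne (a' := a') hab hac hbc with rfl | rfl | rfl
    · rcases eq_or_swap hab hac hbc h1 h2 h3 with ⟨rfl, rfl⟩ | ⟨rfl, rfl⟩
      · simp
      · linarith
    · rcases eq_or_swap hab.symm hbc hac h1 h2 h3 with ⟨rfl, rfl⟩ | ⟨rfl, rfl⟩ <;> linarith
    · rcases eq_or_swap hac.symm hbc.symm hab h1 h2 h3 with ⟨rfl, rfl⟩ | ⟨rfl, rfl⟩ <;> linarith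
  obtain ⟨rfl, rfl, rfl⟩ := e
  rw [h.sectorPotential_eq, if_neg (by linarith), if_pos hb'.le]

/-- The hypotheses are symmetric in `a` and `b`, so the wall `|x_a| = |x_b|` is covered. In the
margin below `K₂` the definition uses the formula IIA, with `α₆ = 1`. -/
theorem potential_eq_fIIB (h : Setup α T p l ε) (hab : a ≠ b)
    (hac : a ≠ c) (hbc : b ≠ c) (hb : K₂ * nsq T a q < 4 * nsq T b q)
    (ha : K₂ * nsq T b q < 4 * nsq T a q) (hca : nsq T c q < nsq T a q)
    (hcb : nsq T c q < nsq T b q) :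
    potential α T p l q = fIIB α (nsq T a q) (nsq T b q) (nsq T c q) := by
  obtain ⟨hk1, hk2⟩ := h.scales.sq_le
  have hc0 := nsq_nonneg T c q
  have ha0 : 0 < nsq T a q := by linarith
  have hb0 : 0 < nsq T b q := by linarith
  refine potential_cases (R := fun r => r = _) fun a' b' c' h1 h2 h3 h4 h5 => ?_
  rw [← nsq_le_nsq_iff h.pos] at h4 h5
  have key : ∀ a b : Fin 3, 0 < nsq T a q → 0 < nsq T b q → K₂ * nsq T a q < 4 * nsq T b q →
      sectorPotential α T p l a b c' q = fIIB α (nsq T a q) (nsq T b q) (nsq T c' q) := by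
    intro a b ha0 hb0 hb
    rw [h.sectorPotential_eq]
    split_ifs with i1 i2
    · nlinarith
    · rw [h.sig_eq_one ha0 hb0 hb.le, fIIA_one]
    · rfl
  rcases eq_of_ne (a' := a') hab hac hbc with rfl | rfl | rfl
  · rcases eq_or_swap hab hac hbc h1 h2 h3 with ⟨rfl, rfl⟩ | ⟨rfl, rfl⟩
    · exact key _ _ ha0 hb0 hb
    · linarith
  · rcases eq_or_swap hab.symm hbc hac h1 h2 h3 with ⟨rfl, rfl⟩ | ⟨rfl, rfl⟩
    · rw [key _ _ hb0 ha0 ha, fIIB_symm]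
    · linarith
  · rcases eq_or_swap hac.symm hbc.symm hab h1 h2 h3 with ⟨rfl, rfl⟩ | ⟨rfl, rfl⟩ <;> linarith

/-- The thresholds `1 / 64` and `K₁ / 2 ^ 18` are loose enough to hold at both ends of an edge, as
`potential_edgeMap` needs. -/
theorem potential_eq_tile (h : Setup α T p l ε) (hq : q ∈ bigDomain T l) (hab : a ≠ b) (hac : a ≠ c)
    (hbc : b ≠ c) (ha : 1 / 64 < nsq T a q) (hb : K₁ / 2 ^ 18 < nsq T b q) :
    potential α T p l q = gg (nsq T a q) (nsq T b q) := by
  have hS := h.scales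
  obtain ⟨hk1, hk2⟩ := hS.sq_le
  have hk := pow_pos hS.k₁_pos 2
  have hc0 := nsq_nonneg T c q
  have hc : nsq T c q < K₁ / 2 ^ 18 := by
    have h1 := nsq_prod_le h.pos hq hab hac hbc
    have hul := hS.u_le
    rw [hS.r₁_eq] at hul
    by_contra! hn
    have h2 : 1 / 64 * (K₁ / 2 ^ 18) * (K₁ / 2 ^ 18) ≤ nsq T a q * nsq T b q * nsq T c q := by
      have := nsq_nonneg T a q
      have := nsq_nonneg T b q
      gcongr
    have hs : S₀ ≤ 1 / 10 ^ 12 := by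
      have := hS.s₀_le
      have := hS.s₁_le
      have := hS.s₀_pos
      linarith
    have h3 : S₀ ^ 3 ≤ 1 / 10 ^ 36 := by
      have := hS.s₀_pos
      calc S₀ ^ 3 ≤ (1 / 10 ^ 12) ^ 3 := by gcongr
        _ ≤ _ := by norm_num
    have h4 : S₀ * (K₁ * S₀) ^ 2 ≤ K₁ * K₁ * (1 / 10 ^ 36) := by
      calc S₀ * (K₁ * S₀) ^ 2 = K₁ * K₁ * S₀ ^ 3 := by ring
        _ ≤ _ := by gcongr
    have h5 : 0 < K₁ * K₁ := by positivity
    nlinarith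
  have hk1' : K₁ ≤ 1 / 100 := by linarith [pow_pos hS.k₂_pos 2]
  have hcb : nsq T c q < nsq T b q := by linarith
  have hca : nsq T c q < nsq T a q := by linarith
  refine potential_cases (R := fun r => r = _) fun a' b' c' h1 h2 h3 h4 h5 => ?_
  rw [← nsq_le_nsq_iff h.pos] at h4 h5
  have key : ∀ a b : Fin 3, a ≠ b → a ≠ c → b ≠ c → nsq T b q ≤ nsq T a q →
      1 / 64 ≤ nsq T a q → K₁ / 2 ^ 18 ≤ nsq T b q →
      sectorPotential α T p l a b c q = gg (nsq T a q) (nsq T b q) := by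
    intro a b hab hac hbc hba ha hb
    obtain ⟨t1, t2, t3⟩ := tile hS h.fits (nsq_nonneg T c q) hba ha (nsq_lt_of_mem hq a).le hb
      (nsq_prod_le h.pos hq hab hac hbc)
    rw [h.sectorPotential_eq]
    split_ifs with i1 i2
    · exact t1 i1
    · exact t2 i2 _ (h.sig_nonneg _ _ _) (h.sig_le_one _ _ _)
    · exact t3
  rcases eq_of_ne (a' := a') hab hac hbc with rfl | rfl | rfl
  · rcases eq_or_swap hab hac hbc h1 h2 h3 with ⟨rfl, rfl⟩ | ⟨rfl, rfl⟩
    · exact key _ _ h1 h2 h3 h4 ha.le hb.le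
    · linarith
  · rcases eq_or_swap hab.symm hbc hac h1 h2 h3 with ⟨rfl, rfl⟩ | ⟨rfl, rfl⟩
    · rw [key _ _ h1 h2 h3 h4 (ha.le.trans h4) (by linarith)]
      simp only [gg]; rw [mul_comm]; ring
    · linarith
  · rcases eq_or_swap hac.symm hbc.symm hab h1 h2 h3 with ⟨rfl, rfl⟩ | ⟨rfl, rfl⟩ <;> linarith

/-! ### Invariance under the transition maps -/

theorem edgeMap_self (T : ℝ) (a : Fin 3) (q : C3) : edgeMap T a q a = ((T : ℂ) ^ 2 * q a)⁻¹ := by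
  fin_cases a <;> simp [edgeMap]

theorem edgeMap_of_ne (T : ℝ) (hab : a ≠ b) (hac : a ≠ c) (hbc : b ≠ c) (q : C3) :
    edgeMap T a q b = T * q a * q c := by
  fin_cases a <;> fin_cases b <;> fin_cases c <;> simp [edgeMap] at hab hac hbc ⊢ <;> ring

theorem nsq_edgeMap_self (hT : 0 < T) (a : Fin 3) (q : C3) :
    nsq T a (edgeMap T a q) = (nsq T a q)⁻¹ := by
  rw [nsq, edgeMap_self, nsq, ← inv_pow, ← norm_inv]
  congr 2
  have : (T : ℂ) ≠ 0 := by exact_mod_cast hT.ne'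
  rcases eq_or_ne (q a) 0 with h0 | h0
  · simp [h0]
  · field_simp

theorem nsq_edgeMap_of_ne (T : ℝ) (hab : a ≠ b) (hac : a ≠ c) (hbc : b ≠ c) (q : C3) :
    nsq T b (edgeMap T a q) = nsq T a q * nsq T c q := by
  rw [nsq, edgeMap_of_ne T hab hac hbc, nsq, nsq, ← mul_pow, ← norm_mul]
  congr 2
  ring

theorem lg_inv {A : ℝ} (hA : 0 < A) : lg A⁻¹ = lg A - Real.log A := by
  rw [lg, lg, ← Real.log_div (by positivity) (by positivity)]
  congr 1
  field_simp
  ring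

/-- Under the transition map along the edge `a` the potential changes by `log |T x_a|²`. -/
theorem potential_edgeMap (h : Setup α T p l ε) (hq : q ∈ bigDomain T l) (ha : q a ≠ 0)
    (hq' : edgeMap T a q ∈ bigDomain T l) :
    potential α T p l (edgeMap T a q) = potential α T p l q - Real.log (nsq T a q) := by
  have hA := (nsq_pos_iff h.pos a q).2 ha
  have hA64 := nsq_lt_of_mem hq a
  have hA1 := nsq_lt_of_mem hq' a
  rw [nsq_edgeMap_self h.pos] at hA1
  have hA1' : 1 / 64 < nsq T a q := by
    rw [inv_lt_comm₀ hA (by norm_num)] at hA1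
    linarith
  have hA2 : 1 / 64 < (nsq T a q)⁻¹ := by
    rw [lt_inv_comm₀ (by norm_num) hA]
    linarith
  have hk := pow_pos h.scales.k₁_pos 2
  -- The cut `2 ^ 10` serves both ends of the edge, where `A` and `A⁻¹` exceed `1 / 64`. Above it,
  -- `AB ≥ K₁ / 2 ^ 16` is still in the tile; below it, `AΓ ≤ K₁ / 16 < 4 K₁ A⁻¹`, and likewise for
  -- `AB`, so both ends are near the axis.
  have tilecase : ∀ b c : Fin 3, a ≠ b → a ≠ c → b ≠ c → K₁ / 2 ^ 10 ≤ nsq T b q →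
      potential α T p l (edgeMap T a q) = potential α T p l q - Real.log (nsq T a q) := by
    intro b c hab hac hbc hb
    have hb0 := nsq_nonneg T b q
    rw [h.potential_eq_tile hq hab hac hbc hA1' (by linarith),
      h.potential_eq_tile hq' hac hab hbc.symm (by rwa [nsq_edgeMap_self h.pos])
        (by rw [nsq_edgeMap_of_ne T hac hab hbc.symm]; nlinarith),
      nsq_edgeMap_self h.pos, nsq_edgeMap_of_ne T hac hab hbc.symm]
    simp only [gg]
    rw [lg_inv hA, inv_mul_cancel_left₀ hA.ne']
    ring
  obtain ⟨b, c, hab, hac, hbc⟩ : ∃ b c : Fin 3, a ≠ b ∧ a ≠ c ∧ b ≠ c := by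
    have : ∀ a : Fin 3, ∃ b c : Fin 3, a ≠ b ∧ a ≠ c ∧ b ≠ c := by decide
    exact this a
  rcases le_or_gt (K₁ / 2 ^ 10) (nsq T b q) with hb | hb
  · exact tilecase b c hab hac hbc hb
  rcases le_or_gt (K₁ / 2 ^ 10) (nsq T c q) with hc | hc
  · exact tilecase c b hac hab hbc.symm hc
  have hb0 := nsq_nonneg T b q
  have hc0 := nsq_nonneg T c q
  have e1 : nsq T b q < 4 * K₁ * nsq T a q := by nlinarith
  have e2 : nsq T c q < 4 * K₁ * nsq T a q := by nlinarith
  have e3 : nsq T b (edgeMap T a q) < 4 * K₁ * nsq T a (edgeMap T a q) := by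
    rw [nsq_edgeMap_self h.pos, nsq_edgeMap_of_ne T hab hac hbc]
    have : nsq T a q * nsq T c q ≤ 64 * (K₁ / 2 ^ 10) := by gcongr
    nlinarith
  have e4 : nsq T c (edgeMap T a q) < 4 * K₁ * nsq T a (edgeMap T a q) := by
    rw [nsq_edgeMap_self h.pos, nsq_edgeMap_of_ne T hac hab hbc.symm]
    have : nsq T a q * nsq T b q ≤ 64 * (K₁ / 2 ^ 10) := by gcongr
    nlinarith
  rw [h.potential_eq_fI hq hab hac hbc e1 e2, h.potential_eq_fI hq' hab hac hbc e3 e4,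
    fI_axis h.scales h.fits hb0 hc0 e1.le e2.le hA1'.le hA64.le,
    fI_axis h.scales h.fits (nsq_nonneg _ _ _) (nsq_nonneg _ _ _) e3.le e4.le
      (by rw [nsq_edgeMap_self h.pos]; exact hA2.le) (nsq_lt_of_mem hq' a).le,
    nsq_edgeMap_self h.pos, nsq_edgeMap_of_ne T hab hac hbc, nsq_edgeMap_of_ne T hac hab hbc.symm,
    lg_inv hA, inv_mul_cancel_left₀ hA.ne', inv_mul_cancel_left₀ hA.ne']
  -- The edge map exchanges `B` with `AΓ` and `Γ` with `AB`, so `θ` changes sign; `α₄(θ) θ` is even.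
  have hθ : ph (nsq T a q * nsq T c q) (nsq T a q)⁻¹ (nsq T a q * nsq T b q)
      - ph (nsq T a q * nsq T b q) (nsq T a q)⁻¹ (nsq T a q * nsq T c q)
      = -(ph (nsq T b q) (nsq T a q) (nsq T c q) - ph (nsq T c q) (nsq T a q) (nsq T b q)) := by
    simp only [ph]
    rw [inv_mul_cancel_left₀ hA.ne', inv_mul_cancel_left₀ hA.ne']
    ring
  rw [hθ, h.fits.odd₄]
  ring

/-! ### Smoothness -/

theorem contDiff_nsq (T : ℝ) (a : Fin 3) : ContDiff ℝ ∞ (nsq T a) := by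
  unfold nsq
  exact ContDiff.norm_sq ℝ (by fun_prop)

theorem _root_.ContDiffAt.lg {A : C3 → ℝ} (hA : ContDiffAt ℝ ∞ A q) (hA0 : 0 ≤ A q) :
    ContDiffAt ℝ ∞ (fun q => BananaMirror.lg (A q)) q := by
  unfold BananaMirror.lg
  exact (contDiffAt_const.add hA).log (by positivity)

theorem contDiffAt_lg_nsq (T : ℝ) (a : Fin 3) (q : C3) :
    ContDiffAt ℝ ∞ (fun q => lg (nsq T a q)) q :=
  (contDiff_nsq T a).contDiffAt.lg (nsq_nonneg _ _ _)

theorem contDiffAt_lg_nsq_mul (T : ℝ) (a b : Fin 3) (q : C3) :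
    ContDiffAt ℝ ∞ (fun q => lg (nsq T a q * nsq T b q)) q :=
  ((contDiff_nsq T a).contDiffAt.mul (contDiff_nsq T b).contDiffAt).lg
    (mul_nonneg (nsq_nonneg _ _ _) (nsq_nonneg _ _ _))

theorem contDiffAt_ph (T : ℝ) (a b c : Fin 3) (q : C3) :
    ContDiffAt ℝ ∞ (fun q => ph (nsq T a q) (nsq T b q) (nsq T c q)) q :=
  (contDiffAt_lg_nsq T a q).sub (contDiffAt_lg_nsq_mul T b c q)

theorem contDiffAt_gg (T : ℝ) (b c : Fin 3) (q : C3) :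
    ContDiffAt ℝ ∞ (fun q => gg (nsq T b q) (nsq T c q)) q :=
  ((contDiffAt_lg_nsq T b q).add (contDiffAt_lg_nsq T c q)).add (contDiffAt_lg_nsq_mul T b c q)

theorem contDiffAt_dI (T : ℝ) (a b c : Fin 3) (q : C3) :
    ContDiffAt ℝ ∞ (fun q => dI (nsq T a q) (nsq T b q) (nsq T c q)) q :=
  (contDiffAt_ph T a b c q).sub
    (((contDiffAt_ph T b a c q).add (contDiffAt_ph T c a b q)).div_const 2)

theorem contDiffAt_sig (h : Setup α T p l ε) (ha : q a ≠ 0) (hb : q b ≠ 0) :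
    ContDiffAt ℝ ∞ (sig α a b) q := by
  refine h.fits.smooth₆.contDiffAt.comp q (ContDiffAt.sub (ContDiffAt.log ?_ ?_)
    (ContDiffAt.log ?_ ?_))
  · exact ContDiffAt.norm ℝ (by fun_prop) hb
  · simpa using hb
  · exact ContDiffAt.norm ℝ (by fun_prop) ha
  · simpa using ha

theorem contDiffAt_fVII (T : ℝ) (a b c : Fin 3) (q : C3) :
    ContDiffAt ℝ ∞ (fun q => fVII (nsq T a q) (nsq T b q) (nsq T c q)) q :=
  (((contDiffAt_gg T a b q).add (contDiffAt_gg T a c q)).add (contDiffAt_gg T b c q)).div_const 3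

theorem contDiffAt_fI (h : Setup α T p l ε) (a b c : Fin 3) (q : C3) :
    ContDiffAt ℝ ∞ (fun q => fI α (nsq T a q) (nsq T b q) (nsq T c q)) q := by
  have hd := contDiffAt_dI T a b c q
  have hθ := (contDiffAt_ph T b a c q).sub (contDiffAt_ph T c a b q)
  exact ((contDiffAt_gg T b c q).add ((h.fits.step₃.smooth.contDiffAt.comp q hd).mul hd)).add
    (((h.fits.smooth₄.contDiffAt.comp q hθ).mul (h.fits.step₅.smooth.contDiffAt.comp q hd)).mul hθ)

theorem contDiffAt_fIIA (h : Setup α T p l ε) (ha : q a ≠ 0) (hb : q b ≠ 0) (c : Fin 3) :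
    ContDiffAt ℝ ∞ (fun q => fIIA α (sig α a b q) (nsq T a q) (nsq T b q) (nsq T c q)) q := by
  have hσ := h.contDiffAt_sig ha hb
  have hφ := contDiffAt_ph T b a c q
  have hd : ContDiffAt ℝ ∞ (fun q => dIIA (sig α a b q) (nsq T a q) (nsq T b q) (nsq T c q)) q :=
    (contDiffAt_dI T a b c q).add ((contDiffAt_const.mul hσ).mul hφ)
  exact (((contDiffAt_gg T b c q).sub (hσ.mul hφ)).add
    ((h.fits.step₃.smooth.contDiffAt.comp q hd).mul hd)).add
    ((contDiffAt_const.mul (h.fits.step₅.smooth.contDiffAt.comp q hd)).mul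
      ((hφ.sub (contDiffAt_ph T c a b q)).sub (hσ.mul hφ)))

theorem contDiffAt_fIIB (h : Setup α T p l ε) (a b c : Fin 3) (q : C3) :
    ContDiffAt ℝ ∞ (fun q => fIIB α (nsq T a q) (nsq T b q) (nsq T c q)) q := by
  have hc := contDiffAt_ph T c a b q
  have hd : ContDiffAt ℝ ∞ (fun q => dIIB (nsq T a q) (nsq T b q) (nsq T c q)) q :=
    ((contDiffAt_ph T a b c q).add (contDiffAt_ph T b a c q)).sub (hc.div_const 2)
  exact (((contDiffAt_gg T b c q).sub (contDiffAt_ph T b a c q)).add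
    ((h.fits.step₃.smooth.contDiffAt.comp q hd).mul hd)).sub
    ((contDiffAt_const.mul (h.fits.step₅.smooth.contDiffAt.comp q hd)).mul hc)

/-! ### The cover by the regions -/

/-- Near each point one single smooth formula is valid. The inequalities recorded with it are those
that smoothness and the Levi estimates need, such as `0 < B` where `log |x_b|` enters. -/
theorem exists_region (h : Setup α T p l ε) (hq : q ∈ bigDomain T l) :
    ∃ a b c : Fin 3, a ≠ b ∧ a ≠ c ∧ b ≠ c ∧ nsq T b q ≤ nsq T a q ∧ nsq T c q ≤ nsq T b q ∧
      (potential α T p l =ᶠ[𝓝 q] (fun q => fVII (nsq T a q) (nsq T b q) (nsq T c q)) ∨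
        S₀ / 2 ≤ nsq T a q ∧
        (nsq T b q < 4 * K₁ * nsq T a q ∧
            potential α T p l =ᶠ[𝓝 q] (fun q => fI α (nsq T a q) (nsq T b q) (nsq T c q)) ∨
          0 < nsq T b q ∧ nsq T b q < K₂ * nsq T a q ∧ potential α T p l =ᶠ[𝓝 q]
            (fun q => fIIA α (sig α a b q) (nsq T a q) (nsq T b q) (nsq T c q)) ∨
          K₂ * nsq T a q ≤ nsq T b q ∧
            potential α T p l =ᶠ[𝓝 q] (fun q => fIIB α (nsq T a q) (nsq T b q) (nsq T c q)))) := by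
  obtain ⟨a, b, c, hab, hac, hbc, hba, hcb⟩ : ∃ a b c : Fin 3, a ≠ b ∧ a ≠ c ∧ b ≠ c ∧
      nsq T b q ≤ nsq T a q ∧ nsq T c q ≤ nsq T b q := by
    rcases le_total (nsq T 0 q) (nsq T 1 q) with h1 | h1 <;>
    rcases le_total (nsq T 0 q) (nsq T 2 q) with h2 | h2 <;>
    rcases le_total (nsq T 1 q) (nsq T 2 q) with h3 | h3
    · exact ⟨2, 1, 0, by decide, by decide, by decide, h3, h1⟩
    · exact ⟨1, 2, 0, by decide, by decide, by decide, h3, h2⟩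
    · exact ⟨2, 1, 0, by decide, by decide, by decide, h3, h1⟩
    · exact ⟨1, 0, 2, by decide, by decide, by decide, h1, h2⟩
    · exact ⟨2, 0, 1, by decide, by decide, by decide, h2, h1⟩
    · exact ⟨0, 1, 2, by decide, by decide, by decide, h1, h3⟩
    · exact ⟨0, 2, 1, by decide, by decide, by decide, h2, h3⟩
    · exact ⟨0, 1, 2, by decide, by decide, by decide, h1, h3⟩
  have hcont : ∀ i, Continuous (nsq T i) := fun i => (contDiff_nsq T i).continuous
  have hS := h.scales
  obtain ⟨hk1, hk2⟩ := hS.sq_le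
  have hk₁ := pow_pos hS.k₁_pos 2
  have hk₂ := pow_pos hS.k₂_pos 2
  have hs := hS.s₀_pos
  have hc0 := nsq_nonneg T c q
  have hb0 := nsq_nonneg T b q
  refine ⟨a, b, c, hab, hac, hbc, hba, hcb, ?_⟩
  rcases lt_or_ge (nsq T a q) (S₀ / 2) with hlt | hge
  · left
    filter_upwards [(hcont a).continuousAt.eventually_lt_const hlt,
      (hcont b).continuousAt.eventually_lt_const (hba.trans_lt hlt),
      (hcont c).continuousAt.eventually_lt_const ((hcb.trans hba).trans_lt hlt)] with x h1 h2 h3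
    exact h.potential_eq_fVII hab hac hbc h1.le h2.le h3.le
  right
  refine ⟨hge, ?_⟩
  have ha0 : 0 < nsq T a q := by linarith
  have hΩ := (isOpen_bigDomain T l).mem_nhds hq
  rcases lt_or_ge (nsq T b q) (4 * K₁ * nsq T a q) with h1 | h1
  · left
    refine ⟨h1, ?_⟩
    filter_upwards [hΩ, (hcont b).continuousAt.eventually_lt ((hcont a).const_mul _).continuousAt h1,
      (hcont c).continuousAt.eventually_lt ((hcont a).const_mul _).continuousAt (hcb.trans_lt h1)]
      with x hx h1 h2
    exact h.potential_eq_fI hx hab hac hbc h1 h2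
  right
  -- If `Γ` were as large as `B`, then `ABΓ` would be of order `s₀ r₁²`, far above its bound. The
  -- strict inequality fixes the third coordinate on a neighbourhood.
  have hcb' : nsq T c q < nsq T b q := by
    have e1 := nsq_prod_le h.pos hq hab hac hbc
    have hul := hS.u_le
    rw [hS.r₁_eq] at hul
    by_contra! hn
    have e2 : S₀ / 2 * (4 * K₁ * (S₀ / 2)) * (4 * K₁ * (S₀ / 2)) ≤
        nsq T a q * nsq T b q * nsq T c q := by
      have e3 : 4 * K₁ * (S₀ / 2) ≤ nsq T b q := le_trans (by gcongr) h1
      have e4 := e3.trans hn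
      gcongr
    have e5 : S₀ / 2 * (4 * K₁ * (S₀ / 2)) * (4 * K₁ * (S₀ / 2)) = 2 * (S₀ * (K₁ * S₀) ^ 2) := by
      ring
    have e6 : 0 < S₀ * (K₁ * S₀) ^ 2 := by positivity
    linarith
  rcases lt_or_ge (nsq T b q) (K₂ * nsq T a q) with h2 | h2
  · left
    have h1' : K₁ * nsq T a q < nsq T b q := by nlinarith
    refine ⟨by nlinarith, h2, ?_⟩
    filter_upwards [((hcont a).const_mul _).continuousAt.eventually_lt (hcont b).continuousAt h1',
      (hcont b).continuousAt.eventually_lt ((hcont a).const_mul _).continuousAt h2,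
      (hcont c).continuousAt.eventually_lt (hcont b).continuousAt hcb'] with x h1 h2 h3
    exact h.potential_eq_fIIA hab hac hbc h1 h2 h3
  · right
    refine ⟨h2, ?_⟩
    have e1 : K₂ * nsq T a q < 4 * nsq T b q := by nlinarith
    have e2 : K₂ * nsq T b q < 4 * nsq T a q := by nlinarith
    filter_upwards [((hcont a).const_mul _).continuousAt.eventually_lt
        ((hcont b).const_mul 4).continuousAt e1,
      ((hcont b).const_mul _).continuousAt.eventually_lt ((hcont a).const_mul 4).continuousAt e2,
      (hcont c).continuousAt.eventually_lt (hcont a).continuousAt (hcb'.trans_le hba),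
      (hcont c).continuousAt.eventually_lt (hcont b).continuousAt hcb'] with x h1 h2 h3 h4
    exact h.potential_eq_fIIB hab hac hbc h1 h2 h3 h4

theorem contDiffAt_potential (h : Setup α T p l ε) (hq : q ∈ bigDomain T l) :
    ContDiffAt ℝ ∞ (potential α T p l) q := by
  obtain ⟨a, b, c, hab, hac, hbc, hba, hcb, h1 | ⟨ha, ⟨-, h1⟩ | ⟨hb, -, h1⟩ | ⟨-, h1⟩⟩⟩ :=
    h.exists_region hq
  · exact (contDiffAt_fVII T a b c q).congr_of_eventuallyEq h1
  · exact (h.contDiffAt_fI a b c q).congr_of_eventuallyEq h1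
  · have hs := h.scales.s₀_pos
    exact (h.contDiffAt_fIIA ((nsq_pos_iff h.pos a q).1 (by linarith))
      ((nsq_pos_iff h.pos b q).1 hb) c).congr_of_eventuallyEq h1
  · exact (h.contDiffAt_fIIB a b c q).congr_of_eventuallyEq h1

end Setup
end BananaMirror
end

noncomputable section

namespace BananaMirror

open scoped ContDiff Topology ComplexConjugate
open Filter

/-! ### Levi forms of the building blocks of the potential -/

theorem two_le_infty_contDiff {f : ℝ → ℝ} (hf : ContDiff ℝ ∞ f) (t : ℝ) : ContDiffAt ℝ 2 f t :=
  hf.contDiffAt.of_le two_le_infty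

theorem hasDerivAt_lg {t : ℝ} (ht : 0 ≤ t) : HasDerivAt lg (1 + t)⁻¹ t := by
  have := ((hasDerivAt_id t).const_add 1).log (by simp; linarith)
  change HasDerivAt (fun y => Real.log (1 + y)) _ t
  simpa using this

theorem deriv_deriv_lg {t : ℝ} (ht : 0 ≤ t) : deriv (deriv lg) t = -((1 + t) ^ 2)⁻¹ := by
  have e : deriv lg =ᶠ[𝓝 t] fun t => (1 + t)⁻¹ := by
    filter_upwards [eventually_gt_nhds (show -1 < t by linarith)] with s hs
    have := ((hasDerivAt_id s).const_add 1).log (by simp; linarith)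
    change deriv (fun y => Real.log (1 + y)) s = _
    simpa using this.deriv
  rw [e.deriv_eq]
  have := (((hasDerivAt_id t).const_add 1).inv (by simp; linarith)).deriv
  simp only [id] at this
  erw [this]
  rw [neg_div, one_div]

theorem hasLevi_lg_norm_sq {h : C3 → ℂ} {q : C3} (hh : ContDiffAt ℂ 2 h q) (a : C3) :
    HasLevi (fun x => lg (‖h x‖ ^ 2)) q a (2 * conj (h q) * fderiv ℂ h q a / (1 + ‖h q‖ ^ 2 : ℝ))
      (2 * ‖fderiv ℂ h q a‖ ^ 2 / (1 + ‖h q‖ ^ 2) ^ 2) := by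
  have h0 : 0 ≤ ‖h q‖ ^ 2 := by positivity
  have hc : ContDiffAt ℝ 2 lg (‖h q‖ ^ 2) := by
    unfold lg
    exact (contDiffAt_const.add contDiffAt_id).log (by simp; positivity)
  refine ((hasLevi_norm_sq hh a).comp hc).congr_val ?_ ?_
  · rw [(hasDerivAt_lg h0).deriv]
    push_cast
    ring
  · rw [(hasDerivAt_lg h0).deriv, deriv_deriv_lg h0]
    simp only [norm_mul, RCLike.norm_conj, Complex.norm_ofNat]
    have : (1 + ‖h q‖ ^ 2) ≠ 0 := by positivity
    field_simp
    ring

/-- The vanishing Levi form has two uses: edge maps do not change `i ∂∂̄ F`, and the argument of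
`α₆` contributes to Levi forms only through its gradient. -/
theorem hasLevi_log_norm {i : Fin 3} {q : C3} (hq : q i ≠ 0) (a : C3) :
    HasLevi (fun x => Real.log ‖x i‖) q a (a i / q i) 0 := by
  have hh : ContDiffAt ℂ 2 (fun x : C3 => x i) q := by fun_prop
  have hf : fderiv ℂ (fun x : C3 => x i) q a = a i := by
    have := (hasFDerivAt_apply (𝕜 := ℂ) i q).fderiv
    rw [this]; rfl
  have h0 : (‖q i‖ ^ 2 : ℝ) ≠ 0 := by simpa using hq
  have hn : ‖q i‖ ≠ 0 := by simpa using hq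
  have h1 := ((hasLevi_norm_sq hh a).comp (h := Real.log) (Real.contDiffAt_log.2 h0)).const_mul (1 / 2)
  rw [hf] at h1
  refine (h1.congr (Eventually.of_forall fun x => ?_)).congr_val ?_ ?_
  · simp only [Real.log_pow]; push_cast; ring
  · rw [Real.deriv_log]
    have e : (‖q i‖ ^ 2 : ℝ) = Complex.normSq (q i) := (Complex.normSq_eq_norm_sq _).symm
    rw [e, div_eq_mul_inv, Complex.inv_def]
    push_cast
    ring
  · rw [Real.deriv_log, Real.deriv_log']
    simp only [deriv_inv', norm_mul, RCLike.norm_conj, Complex.norm_ofNat]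
    field_simp
    ring

theorem fderiv_coord (T : ℝ) (i : Fin 3) (q v : C3) :
    fderiv ℂ (fun x : C3 => (T : ℂ) * x i) q v = T * v i := by
  have := ((hasFDerivAt_apply (𝕜 := ℂ) i q).const_mul (T : ℂ)).fderiv
  rw [this]; simp

theorem fderiv_coord_mul (T : ℝ) (i j : Fin 3) (q v : C3) :
    fderiv ℂ (fun x : C3 => ((T : ℂ) * x i) * (T * x j)) q v
      = T * q i * (T * v j) + T * q j * (T * v i) := by
  have := (((hasFDerivAt_apply (𝕜 := ℂ) i q).const_mul (T : ℂ)).mul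
    ((hasFDerivAt_apply (𝕜 := ℂ) j q).const_mul (T : ℂ))).fderiv
  erw [this]; simp

theorem exists_hasLevi_lg_nsq (T : ℝ) (a : Fin 3) {q : C3} (v : C3) (hA : nsq T a q ≤ 1) :
    ∃ p L, HasLevi (fun x => lg (nsq T a x)) q v p L ∧ ‖p‖ ^ 2 ≤ 4 * nsq T a q * nsq T a v ∧
      nsq T a v / 2 ≤ L ∧ L ≤ 2 * nsq T a v := by
  have h := hasLevi_lg_norm_sq (h := fun x : C3 => (T : ℂ) * x a) (q := q) (by fun_prop) v
  rw [fderiv_coord] at h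
  refine ⟨_, _, h, ?_, ?_, ?_⟩
  · simp only [norm_div, norm_mul, RCLike.norm_conj, Complex.norm_ofNat, Complex.norm_real,
      nsq, Real.norm_eq_abs]
    rw [div_pow, div_le_iff₀ (by positivity), sq_abs]
    have e : (1 : ℝ) ≤ (1 + (|T| * ‖q a‖) ^ 2) ^ 2 := by nlinarith [sq_nonneg (|T| * ‖q a‖)]
    have e2 : 0 ≤ (2 * (|T| * ‖q a‖) * (|T| * ‖v a‖)) ^ 2 := by positivity
    nlinarith
  · unfold nsq at *
    rw [div_le_div_iff₀ (by norm_num) (by positivity)]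
    have e2 : 0 ≤ ‖(T : ℂ) * q a‖ ^ 2 := by positivity
    have e : (1 + ‖(T : ℂ) * q a‖ ^ 2) ^ 2 ≤ 4 := by nlinarith
    have e3 : 0 ≤ ‖(T : ℂ) * v a‖ ^ 2 := by positivity
    nlinarith
  · unfold nsq at *
    rw [div_le_iff₀ (by positivity)]
    have e2 : 0 ≤ ‖(T : ℂ) * q a‖ ^ 2 := by positivity
    have e : 1 ≤ (1 + ‖(T : ℂ) * q a‖ ^ 2) ^ 2 := by nlinarith
    have e3 : 0 ≤ ‖(T : ℂ) * v a‖ ^ 2 := by positivity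
    nlinarith

theorem norm_add_sq_le (z w : ℂ) : ‖z + w‖ ^ 2 ≤ 2 * (‖z‖ ^ 2 + ‖w‖ ^ 2) := by
  have := norm_add_le z w
  nlinarith [sq_nonneg (‖z‖ - ‖w‖), norm_nonneg (z + w), norm_nonneg z, norm_nonneg w]

theorem exists_hasLevi_lg_nsq_mul (T : ℝ) (b c : Fin 3) (q v : C3) :
    ∃ p L, HasLevi (fun x => lg (nsq T b x * nsq T c x)) q v p L ∧
      ‖p‖ ^ 2 ≤ 8 * (nsq T b q * nsq T c q) * (nsq T b q * nsq T c v + nsq T c q * nsq T b v) ∧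
      0 ≤ L ∧ L ≤ 4 * (nsq T b q * nsq T c v + nsq T c q * nsq T b v) := by
  have h := hasLevi_lg_norm_sq (h := fun x : C3 => ((T : ℂ) * x b) * (T * x c)) (q := q)
    (by fun_prop) v
  rw [fderiv_coord_mul] at h
  have hs := norm_add_sq_le ((T : ℂ) * q b * (T * v c)) (T * q c * (T * v b))
  set D := (T : ℂ) * q b * (T * v c) + T * q c * (T * v b)
  have hD : ‖D‖ ^ 2 ≤ 2 * (nsq T b q * nsq T c v + nsq T c q * nsq T b v) := by
    have e : nsq T b q * nsq T c v + nsq T c q * nsq T b v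
        = ‖(T : ℂ) * q b * (T * v c)‖ ^ 2 + ‖(T : ℂ) * q c * (T * v b)‖ ^ 2 := by
      simp only [nsq, ← mul_pow, ← norm_mul]
    rw [e]; exact hs
  have e1 : ‖(T : ℂ) * q b * (T * q c)‖ ^ 2 = nsq T b q * nsq T c q := by
    simp only [nsq, ← mul_pow, ← norm_mul]
  have e0 : 0 ≤ nsq T b q * nsq T c q := mul_nonneg (nsq_nonneg _ _ _) (nsq_nonneg _ _ _)
  have e3 : 1 ≤ (1 + nsq T b q * nsq T c q) ^ 2 := by nlinarith
  refine ⟨_, _, h.congr (Eventually.of_forall fun x => ?_), ?_, ?_, ?_⟩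
  · simp only [nsq, ← mul_pow, ← norm_mul]
  · rw [norm_div, norm_mul, norm_mul, RCLike.norm_conj, Complex.norm_ofNat, Complex.norm_real,
      Real.norm_eq_abs, div_pow, sq_abs, e1, div_le_iff₀ (by positivity), mul_pow, mul_pow, e1]
    have e4 : 0 ≤ 2 ^ 2 * (nsq T b q * nsq T c q) * ‖D‖ ^ 2 := by positivity
    calc 2 ^ 2 * (nsq T b q * nsq T c q) * ‖D‖ ^ 2
        ≤ 2 ^ 2 * (nsq T b q * nsq T c q) * (2 * (nsq T b q * nsq T c v + nsq T c q * nsq T b v)) := by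
          gcongr
      _ = 8 * (nsq T b q * nsq T c q) * (nsq T b q * nsq T c v + nsq T c q * nsq T b v) * 1 := by ring
      _ ≤ _ := by
          apply mul_le_mul_of_nonneg_left e3
          have := (sq_nonneg ‖D‖).trans hD
          nlinarith
  · positivity
  · rw [e1, div_le_iff₀ (by positivity)]
    nlinarith [sq_nonneg ‖D‖]

/-- The Levi form of `f(d) χ` when `d` is at least of size `S`, the logarithmic derivatives of `f`
are small and `d` and `χ` behave like squares of absolute values of linear functions. -/
theorem HasLevi.step_mul {f : ℝ → ℝ} {d χ : C3 → ℝ} {q v : C3} {p p' : ℂ} {L L' S M R m ε : ℝ}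
    (hf : ContDiff ℝ ∞ f) (hd : HasLevi d q v p L) (hχ : HasLevi χ q v p' L') (hS : 0 < S)
    (hdS : S / 4 ≤ d q) (h1 : |d q| * |deriv f (d q)| ≤ ε)
    (h2 : d q ^ 2 * |deriv (deriv f) (d q)| ≤ 2 * ε) (hχS : |χ q| ≤ m * S) (hp : ‖p‖ ≤ m * R)
    (hp' : ‖p'‖ ≤ m * R) (hL : |L| ≤ m * M) (hR : 0 ≤ R) (hRS : R ^ 2 = S * M) (hm : 1 ≤ m) :
    ∃ P Λ, HasLevi (fun x => f (d x) * χ x) q v P Λ ∧ |Λ - f (d q) * L'| ≤ 24 * m ^ 3 * ε * M ∧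
      ‖P - f (d q) * p'‖ ≤ 4 * m ^ 2 * ε * R := by
  have hM : 0 ≤ M := by
    by_contra! h
    nlinarith [sq_nonneg R]
  have hd0 : 0 < d q := by linarith
  have hε : 0 ≤ ε := le_trans (by positivity) h1
  -- As `d ≥ S / 4`, the logarithmic bounds become `|f'| ≤ 4 ε / S` and `|f''| ≤ 32 ε / S²`; the
  -- negative powers of `S` are compensated by `|χ| ≤ m S` and by gradients of size `m √(S M)`.
  have h1' : |deriv f (d q)| * S ≤ 4 * ε := by
    rw [abs_of_pos hd0] at h1
    nlinarith [abs_nonneg (deriv f (d q))]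
  have h2' : |deriv (deriv f) (d q)| * S ^ 2 ≤ 32 * ε := by
    have : S ^ 2 ≤ 16 * d q ^ 2 := by nlinarith
    nlinarith [abs_nonneg (deriv (deriv f) (d q))]
  set f1 := deriv f (d q)
  set f2 := deriv (deriv f) (d q)
  have hcomp := hd.comp (h := f) (two_le_infty_contDiff hf _)
  have hp2 : ‖p‖ ^ 2 ≤ m ^ 2 * (S * M) := by
    rw [← hRS, ← mul_pow]; gcongr
  have hpp : ‖p‖ * ‖p'‖ ≤ m ^ 2 * (S * M) := by
    rw [← hRS]
    calc ‖p‖ * ‖p'‖ ≤ (m * R) * (m * R) := by gcongr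
      _ = _ := by ring
  refine ⟨_, _, hcomp.mul hχ, ?_, ?_⟩
  · have e : f (d q) * L' + χ q * (f1 * L + f2 * (‖p‖ ^ 2 / 2)) + (↑f1 * p * conj p').re
        - f (d q) * L' = χ q * (f1 * L) + χ q * f2 * (‖p‖ ^ 2 / 2) + (↑f1 * p * conj p').re := by
      ring
    rw [e]
    have t1 : |χ q * (f1 * L)| ≤ 4 * m ^ 2 * ε * M := by
      rw [abs_mul, abs_mul]
      calc |χ q| * (|f1| * |L|) ≤ (m * S) * (|f1| * (m * M)) := by gcongr
        _ = m ^ 2 * M * (|f1| * S) := by ring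
        _ ≤ m ^ 2 * M * (4 * ε) := by gcongr
        _ = _ := by ring
    have t2 : |χ q * f2 * (‖p‖ ^ 2 / 2)| ≤ 16 * m ^ 3 * ε * M := by
      rw [abs_mul, abs_mul, abs_of_nonneg (show 0 ≤ ‖p‖ ^ 2 / 2 by positivity)]
      calc |χ q| * |f2| * (‖p‖ ^ 2 / 2) ≤ (m * S) * |f2| * (m ^ 2 * (S * M) / 2) := by gcongr
        _ = m ^ 3 * M / 2 * (|f2| * S ^ 2) := by ring
        _ ≤ m ^ 3 * M / 2 * (32 * ε) := by gcongr
        _ = _ := by ring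
    have t3 : |(↑f1 * p * conj p').re| ≤ 4 * m ^ 2 * ε * M := by
      refine (Complex.abs_re_le_norm _).trans ?_
      rw [norm_mul, norm_mul, RCLike.norm_conj, Complex.norm_real, Real.norm_eq_abs]
      calc |f1| * ‖p‖ * ‖p'‖ = |f1| * (‖p‖ * ‖p'‖) := by ring
        _ ≤ |f1| * (m ^ 2 * (S * M)) := by gcongr
        _ = m ^ 2 * M * (|f1| * S) := by ring
        _ ≤ m ^ 2 * M * (4 * ε) := by gcongr
        _ = _ := by ring
    have hm3 : m ^ 2 ≤ m ^ 3 := pow_le_pow_right₀ hm (by norm_num)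
    have hεM : 0 ≤ ε * M := by positivity
    calc _ ≤ |χ q * (f1 * L)| + |χ q * f2 * (‖p‖ ^ 2 / 2)| + |(↑f1 * p * conj p').re| :=
          abs_add_three _ _ _
      _ ≤ 4 * m ^ 2 * ε * M + 16 * m ^ 3 * ε * M + 4 * m ^ 2 * ε * M := by gcongr
      _ ≤ _ := by nlinarith
  · rw [add_sub_cancel_left, norm_mul, norm_mul, Complex.norm_real, Complex.norm_real,
      Real.norm_eq_abs, Real.norm_eq_abs]
    calc |χ q| * (|f1| * ‖p‖) ≤ (m * S) * (|f1| * (m * R)) := by gcongr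
      _ = m ^ 2 * R * (|f1| * S) := by ring
      _ ≤ m ^ 2 * R * (4 * ε) := by gcongr
      _ = _ := by ring

end BananaMirror
end

noncomputable section

namespace BananaMirror

open scoped ContDiff Topology ComplexConjugate
open Filter

/-! ### Lower bounds for the Levi form of the potential -/

/-- The Levi forms of the logarithms from which the potential is built, at a point with
`|x_c| ≤ |x_b| ≤ |x_a|`; here `M` is the size of the tangent vector, and `Ra`, `Rb` are the sizes of
the first derivatives. -/
structure Jets (T : ℝ) (a b c : Fin 3) (q v : C3) (Ra Rb M : ℝ) (pa pb pc qa qb qc : ℂ)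
    (La Lb Lc Ma Mb Mc : ℝ) : Prop where
  ja : HasLevi (fun x => lg (nsq T a x)) q v pa La
  jb : HasLevi (fun x => lg (nsq T b x)) q v pb Lb
  jc : HasLevi (fun x => lg (nsq T c x)) q v pc Lc
  ka : HasLevi (fun x => lg (nsq T b x * nsq T c x)) q v qa Ma
  kb : HasLevi (fun x => lg (nsq T a x * nsq T c x)) q v qb Mb
  kc : HasLevi (fun x => lg (nsq T a x * nsq T b x)) q v qc Mc
  M_eq : M = 8 * (nsq T a v + nsq T b v + nsq T c v)
  Ra_nonneg : 0 ≤ Ra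
  Rb_nonneg : 0 ≤ Rb
  Rb_le : Rb ≤ Ra
  Ra_sq : Ra ^ 2 = nsq T a q * M
  Rb_sq : Rb ^ 2 = nsq T b q * M
  pa_le : ‖pa‖ ≤ Ra
  pb_le : ‖pb‖ ≤ Rb
  pc_le : ‖pc‖ ≤ Rb
  qa_le : ‖qa‖ ≤ Rb
  qb_le : ‖qb‖ ≤ Rb
  qc_le : ‖qc‖ ≤ Rb
  le_La : nsq T a v / 2 ≤ La
  le_Lb : nsq T b v / 2 ≤ Lb
  le_Lc : nsq T c v / 2 ≤ Lc
  La_le : La ≤ M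
  Lb_le : Lb ≤ M
  Lc_le : Lc ≤ M
  Ma_nonneg : 0 ≤ Ma
  Mb_nonneg : 0 ≤ Mb
  Mc_nonneg : 0 ≤ Mc
  Ma_le : Ma ≤ M
  Mb_le : Mb ≤ nsq T a q * M
  Mc_le : Mc ≤ M

-- The gradient of `lg (|h|²)` has order `|h| |dh|`, whence `Ra = √(A M)` and `Rb = √(B M)`; the
-- factor `8` in `M` absorbs the numerical constants. The gradients of all three mixed terms are of
-- order `Rb`, since `BΓ`, `AΓ` and `AB` are at most `B`.
set_option maxHeartbeats 800000 in
theorem exists_jets (T : ℝ) (a b c : Fin 3) (q v : C3) (hA : nsq T a q ≤ 1)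
    (hBA : nsq T b q ≤ nsq T a q) (hCB : nsq T c q ≤ nsq T b q) :
    ∃ (Ra Rb M : ℝ) (pa pb pc qa qb qc : ℂ) (La Lb Lc Ma Mb Mc : ℝ),
      Jets T a b c q v Ra Rb M pa pb pc qa qb qc La Lb Lc Ma Mb Mc := by
  obtain ⟨pa, La, ja, pa', la, la'⟩ := exists_hasLevi_lg_nsq T a v hA
  obtain ⟨pb, Lb, jb, pb', lb, lb'⟩ := exists_hasLevi_lg_nsq T b v (hBA.trans hA)
  obtain ⟨pc, Lc, jc, pc', lc, lc'⟩ := exists_hasLevi_lg_nsq T c v (hCB.trans (hBA.trans hA))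
  obtain ⟨qa, Ma, ka, qa', ma, ma'⟩ := exists_hasLevi_lg_nsq_mul T b c q v
  obtain ⟨qb, Mb, kb, qb', mb, mb'⟩ := exists_hasLevi_lg_nsq_mul T a c q v
  obtain ⟨qc, Mc, kc, qc', mc, mc'⟩ := exists_hasLevi_lg_nsq_mul T a b q v
  have hc0 := nsq_nonneg T c q
  have x0 := nsq_nonneg T a v
  have y0 := nsq_nonneg T b v
  have z0 := nsq_nonneg T c v
  set A := nsq T a q
  set B := nsq T b q
  set Γ := nsq T c q
  set x := nsq T a v
  set y := nsq T b v
  set z := nsq T c v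
  have hb0 : 0 ≤ B := hc0.trans hCB
  have ha0 : 0 ≤ A := hb0.trans hBA
  have hB : B ≤ 1 := hBA.trans hA
  have hC : Γ ≤ 1 := hCB.trans hB
  have hCA : Γ ≤ A := hCB.trans hBA
  have hM : 0 ≤ 8 * (x + y + z) := by positivity
  have sq : ∀ {p : ℂ} {D : ℝ}, 0 ≤ D → ‖p‖ ^ 2 ≤ D * (8 * (x + y + z)) →
      ‖p‖ ≤ √(D * (8 * (x + y + z))) := fun _ h => Real.le_sqrt_of_sq_le h
  have mix : ∀ {s t E : ℝ}, 0 ≤ s → 0 ≤ t → s ≤ E → t ≤ E → ∀ {w w' : ℝ}, 0 ≤ w → 0 ≤ w' →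
      w + w' ≤ x + y + z → 0 ≤ E → s * w + t * w' ≤ E * (x + y + z) := by
    intro s t E hs ht hsE htE w w' hw hw' hww hE
    calc s * w + t * w' ≤ E * w + E * w' := by gcongr
      _ = E * (w + w') := by ring
      _ ≤ _ := by gcongr
  have mixa := mix hb0 hc0 hB hC z0 y0 (by linarith) zero_le_one
  have mixb := mix ha0 hc0 le_rfl hCA z0 x0 (by linarith) ha0
  have mixc := mix ha0 hb0 hA hB y0 x0 (by linarith) zero_le_one
  have hAN : A * (x + y + z) ≤ 1 * (x + y + z) := by gcongr
  have bnd : ∀ {p : ℂ} {D w : ℝ}, 0 ≤ D → D ≤ B → w ≤ 1 * (x + y + z) → ‖p‖ ^ 2 ≤ 8 * D * w →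
      ‖p‖ ≤ √(B * (8 * (x + y + z))) := by
    intro p D w hD hDB hw hp
    apply sq hb0
    calc ‖p‖ ^ 2 ≤ 8 * D * w := hp
      _ ≤ 8 * D * (1 * (x + y + z)) := by gcongr
      _ ≤ 8 * B * (1 * (x + y + z)) := by gcongr
      _ = _ := by ring
  refine ⟨√(A * (8 * (x + y + z))), √(B * (8 * (x + y + z))), 8 * (x + y + z), pa, pb, pc, qa, qb, qc,
    La, Lb, Lc, Ma, Mb, Mc, ja, jb, jc, ka, kb, kc, rfl, Real.sqrt_nonneg _, Real.sqrt_nonneg _,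
    Real.sqrt_le_sqrt (by gcongr), Real.sq_sqrt (by positivity), Real.sq_sqrt (by positivity),
    sq ha0 ?_, sq hb0 ?_, sq hb0 ?_, bnd (mul_nonneg hb0 hc0) (mul_le_of_le_one_right hb0 hC) mixa qa',
    bnd (mul_nonneg ha0 hc0) ((mul_le_of_le_one_left hc0 hA).trans hCB) (mixb.trans hAN) qb',
    bnd (mul_nonneg ha0 hb0) (mul_le_of_le_one_left hb0 hA) mixc qc',
    la, lb, lc, by linarith, by linarith, by linarith, ma, mb, mc, by linarith, by linarith,
    by linarith⟩
  · have : A * x ≤ A * (x + y + z) := mul_le_mul_of_nonneg_left (by linarith) ha0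
    linarith [mul_nonneg ha0 x0]
  · have : B * y ≤ B * (x + y + z) := mul_le_mul_of_nonneg_left (by linarith) hb0
    linarith [mul_nonneg hb0 y0]
  · have : Γ * z ≤ B * (x + y + z) := by
      calc Γ * z ≤ B * z := by gcongr
        _ ≤ _ := mul_le_mul_of_nonneg_left (by linarith) hb0
    linarith [mul_nonneg hc0 z0]

namespace Jets

variable {T : ℝ} {a b c : Fin 3} {q v : C3} {Ra Rb M : ℝ} {pa pb pc qa qb qc : ℂ}
    {La Lb Lc Ma Mb Mc : ℝ} (J : Jets T a b c q v Ra Rb M pa pb pc qa qb qc La Lb Lc Ma Mb Mc)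

include J

theorem phA : HasLevi (fun x => ph (nsq T a x) (nsq T b x) (nsq T c x)) q v (pa - qa) (La - Ma) :=
  J.ja.sub J.ka

theorem phB : HasLevi (fun x => ph (nsq T b x) (nsq T a x) (nsq T c x)) q v (pb - qb) (Lb - Mb) :=
  J.jb.sub J.kb

theorem phC : HasLevi (fun x => ph (nsq T c x) (nsq T a x) (nsq T b x)) q v (pc - qc) (Lc - Mc) :=
  J.jc.sub J.kc

theorem g : HasLevi (fun x => gg (nsq T b x) (nsq T c x)) q v (pb + pc + qa) (Lb + Lc + Ma) :=
  (J.jb.add J.jc).add J.ka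

theorem d : HasLevi (fun x => dI (nsq T a x) (nsq T b x) (nsq T c x)) q v
    (pa - qa - (1 / 2 : ℝ) * (pb - qb + (pc - qc))) (La - Ma - 1 / 2 * (Lb - Mb + (Lc - Mc))) :=
  (J.phA.sub ((J.phB.add J.phC).const_mul (1 / 2))).congr
    (Eventually.of_forall fun x => by simp only [dI]; ring)

theorem theta : HasLevi (fun x => ph (nsq T b x) (nsq T a x) (nsq T c x)
    - ph (nsq T c x) (nsq T a x) (nsq T b x)) q v (pb - qb - (pc - qc)) (Lb - Mb - (Lc - Mc)) :=
  J.phB.sub J.phC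

theorem M_nonneg : 0 ≤ M := by
  rw [J.M_eq]
  have := nsq_nonneg T a v
  have := nsq_nonneg T b v
  have := nsq_nonneg T c v
  positivity

theorem phA_le : ‖pa - qa‖ ≤ 2 * Ra := by
  have := norm_sub_le pa qa
  linarith [J.pa_le, J.qa_le, J.Rb_le]

theorem phB_le : ‖pb - qb‖ ≤ 2 * Rb := by
  have := norm_sub_le pb qb
  linarith [J.pb_le, J.qb_le]

theorem phC_le : ‖pc - qc‖ ≤ 2 * Rb := by
  have := norm_sub_le pc qc
  linarith [J.pc_le, J.qc_le]

theorem Mb_le' (hA : nsq T a q ≤ 1) : Mb ≤ M := by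
  have := J.Mb_le
  nlinarith [J.M_nonneg]

theorem L_bounds (hA : nsq T a q ≤ 1) : |La - Ma| ≤ M ∧ |Lb - Mb| ≤ M ∧ |Lc - Mc| ≤ M := by
  have h1 := J.Mb_le' hA
  have h2 := nsq_nonneg T a v
  have h3 := nsq_nonneg T b v
  have h4 := nsq_nonneg T c v
  refine ⟨?_, ?_, ?_⟩ <;> rw [abs_le] <;> constructor <;>
    linarith [J.le_La, J.le_Lb, J.le_Lc, J.La_le, J.Lb_le, J.Lc_le, J.Ma_nonneg, J.Mb_nonneg,
      J.Mc_nonneg, J.Ma_le, J.Mc_le]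

theorem d_le : ‖pa - qa - (1 / 2 : ℝ) * (pb - qb + (pc - qc))‖ ≤ 4 * Ra := by
  have h1 := norm_sub_le (pa - qa) ((1 / 2 : ℝ) * (pb - qb + (pc - qc)))
  have h2 := norm_add_le (pb - qb) (pc - qc)
  rw [norm_mul, Complex.norm_real] at h1
  norm_num at h1 ⊢
  linarith [J.phA_le, J.phB_le, J.phC_le, J.Rb_le]

/-- Near the vertex the coefficients are `2/3` for `lg A`, `lg B`, `lg Γ` and `1/3` for the mixed
terms, so every direction is controlled without restriction to `ker dv₀`. -/
theorem fVII_pos (hv : v ≠ 0) (hT : 0 < T) (hab : a ≠ b) (hac : a ≠ c) (hbc : b ≠ c) :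
    ∃ p L, HasLevi (fun x => fVII (nsq T a x) (nsq T b x) (nsq T c x)) q v p L ∧ 0 < L := by
  have h1 := (((((J.ja.add J.jb).add J.jc).const_mul (2 / 3)).add
    (((J.ka.add J.kb).add J.kc).const_mul (1 / 3))))
  refine ⟨_, _, h1.congr (Eventually.of_forall fun x => by simp only [fVII, gg]; ring), ?_⟩
  have h2 := nsq_nonneg T a v
  have h3 := nsq_nonneg T b v
  have h4 := nsq_nonneg T c v
  have h5 : 0 < nsq T a v + nsq T b v + nsq T c v := by
    by_contra! hn
    apply hv
    funext i
    have : ∀ i, ¬ (0 < nsq T i v) := forall_of_ne hab hac hbc (by linarith) (by linarith) (by linarith)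
    simpa [nsq_pos_iff hT] using this i
  linarith [J.le_La, J.le_Lb, J.le_Lc, J.Ma_nonneg, J.Mb_nonneg, J.Mc_nonneg]

end Jets

/-- A positive lower bound on the kernel of `dv₀`. -/
theorem pos_of_kernel {T : ℝ} {a b c : Fin 3} {q v : C3} {L : ℝ} (hT : 0 < T) (hab : a ≠ b)
    (hac : a ≠ c) (hbc : b ≠ c) (hb : 0 < nsq T b q) (hBA : nsq T b q ≤ nsq T a q)
    (hCB : nsq T c q ≤ nsq T b q) (hv : v ≠ 0)
    (hker : q b * q c * v a + q a * q c * v b + q a * q b * v c = 0)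
    (hL : (nsq T a v + nsq T b v) / 4 - (nsq T a v + nsq T b v + nsq T c v) / 1000 ≤ L) : 0 < L := by
  have hqb := (nsq_pos_iff hT b q).1 hb
  have hqa := (nsq_pos_iff hT a q).1 (hb.trans_le hBA)
  rw [nsq_le_nsq_iff hT] at hBA hCB
  have hqb' : 0 < ‖q b‖ := by simpa using hqb
  have hqa' : 0 < ‖q a‖ := by simpa using hqa
  -- On the kernel `v_c = -(x_c / x_a) v_a - (x_c / x_b) v_b`, and both quotients have absolute
  -- value at most `1`.
  have h1 : ‖v c‖ ≤ ‖v a‖ + ‖v b‖ := by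
    have e : q a * q b * v c = -(q b * q c * v a + q a * q c * v b) := by
      linear_combination hker
    have e2 : ‖q a‖ * ‖q b‖ * ‖v c‖ ≤ ‖q b‖ * ‖q c‖ * ‖v a‖ + ‖q a‖ * ‖q c‖ * ‖v b‖ := by
      rw [← norm_mul, ← norm_mul, e, norm_neg]
      refine (norm_add_le _ _).trans ?_
      simp only [norm_mul]; exact le_rfl
    have e3 : ‖q b‖ * ‖q c‖ * ‖v a‖ + ‖q a‖ * ‖q c‖ * ‖v b‖ ≤
        ‖q a‖ * ‖q b‖ * (‖v a‖ + ‖v b‖) := by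
      have i1 : ‖q b‖ * ‖q c‖ * ‖v a‖ ≤ ‖q b‖ * ‖q a‖ * ‖v a‖ := by
        gcongr; exact hCB.trans hBA
      have i2 : ‖q a‖ * ‖q c‖ * ‖v b‖ ≤ ‖q a‖ * ‖q b‖ * ‖v b‖ := by gcongr
      linarith
    exact le_of_mul_le_mul_left (e2.trans e3) (by positivity)
  have h2 : nsq T c v ≤ 2 * (nsq T a v + nsq T b v) := by
    simp only [nsq_eq hT]
    have : ‖v c‖ ^ 2 ≤ 2 * (‖v a‖ ^ 2 + ‖v b‖ ^ 2) := by
      nlinarith [norm_nonneg (v c), norm_nonneg (v a), norm_nonneg (v b),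
        sq_nonneg (‖v a‖ - ‖v b‖)]
    simp only [mul_pow]
    nlinarith [pow_pos hT 2]
  have ha0 := nsq_nonneg T a v
  have hb0 := nsq_nonneg T b v
  have hc0 := nsq_nonneg T c v
  have h3 : 0 < nsq T a v + nsq T b v := by
    by_contra! hn
    apply hv
    funext i
    have : ∀ i, ¬ (0 < nsq T i v) := forall_of_ne hab hac hbc (by linarith) (by linarith) (by linarith)
    simpa [nsq_pos_iff hT] using this i
  linarith

/-- The estimates that hold outside the central region: either both radial bump functions are
constant or the coordinates are small. -/
theorem Setup.radial {α : Bumps} {T p l ε d A : ℝ} (h : Setup α T p l ε) (hd : A / 4 ≤ d) :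
    (α.α₃ d = 1 ∧ α.α₅ d = 1) ∨ A ≤ 1 / 10 ^ 9 := by
  rcases le_or_gt (T ^ (2 + l / 2 - 2 * l / p) / 2) d with h1 | h1
  · exact Or.inl ⟨h.fits.step₃.high _ h1, h.fits.step₅.high _ h1⟩
  · right
    have := h.scales.s₁_le
    linarith

/-- The frozen coefficients are `α₃` for `lg A` and `lg B`, `1 - (α₃ + α₅) / 2` for `lg Γ`, `1 - α₃`
for `lg (BΓ)` and `lg (AΓ)`, and `(α₃ + α₅) / 2` for `lg (AB)`, all nonnegative. With `9` as a
common constant `m` in `HasLevi.step_mul`, the errors are multiples of `24 * 9 ^ 3 * ε * M`, within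
the allowed `1 / 1000` because `ε ≤ 1 / 10 ^ 9`. -/
theorem Setup.fIIB_bound {α : Bumps} {T p l ε : ℝ} {a b c : Fin 3} {q v : C3} {Ra Rb M : ℝ}
    {pa pb pc qa qb qc : ℂ} {La Lb Lc Ma Mb Mc : ℝ} (h : Setup α T p l ε) (hε : ε ≤ 1 / 10 ^ 9)
    (J : Jets T a b c q v Ra Rb M pa pb pc qa qb qc La Lb Lc Ma Mb Mc)
    (hA : nsq T a q ≤ 1) (hA0 : 0 < nsq T a q) (hBA : nsq T b q ≤ nsq T a q)
    (hCB : nsq T c q ≤ nsq T b q) (hC : nsq T c q ≤ 1 / 16) :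
    ∃ p L, HasLevi (fun x => fIIB α (nsq T a x) (nsq T b x) (nsq T c x)) q v p L ∧
      (nsq T a v + nsq T b v) / 4 - (nsq T a v + nsq T b v + nsq T c v) / 1000 ≤ L := by
  have hc0 := nsq_nonneg T c q
  have hb0 := hc0.trans hCB
  have hM := J.M_nonneg
  obtain ⟨l1, l2, l3⟩ := J.L_bounds hA
  have hd : HasLevi (fun x => dIIB (nsq T a x) (nsq T b x) (nsq T c x)) q v _ _ :=
    ((J.phA.add J.phB).sub (J.phC.const_mul (1 / 2))).congr
      (Eventually.of_forall fun x => by simp only [dIIB]; ring)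
  have hdS : nsq T a q / 4 ≤ dIIB (nsq T a q) (nsq T b q) (nsq T c q) := by
    have e1 := le_dIIB hA0.le hb0 hc0
    have e2 := le_lg_of_le hA0.le hA
    have e3 := le_lg_of_le hb0 (hBA.trans hA)
    norm_num at e2 e3
    nlinarith
  have hdS2 : |dIIB (nsq T a q) (nsq T b q) (nsq T c q)| ≤ 9 * nsq T a q := by
    have e1 := dIIB_le hA0.le hb0 hc0
    rw [abs_of_nonneg (by linarith)]
    nlinarith
  have hpd : ‖pa - qa + (pb - qb) - (1 / 2 : ℝ) * (pc - qc)‖ ≤ 9 * Ra := by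
    have h1 := norm_sub_le (pa - qa + (pb - qb)) ((1 / 2 : ℝ) * (pc - qc))
    have h2 := norm_add_le (pa - qa) (pb - qb)
    rw [norm_mul, Complex.norm_real] at h1
    norm_num at h1 ⊢
    linarith [J.phA_le, J.phB_le, J.phC_le, J.Rb_le, J.Ra_nonneg]
  have hLd : |La - Ma + (Lb - Mb) - 1 / 2 * (Lc - Mc)| ≤ 9 * M := by
    rw [abs_le] at *; constructor <;> linarith
  have hχS : |ph (nsq T c q) (nsq T a q) (nsq T b q)| ≤ 9 * nsq T a q := by
    have e1 := ph_le hA0.le hc0 hb0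
    have e2 := le_ph hA0.le hc0 hb0
    rw [abs_le]; constructor <;> nlinarith
  have hpχ : ‖pc - qc‖ ≤ 9 * Ra := by linarith [J.phC_le, J.Rb_le, J.Ra_nonneg]
  obtain ⟨P3, Λ3, H3, E3, -⟩ := HasLevi.step_mul h.fits.step₃.smooth hd hd hA0 hdS
    (h.fits.step₃.deriv_le _) (h.fits.step₃.deriv2_le _) hdS2 hpd hpd hLd J.Ra_nonneg J.Ra_sq
    (by norm_num)
  obtain ⟨P5, Λ5, H5, E5, -⟩ := HasLevi.step_mul h.fits.step₅.smooth hd J.phC hA0 hdS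
    (h.fits.step₅.deriv_le _) (h.fits.step₅.deriv2_le _) hχS hpd hpχ hLd J.Ra_nonneg J.Ra_sq
    (by norm_num)
  refine ⟨_, _, (((J.g.sub J.phB).add H3).sub (H5.const_mul (1 / 2))).congr
    (Eventually.of_forall fun x => by simp only [fIIB]; ring), ?_⟩
  set d₀ := dIIB (nsq T a q) (nsq T b q) (nsq T c q)
  have u1 := h.fits.step₃.ge d₀
  have u2 := h.fits.step₃.le d₀
  have u3 := h.fits.step₅.ge d₀
  have u4 := h.fits.step₅.le d₀
  set A3 := α.α₃ d₀
  set A5 := α.α₅ d₀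
  have hεM : ε * M ≤ 1 / 10 ^ 9 * M := by gcongr
  have x0 := nsq_nonneg T a v
  have y0 := nsq_nonneg T b v
  have z0 := nsq_nonneg T c v
  have m1 : 2 / 3 * La ≤ A3 * La := mul_le_mul_of_nonneg_right u1 (by linarith [J.le_La])
  have m2 : 2 / 3 * Lb ≤ A3 * Lb := mul_le_mul_of_nonneg_right u1 (by linarith [J.le_Lb])
  have m3 : 0 ≤ (1 - A3 / 2 - A5 / 2) * Lc := mul_nonneg (by linarith) (by linarith [J.le_Lc])
  have m4 : 0 ≤ (1 - A3) * (Ma + Mb) := mul_nonneg (by linarith) (by linarith [J.Ma_nonneg, J.Mb_nonneg])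
  have m5 : 0 ≤ (A3 + A5) / 2 * Mc := mul_nonneg (by linarith) J.Mc_nonneg
  rw [abs_le] at E3 E5
  have hMe := J.M_eq
  linarith [J.le_La, J.le_Lb, E3.1, E5.2]

end BananaMirror
end

/-! ### Positivity of the Levi form in the regions I and IIA, and on `ker dv₀` -/

noncomputable section

namespace BananaMirror

open scoped ContDiff Topology ComplexConjugate
open Filter

namespace Setup

variable {α : Bumps} {T p l ε : ℝ} {a b c : Fin 3} {q v : C3} {Ra Rb M : ℝ}
    {pa pb pc qa qb qc : ℂ} {La Lb Lc Ma Mb Mc : ℝ}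

local notation "K₁" => (T ^ (l / 8 - l / p)) ^ 2
local notation "K₂" => (T ^ (l / 8 - 2 * l / p)) ^ 2
local notation "S₀" => (T ^ (2 + l / 2))

set_option maxHeartbeats 800000 in
/-- The Levi form of `α₄(θ) θ` is close to the one of `θ`, multiplied with `α₄(θ)`. -/
theorem angular (h : Setup α T p l ε) (hε : ε ≤ 1 / 10 ^ 9) (hε0 : 0 ≤ ε)
    (J : Jets T a b c q v Ra Rb M pa pb pc qa qb qc La Lb Lc Ma Mb Mc)
    (hA : nsq T a q ≤ 1) (hBA : nsq T b q ≤ 4 * K₁ * nsq T a q)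
    (hCB : nsq T c q ≤ nsq T b q) (hS : S₀ / 2 ≤ nsq T a q)
    (hu : nsq T a q * nsq T b q * nsq T c q ≤ T ^ (6 + 2 * l)) :
    ∃ (σ : ℝ) (P : ℂ) (Λ : ℝ), HasLevi (fun x => α.α₄ (ph (nsq T b x) (nsq T a x) (nsq T c x)
      - ph (nsq T c x) (nsq T a x) (nsq T b x)) * (ph (nsq T b x) (nsq T a x) (nsq T c x)
      - ph (nsq T c x) (nsq T a x) (nsq T b x))) q v P Λ ∧ 0 ≤ σ ∧ σ ≤ 1 / 2 ∧ (σ = 0 ∨ 0 < nsq T b q) ∧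
      |Λ - σ * (Lb - Mb - (Lc - Mc))| ≤ 24 * 4 ^ 3 * ε * M ∧ ‖P‖ ≤ 9 * Ra ∧
      |α.α₄ (ph (nsq T b q) (nsq T a q) (nsq T c q) - ph (nsq T c q) (nsq T a q) (nsq T b q))
        * (ph (nsq T b q) (nsq T a q) (nsq T c q) - ph (nsq T c q) (nsq T a q) (nsq T b q))|
          ≤ 9 * nsq T a q := by
  have hSc := h.scales
  obtain ⟨hk1, hk2⟩ := hSc.sq_le
  have hr := hSc.r₀_pos
  have hs := hSc.s₀_pos
  have hs' : S₀ ≤ 1 / 10 ^ 12 := by linarith [hSc.s₀_le, hSc.s₁_le]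
  have hM := J.M_nonneg
  have hRa := J.Ra_nonneg
  have hRb := J.Rb_nonneg
  have hc0 := nsq_nonneg T c q
  have hb0 : 0 ≤ nsq T b q := hc0.trans hCB
  have ha0 : 0 < nsq T a q := by linarith
  have hba : nsq T b q ≤ nsq T a q / 100 := by
    have := mul_le_mul_of_nonneg_right (show 4 * K₁ ≤ 1 / 100 by linarith) ha0.le
    linarith
  have hθle : ph (nsq T b q) (nsq T a q) (nsq T c q) - ph (nsq T c q) (nsq T a q) (nsq T b q)
      ≤ nsq T b q * (1 + nsq T a q) := by
    have e1 := ph_le ha0.le hb0 hc0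
    have e2 := le_ph ha0.le hc0 hb0
    linarith
  have hθ0 := le_theta ha0.le hc0 hCB
  have hlg := lg_mono hc0 hCB
  set θ := ph (nsq T b q) (nsq T a q) (nsq T c q) - ph (nsq T c q) (nsq T a q) (nsq T b q) with hθ
  have hpθ : ‖pb - qb - (pc - qc)‖ ≤ 4 * Rb := by
    have := norm_sub_le (pb - qb) (pc - qc)
    linarith [J.phB_le, J.phC_le]
  obtain ⟨-, l2, l3⟩ := J.L_bounds hA
  rcases lt_or_ge θ (2 * T ^ (3 / 2 + 3 * l / 4)) with hlt | hge
  -- `θ ≥ 0` by the order of the coordinates, so `|θ| < 2 r₀` near `q` and the term vanishes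
  -- identically there.
  · have hz : (fun x => α.α₄ (ph (nsq T b x) (nsq T a x) (nsq T c x)
        - ph (nsq T c x) (nsq T a x) (nsq T b x)) * (ph (nsq T b x) (nsq T a x) (nsq T c x)
        - ph (nsq T c x) (nsq T a x) (nsq T b x))) =ᶠ[𝓝 q] fun _ => 0 := by
      have hcont : ContinuousAt (fun x => ph (nsq T b x) (nsq T a x) (nsq T c x)
        - ph (nsq T c x) (nsq T a x) (nsq T b x)) q :=
        ((contDiffAt_ph T b a c q).sub (contDiffAt_ph T c a b q)).continuousAt
      filter_upwards [hcont.eventually_lt_const hlt, hcont.eventually_const_lt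
        (show -(2 * T ^ (3 / 2 + 3 * l / 4)) < θ by linarith)] with x h1 h2
      rw [h.fits.low₄ _ (abs_le.2 ⟨h2.le, h1.le⟩), zero_mul]
    refine ⟨0, 0, 0, (HasLevi.const 0).congr hz, le_rfl, by norm_num, Or.inl rfl, ?_, ?_, ?_⟩
    · simp; positivity
    · simp; positivity
    · rw [h.fits.low₄ θ (abs_le.2 ⟨by linarith, hlt.le⟩)]
      simp; positivity
  · have hB2 : 2 * T ^ (3 / 2 + 3 * l / 4) ≤ nsq T b q * (1 + nsq T a q) := hge.trans hθle
    have hBpos : 0 < nsq T b q := by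
      by_contra! hn
      have := mul_nonpos_of_nonpos_of_nonneg hn (show 0 ≤ 1 + nsq T a q by linarith)
      linarith
    set r := T ^ (3 / 2 + 3 * l / 4)
    -- With `θ ≥ 2 r₀`, the bound `u ≤ s₀ r₀²` forces a definite gap between `Γ` and `B`. Hence `θ`
    -- is comparable with `B`, and `HasLevi.step_mul` applies with `S = B`.
    have hCB' : nsq T c q ≤ 6 / 10 * nsq T b q := by
      by_contra! hn
      have hu' := hSc.u_le'
      have e1 : nsq T a q * nsq T b q * (6 / 10 * nsq T b q) < S₀ * r ^ 2 := by
        calc nsq T a q * nsq T b q * (6 / 10 * nsq T b q)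
            < nsq T a q * nsq T b q * nsq T c q := by gcongr
          _ ≤ _ := hu.trans hu'
      have e2 : (2 * r) ^ 2 ≤ (nsq T b q * (1 + nsq T a q)) ^ 2 := by gcongr
      have e3 : nsq T a q * (2 * r) ^ 2 * (6 / 10) < S₀ * r ^ 2 * (1 + nsq T a q) ^ 2 := by
        calc nsq T a q * (2 * r) ^ 2 * (6 / 10)
            ≤ nsq T a q * (nsq T b q * (1 + nsq T a q)) ^ 2 * (6 / 10) := by gcongr
          _ = nsq T a q * nsq T b q * (6 / 10 * nsq T b q) * (1 + nsq T a q) ^ 2 := by ring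
          _ < _ := by gcongr
      have e4 : r ^ 2 * (24 / 10 * nsq T a q) < r ^ 2 * (S₀ * (1 + nsq T a q) ^ 2) := by
        linarith
      have e5 := lt_of_mul_lt_mul_left e4 (by positivity)
      rcases le_or_gt (nsq T a q) (1 / 100) with h1 | h1
      · have : (1 + nsq T a q) ^ 2 ≤ 11 / 10 := by
          have := mul_le_mul_of_nonneg_left h1 ha0.le
          linarith
        have := mul_le_mul_of_nonneg_left this hs.le
        linarith
      · have : (1 + nsq T a q) ^ 2 ≤ 4 := by
          have := mul_le_mul_of_nonneg_left hA ha0.le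
          linarith
        have := mul_le_mul_of_nonneg_left this hs.le
        linarith
    have hθB : nsq T b q / 4 ≤ θ := by
      have e1 : (nsq T b q - nsq T c q) / (1 + nsq T b q) ≤ lg (nsq T b q) - lg (nsq T c q) := by
        unfold lg
        rw [← Real.log_div (by linarith) (by linarith)]
        have := Real.one_sub_inv_le_log_of_pos
          (show 0 < (1 + nsq T b q) / (1 + nsq T c q) by positivity)
        refine le_trans (le_of_eq ?_) this
        field_simp
        ring
      have e2 : nsq T b q / 4 ≤ (nsq T b q - nsq T c q) / (1 + nsq T b q) := by
        rw [le_div_iff₀ (by linarith)]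
        have := mul_le_mul_of_nonneg_left (show nsq T b q ≤ 1 / 100 by linarith) hb0
        linarith
      linarith
    have hθpos : 0 < θ := by linarith
    have hLθ : |Lb - Mb - (Lc - Mc)| ≤ 4 * M := by
      rw [abs_le] at *; constructor <;> linarith
    have hθS : |θ| ≤ 4 * nsq T b q := by
      rw [abs_of_pos hθpos]; have := mul_le_of_le_one_right hb0 hA
      linarith
    obtain ⟨P, Λ, H, E, E'⟩ := HasLevi.step_mul h.fits.smooth₄ J.theta J.theta hBpos hθB
      (h.fits.deriv_le₄ _ hθpos) (h.fits.deriv2_le₄ _ hθpos) hθS hpθ hpθ hLθ hRb J.Rb_sq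
      (by norm_num)
    have u1 := h.fits.nonneg₄ θ hθpos.le
    have u2 := h.fits.le₄ θ
    refine ⟨α.α₄ θ, P, Λ, H, u1, u2, Or.inr hBpos, E, ?_, ?_⟩
    · have e1 : ‖(α.α₄ θ : ℂ) * (pb - qb - (pc - qc))‖ ≤ 1 / 2 * (4 * Rb) := by
        rw [norm_mul, Complex.norm_real, Real.norm_eq_abs, abs_of_nonneg u1]
        gcongr
      have e2 : ‖P‖ ≤ ‖P - (α.α₄ θ : ℂ) * (pb - qb - (pc - qc))‖
          + ‖(α.α₄ θ : ℂ) * (pb - qb - (pc - qc))‖ := by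
        have := norm_add_le (P - (α.α₄ θ : ℂ) * (pb - qb - (pc - qc)))
          ((α.α₄ θ : ℂ) * (pb - qb - (pc - qc)))
        rwa [sub_add_cancel] at this
      have e3 : ε * Rb ≤ 1 / 10 ^ 9 * Rb := by gcongr
      change ‖P - (α.α₄ θ : ℂ) * (pb - qb - (pc - qc))‖ ≤ _ at E'
      linarith [J.Rb_le]
    · rw [abs_mul, abs_of_nonneg u1]
      calc α.α₄ θ * |θ| ≤ 1 / 2 * (4 * nsq T b q) := by gcongr
        _ ≤ _ := by linarith

/-- The frozen coefficient `1 - α₃ / 2 - α₅ σ` of `lg Γ` can vanish, which leaves `v_c`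
uncontrolled; this is why the kernel of `dv₀` is needed. If `x_b = 0`, then `x_c = 0` and `dv₀ = 0`,
so the kernel is no restriction; but then `σ = 0`, the coefficient is at least `1/2`, and the second
alternative bounds all directions. -/
theorem fI_bound (h : Setup α T p l ε) (hε : ε ≤ 1 / 10 ^ 9) (hε0 : 0 ≤ ε)
    (J : Jets T a b c q v Ra Rb M pa pb pc qa qb qc La Lb Lc Ma Mb Mc)
    (hA : nsq T a q ≤ 1) (hBA : nsq T b q ≤ 4 * K₁ * nsq T a q)
    (hCB : nsq T c q ≤ nsq T b q) (hS : S₀ / 2 ≤ nsq T a q)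
    (hu : nsq T a q * nsq T b q * nsq T c q ≤ T ^ (6 + 2 * l)) :
    ∃ p L, HasLevi (fun x => fI α (nsq T a x) (nsq T b x) (nsq T c x)) q v p L ∧
      (nsq T a v + nsq T b v) / 4 - (nsq T a v + nsq T b v + nsq T c v) / 1000 ≤ L ∧
      (0 < nsq T b q ∨
        (nsq T a v + nsq T b v + nsq T c v) / 4 - (nsq T a v + nsq T b v + nsq T c v) / 1000 ≤ L) := by
  obtain ⟨σ, Pθ, Λθ, Hθ, σ0, σ1, hσ, Eθ, Pθ_le, χ_le⟩ := h.angular hε hε0 J hA hBA hCB hS hu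
  obtain ⟨hk1, hk2⟩ := h.scales.sq_le
  have hs := h.scales.s₀_pos
  have hM := J.M_nonneg
  have hRa := J.Ra_nonneg
  have hc0 := nsq_nonneg T c q
  have hb0 : 0 ≤ nsq T b q := hc0.trans hCB
  have ha0 : 0 < nsq T a q := by linarith
  have hba : nsq T b q ≤ nsq T a q / 100 := by
    have := mul_le_mul_of_nonneg_right (show 4 * K₁ ≤ 1 / 100 by linarith) ha0.le
    linarith
  obtain ⟨l1, l2, l3⟩ := J.L_bounds hA
  have hdS : nsq T a q / 4 ≤ dI (nsq T a q) (nsq T b q) (nsq T c q) := by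
    have e1 := le_dI ha0.le hb0 hc0
    have e2 := le_lg_of_le ha0.le hA
    norm_num at e2
    have := mul_le_of_le_one_left hc0 (show nsq T b q ≤ 1 by linarith)
    linarith
  have hdS2 : |dI (nsq T a q) (nsq T b q) (nsq T c q)| ≤ 9 * nsq T a q := by
    have e1 := dI_le ha0.le hb0 hc0
    rw [abs_of_nonneg (by linarith)]
    have := mul_le_of_le_one_left (show 0 ≤ nsq T b q + nsq T c q by linarith) hA
    linarith
  have hpd := J.d_le.trans (show 4 * Ra ≤ 9 * Ra by linarith)
  have hLd : |La - Ma - 1 / 2 * (Lb - Mb + (Lc - Mc))| ≤ 9 * M := by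
    rw [abs_le] at *; constructor <;> linarith
  obtain ⟨P3, Λ3, H3, E3, -⟩ := HasLevi.step_mul h.fits.step₃.smooth J.d J.d ha0 hdS
    (h.fits.step₃.deriv_le _) (h.fits.step₃.deriv2_le _) hdS2 hpd hpd hLd J.Ra_nonneg J.Ra_sq
    (by norm_num)
  obtain ⟨P5, Λ5, H5, E5, -⟩ := HasLevi.step_mul h.fits.step₅.smooth J.d Hθ ha0 hdS
    (h.fits.step₅.deriv_le _) (h.fits.step₅.deriv2_le _) χ_le hpd Pθ_le hLd J.Ra_nonneg J.Ra_sq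
    (by norm_num)
  -- `e` is a lower bound for the coefficient of `lg Γ`: `0` in general and `1/2` if `σ = 0`.
  have key : ∀ e : ℝ, (e ≤ 0 ∨ e ≤ 1 / 2 ∧ σ = 0) → (nsq T a v + nsq T b v) / 4
      + e * nsq T c v / 2 - (nsq T a v + nsq T b v + nsq T c v) / 1000 ≤
        Lb + Lc + Ma + Λ3 + Λ5 := by
    intro e he
    have hrad := h.radial hdS
    set d₀ := dI (nsq T a q) (nsq T b q) (nsq T c q)
    have u1 := h.fits.step₃.ge d₀
    have u2 := h.fits.step₃.le d₀
    have u3 := h.fits.step₅.ge d₀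
    have u4 := h.fits.step₅.le d₀
    set A3 := α.α₃ d₀
    set A5 := α.α₅ d₀
    have hεM : ε * M ≤ 1 / 10 ^ 9 * M := by gcongr
    have x0 := nsq_nonneg T a v
    have y0 := nsq_nonneg T b v
    have z0 := nsq_nonneg T c v
    have hLc := J.le_Lc
    have hp : 0 ≤ A5 * σ := by positivity
    have hp' : A5 * σ ≤ σ := mul_le_of_le_one_left σ0 u4
    have m1 : 2 / 3 * La ≤ A3 * La := mul_le_mul_of_nonneg_right u1 (by linarith [J.le_La])
    have m2 : 1 / 2 * Lb ≤ (1 - A3 / 2 + A5 * σ) * Lb :=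
      mul_le_mul_of_nonneg_right (by linarith) (by linarith [J.le_Lb])
    have m3 : e * nsq T c v / 2 ≤ (1 - A3 / 2 - A5 * σ) * Lc := by
      rcases he with he | ⟨he, hσ0⟩
      · have : 0 ≤ (1 - A3 / 2 - A5 * σ) * Lc := mul_nonneg (by linarith) (by linarith)
        have := mul_nonpos_of_nonpos_of_nonneg he z0
        linarith
      · rw [hσ0] at hp' ⊢
        have : e * (nsq T c v / 2) ≤ (1 - A3 / 2 - A5 * 0) * (nsq T c v / 2) :=
          mul_le_mul_of_nonneg_right (by linarith) (by linarith)
        have : (1 - A3 / 2 - A5 * 0) * (nsq T c v / 2) ≤ (1 - A3 / 2 - A5 * 0) * Lc :=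
          mul_le_mul_of_nonneg_left hLc (by linarith)
        linarith
    have m4 : 0 ≤ (1 - A3) * Ma := mul_nonneg (by linarith) J.Ma_nonneg
    have m5 : 0 ≤ (A3 / 2 + A5 * σ) * Mc := mul_nonneg (by linarith) J.Mc_nonneg
    -- Only the coefficient of `lg (AΓ)` can have the wrong sign. It is nonnegative if `α₃ = α₅ =
    -- 1`; otherwise `A ≤ 1 / 10 ^ 9`, and `Mb ≤ A M` is negligible.
    have m6 : -(1 / 10 ^ 9 * M) ≤ (A3 / 2 - A5 * σ) * Mb := by
      rcases hrad with ⟨r1, r2⟩ | r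
      · have : 0 ≤ (A3 / 2 - A5 * σ) * Mb :=
          mul_nonneg (by rw [r1, r2]; linarith) J.Mb_nonneg
        have : 0 ≤ 1 / 10 ^ 9 * M := by positivity
        linarith
      · have i1 : Mb ≤ 1 / 10 ^ 9 * M := J.Mb_le.trans (by gcongr)
        have i2 : -1 * Mb ≤ (A3 / 2 - A5 * σ) * Mb :=
          mul_le_mul_of_nonneg_right (by linarith) J.Mb_nonneg
        linarith
    have m7 : |A5 * (Λθ - σ * (Lb - Mb - (Lc - Mc)))| ≤ 24 * 4 ^ 3 * ε * M := by
      rw [abs_mul, abs_of_nonneg u3]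
      exact (mul_le_of_le_one_left (abs_nonneg _) u4).trans Eθ
    rw [abs_le] at E3 E5 m7
    have hMe := J.M_eq
    linarith [J.le_La, J.le_Lb, E3.1, E5.1, m7.1]
  refine ⟨_, _, ((J.g.add H3).add H5).congr
    (Eventually.of_forall fun x => by simp only [fI]; ring), ?_, ?_⟩
  · have := key 0 (Or.inl le_rfl)
    linarith
  · rcases hσ with hσ | hσ
    · right
      have := key (1 / 2) (Or.inr ⟨le_rfl, hσ⟩)
      linarith
    · exact Or.inl hσ

-- The new term is `ψ = α₆ φ_b`. The argument of `α₆` is pluriharmonic with a gradient of order `√(M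
-- / B)`; this is large, but `φ_b` has size `B` and gradient `√(B M)`, so the variation of `α₆`
-- costs only `O(ε M)` and `ψ` behaves like `σ φ_b`. The radial bump functions are then treated as
-- in the other regions.
set_option maxHeartbeats 800000 in
theorem fIIA_bound (h : Setup α T p l ε) (hε : ε ≤ 1 / 10 ^ 9) (hε0 : 0 ≤ ε)
    (J : Jets T a b c q v Ra Rb M pa pb pc qa qb qc La Lb Lc Ma Mb Mc)
    (hA : nsq T a q ≤ 1) (hB0 : 0 < nsq T b q) (hBA : nsq T b q ≤ K₂ * nsq T a q)
    (hCB : nsq T c q ≤ nsq T b q) :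
    ∃ p L, HasLevi (fun x => fIIA α (sig α a b x) (nsq T a x) (nsq T b x) (nsq T c x)) q v p L ∧
      (nsq T a v + nsq T b v) / 4 - (nsq T a v + nsq T b v + nsq T c v) / 1000 ≤ L := by
  obtain ⟨hk1, hk2⟩ := h.scales.sq_le
  have hM := J.M_nonneg
  have hRa := J.Ra_nonneg
  have hRb := J.Rb_nonneg
  have hRab := J.Rb_le
  have hc0 := nsq_nonneg T c q
  have hb0 := hB0.le
  have ha0 : 0 < nsq T a q := by
    by_contra! hn
    have := mul_nonpos_of_nonneg_of_nonpos (pow_pos h.scales.k₂_pos 2).le hn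
    linarith
  have hba : nsq T b q ≤ nsq T a q / 100 := by
    have := mul_le_mul_of_nonneg_right hk2 ha0.le
    linarith
  have hba' : nsq T b q ≤ nsq T a q := by linarith
  obtain ⟨l1, l2, l3⟩ := J.L_bounds hA
  have hqa := (nsq_pos_iff h.pos a q).1 ha0
  have hqb := (nsq_pos_iff h.pos b q).1 hB0
  have x0 := nsq_nonneg T a v
  have y0 := nsq_nonneg T b v
  have z0 := nsq_nonneg T c v
  -- the angular coordinate
  have jt : HasLevi (fun x : C3 => Real.log ‖x b‖ - Real.log ‖x a‖) q v (v b / q b - v a / q a) 0 :=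
    ((hasLevi_log_norm hqb v).sub (hasLevi_log_norm hqa v)).congr_val rfl (by ring)
  set pt := v b / q b - v a / q a
  have hpt : nsq T b q * ‖pt‖ ^ 2 ≤ M / 4 := by
    have e1 : ‖pt‖ ^ 2 ≤ 2 * (‖v b / q b‖ ^ 2 + ‖v a / q a‖ ^ 2) := by
      have := norm_add_sq_le (v b / q b) (-(v a / q a))
      rwa [norm_neg, ← sub_eq_add_neg] at this
    have e2 : nsq T b q * ‖v b / q b‖ ^ 2 = nsq T b v := by
      have : ‖q b‖ ≠ 0 := by simpa using hqb
      rw [nsq_eq h.pos, nsq_eq h.pos, norm_div]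
      field_simp
    have e3 : nsq T a q * ‖v a / q a‖ ^ 2 = nsq T a v := by
      have : ‖q a‖ ≠ 0 := by simpa using hqa
      rw [nsq_eq h.pos, nsq_eq h.pos, norm_div]
      field_simp
    have e4 : nsq T b q * ‖v a / q a‖ ^ 2 ≤ nsq T a q * ‖v a / q a‖ ^ 2 := by gcongr
    have e5 : nsq T b q * ‖pt‖ ^ 2 ≤
        nsq T b q * (2 * (‖v b / q b‖ ^ 2 + ‖v a / q a‖ ^ 2)) := by gcongr
    rw [J.M_eq]
    linarith
  have hptR : nsq T b q * ‖pt‖ ≤ Rb := by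
    apply le_of_sq_le_sq _ hRb
    rw [J.Rb_sq]
    calc (nsq T b q * ‖pt‖) ^ 2 = nsq T b q * (nsq T b q * ‖pt‖ ^ 2) := by ring
      _ ≤ nsq T b q * M := by gcongr; linarith
  have hptphi : ‖pt‖ * (2 * Rb) ≤ M := by
    apply le_of_sq_le_sq _ hM
    calc (‖pt‖ * (2 * Rb)) ^ 2 = 4 * Rb ^ 2 * ‖pt‖ ^ 2 := by ring
      _ = 4 * M * (nsq T b q * ‖pt‖ ^ 2) := by rw [J.Rb_sq]; ring
      _ ≤ 4 * M * (M / 4) := by gcongr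
      _ = M ^ 2 := by ring
  have jσ : HasLevi (sig α a b) q v _ _ := jt.comp (h := α.α₆) (two_le_infty_contDiff h.fits.smooth₆ _)
  have hσ0 := h.sig_nonneg a b q
  have hσ1 := h.sig_le_one a b q
  have d6 := h.fits.deriv_le₆ (Real.log ‖q b‖ - Real.log ‖q a‖)
  have d66 := h.fits.deriv2_le₆ (Real.log ‖q b‖ - Real.log ‖q a‖)
  set s1 := deriv α.α₆ (Real.log ‖q b‖ - Real.log ‖q a‖)
  set s2 := deriv (deriv α.α₆) (Real.log ‖q b‖ - Real.log ‖q a‖)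
  have jψ := jσ.mul J.phB
  have hφB : |ph (nsq T b q) (nsq T a q) (nsq T c q)| ≤ nsq T b q := by
    have e1 := ph_le ha0.le hb0 hc0
    have e2 := le_ph ha0.le hb0 hc0
    have := mul_le_of_le_one_left hc0 hA
    rw [abs_le]; constructor <;> linarith
  have hφC : |ph (nsq T c q) (nsq T a q) (nsq T b q)| ≤ nsq T b q := by
    have e1 := ph_le ha0.le hc0 hb0
    have e2 := le_ph ha0.le hc0 hb0
    have := mul_le_of_le_one_left hb0 hA
    rw [abs_le]; constructor <;> linarith
  set σ := sig α a b q
  set φ := ph (nsq T b q) (nsq T a q) (nsq T c q)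
  have hσφ : |σ * φ| ≤ nsq T b q := by
    rw [abs_mul, abs_of_nonneg hσ0]
    exact (mul_le_of_le_one_left (abs_nonneg _) hσ1).trans hφB
  obtain ⟨pψ, Lψ, jψ', hpψ, hLψ⟩ : ∃ pψ Lψ, HasLevi (fun x => sig α a b x
      * ph (nsq T b x) (nsq T a x) (nsq T c x)) q v pψ Lψ ∧ ‖pψ‖ ≤ 3 * Rb ∧
      |Lψ - σ * (Lb - Mb)| ≤ 2 * ε * M := by
    refine ⟨_, _, jψ, ?_, ?_⟩
    · have e1 : ‖(σ : ℂ) * (pb - qb)‖ ≤ 2 * Rb := by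
        rw [norm_mul, Complex.norm_real, Real.norm_eq_abs, abs_of_nonneg hσ0]
        exact (mul_le_of_le_one_left (norm_nonneg _) hσ1).trans J.phB_le
      have e2 : ‖(φ : ℂ) * ((s1 : ℂ) * pt)‖ ≤ Rb := by
        rw [norm_mul, norm_mul, Complex.norm_real, Complex.norm_real, Real.norm_eq_abs,
          Real.norm_eq_abs]
        calc |φ| * (|s1| * ‖pt‖) ≤ nsq T b q * (1 * ‖pt‖) := by
              gcongr
              linarith
          _ ≤ Rb := by rw [one_mul]; exact hptR
      exact (norm_add_le _ _).trans (by linarith)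
    · have e : σ * (Lb - Mb) + φ * (s1 * 0 + s2 * (‖pt‖ ^ 2 / 2))
          + ((s1 : ℂ) * pt * conj (pb - qb)).re - σ * (Lb - Mb)
          = φ * s2 * (‖pt‖ ^ 2 / 2) + ((s1 : ℂ) * pt * conj (pb - qb)).re := by ring
      rw [e]
      have e1 : |φ * s2 * (‖pt‖ ^ 2 / 2)| ≤ ε * M := by
        rw [abs_mul, abs_mul, abs_of_nonneg (show 0 ≤ ‖pt‖ ^ 2 / 2 by positivity)]
        calc |φ| * |s2| * (‖pt‖ ^ 2 / 2) ≤ nsq T b q * ε * (‖pt‖ ^ 2 / 2) := by gcongr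
          _ = ε * (nsq T b q * ‖pt‖ ^ 2) / 2 := by ring
          _ ≤ ε * (M / 4) / 2 := by gcongr
          _ ≤ ε * M := by have := mul_nonneg hε0 hM; linarith
      have e2 : |((s1 : ℂ) * pt * conj (pb - qb)).re| ≤ ε * M := by
        refine (Complex.abs_re_le_norm _).trans ?_
        rw [norm_mul, norm_mul, RCLike.norm_conj, Complex.norm_real, Real.norm_eq_abs, mul_assoc]
        have i1 : ‖pt‖ * ‖pb - qb‖ ≤ M := le_trans (by gcongr; exact J.phB_le) hptphi
        gcongr
      exact (abs_add_le _ _).trans (by linarith)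
  -- the radial coordinate
  have jd : HasLevi (fun x => dIIA (sig α a b x) (nsq T a x) (nsq T b x) (nsq T c x)) q v _ _ :=
    (J.d.add (jψ'.const_mul (3 / 2))).congr
      (Eventually.of_forall fun x => by simp only [dIIA]; ring)
  have jχ : HasLevi (fun x => 1 / 2 * (ph (nsq T b x) (nsq T a x) (nsq T c x)
      - ph (nsq T c x) (nsq T a x) (nsq T b x)
      - sig α a b x * ph (nsq T b x) (nsq T a x) (nsq T c x))) q v _ _ :=
    (J.theta.sub jψ').const_mul (1 / 2)
  have hLψ' : |Lψ| ≤ 2 * M := by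
    have i1 : |σ * (Lb - Mb)| ≤ M := by
      rw [abs_mul, abs_of_nonneg hσ0]
      exact (mul_le_of_le_one_left (abs_nonneg _) hσ1).trans l2
    have i2 : ε * M ≤ 1 / 10 ^ 9 * M := by gcongr
    rw [abs_le] at *
    constructor <;> linarith
  have hdS : nsq T a q / 4 ≤ dIIA σ (nsq T a q) (nsq T b q) (nsq T c q) := by
    have e1 := le_dIIA ha0.le hb0 hc0 hσ0 hσ1
    have e2 := le_lg_of_le ha0.le hA
    norm_num at e2
    have := mul_le_of_le_one_left hc0 hA
    have := mul_le_of_le_one_left hc0 (show nsq T b q ≤ 1 by linarith)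
    linarith
  have hdS2 : |dIIA σ (nsq T a q) (nsq T b q) (nsq T c q)| ≤ 9 * nsq T a q := by
    have e1 := dIIA_le ha0.le hb0 hc0 hσ0 hσ1
    rw [abs_of_nonneg (by linarith)]
    have := mul_le_of_le_one_left (show 0 ≤ nsq T b q + nsq T c q by linarith) hA
    linarith
  have hpd : ‖pa - qa - (1 / 2 : ℝ) * (pb - qb + (pc - qc)) + (3 / 2 : ℝ) * pψ‖ ≤ 9 * Ra := by
    have h1 := norm_add_le (pa - qa - (1 / 2 : ℝ) * (pb - qb + (pc - qc))) ((3 / 2 : ℝ) * pψ)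
    rw [norm_mul ((3 / 2 : ℝ) : ℂ), Complex.norm_real, Real.norm_eq_abs,
      abs_of_pos (by norm_num)] at h1
    linarith [J.d_le]
  have hLd : |La - Ma - 1 / 2 * (Lb - Mb + (Lc - Mc)) + 3 / 2 * Lψ| ≤ 9 * M := by
    rw [abs_le] at *; constructor <;> linarith
  have hpχ : ‖((1 / 2 : ℝ) : ℂ) * (pb - qb - (pc - qc) - pψ)‖ ≤ 9 * Ra := by
    have h1 := norm_sub_le (pb - qb - (pc - qc)) pψ
    have h2 := norm_sub_le (pb - qb) (pc - qc)
    rw [norm_mul, Complex.norm_real, Real.norm_eq_abs, abs_of_pos (by norm_num)]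
    linarith [J.phB_le, J.phC_le]
  have hχS : |1 / 2 * (φ - ph (nsq T c q) (nsq T a q) (nsq T b q) - σ * φ)| ≤ 9 * nsq T a q := by
    rw [abs_le] at *; constructor <;> linarith
  obtain ⟨P3, Λ3, H3, E3, -⟩ := HasLevi.step_mul h.fits.step₃.smooth jd jd ha0 hdS
    (h.fits.step₃.deriv_le _) (h.fits.step₃.deriv2_le _) hdS2 hpd hpd hLd hRa J.Ra_sq (by norm_num)
  obtain ⟨P5, Λ5, H5, E5, -⟩ := HasLevi.step_mul h.fits.step₅.smooth jd jχ ha0 hdS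
    (h.fits.step₅.deriv_le _) (h.fits.step₅.deriv2_le _) hχS hpd hpχ hLd hRa J.Ra_sq (by norm_num)
  refine ⟨_, _, (((J.g.sub jψ').add H3).add H5).congr
    (Eventually.of_forall fun x => by simp only [fIIA]; ring), ?_⟩
  have hrad := h.radial hdS
  change |Λ3 - α.α₃ (dIIA σ (nsq T a q) (nsq T b q) (nsq T c q)) * _| ≤ _ at E3
  change |Λ5 - α.α₅ (dIIA σ (nsq T a q) (nsq T b q) (nsq T c q)) * _| ≤ _ at E5
  set d₀ := dIIA σ (nsq T a q) (nsq T b q) (nsq T c q)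
  have u1 := h.fits.step₃.ge d₀
  have u2 := h.fits.step₃.le d₀
  have u3 := h.fits.step₅.ge d₀
  have u4 := h.fits.step₅.le d₀
  set A3 := α.α₃ d₀
  set A5 := α.α₅ d₀
  have hεM : ε * M ≤ 1 / 10 ^ 9 * M := by gcongr
  -- This coefficient of `lg B` is affine in `σ`, with the values `1 - α₃ / 2 + α₅ / 2` at `0` and
  -- `α₃` at `1`.
  have hcoef : 1 / 2 ≤ 1 - σ + A3 * (-1 / 2 + 3 / 2 * σ) + 1 / 2 * A5 * (1 - σ) := by
    have : 0 ≤ A5 * (1 - σ) := mul_nonneg u3 (by linarith)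
    have := mul_le_mul_of_nonneg_right u1 hσ0
    linarith
  have hcoef' : 1 - σ + A3 * (-1 / 2 + 3 / 2 * σ) + 1 / 2 * A5 * (1 - σ) ≤ 4 := by
    have : A5 * (1 - σ) ≤ 1 * 1 := mul_le_mul u4 (by linarith) (by linarith) zero_le_one
    have := mul_le_mul_of_nonneg_right u2 hσ0
    linarith
  have m1 : 2 / 3 * La ≤ A3 * La := mul_le_mul_of_nonneg_right u1 (by linarith [J.le_La])
  have m2 : 1 / 2 * Lb ≤ (1 - σ + A3 * (-1 / 2 + 3 / 2 * σ) + 1 / 2 * A5 * (1 - σ)) * Lb :=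
    mul_le_mul_of_nonneg_right hcoef (by linarith [J.le_Lb])
  have m3 : 0 ≤ (1 - A3 / 2 - A5 / 2) * Lc := mul_nonneg (by linarith) (by linarith [J.le_Lc])
  have m4 : 0 ≤ (1 - A3) * Ma := mul_nonneg (by linarith) J.Ma_nonneg
  have m5 : 0 ≤ (A3 / 2 + A5 / 2) * Mc := mul_nonneg (by linarith) J.Mc_nonneg
  have m6 : -(4 / 10 ^ 9 * M) ≤
      -(-σ + A3 * (-1 / 2 + 3 / 2 * σ) + 1 / 2 * A5 * (1 - σ)) * Mb := by
    rcases hrad with ⟨r1, r2⟩ | r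
    · have e : -σ + A3 * (-1 / 2 + 3 / 2 * σ) + 1 / 2 * A5 * (1 - σ) = 0 := by
        rw [r1, r2]; ring
      rw [e]
      have : 0 ≤ 4 / 10 ^ 9 * M := by positivity
      linarith
    · have i1 : Mb ≤ 1 / 10 ^ 9 * M := J.Mb_le.trans (by gcongr)
      have i2 : -4 * Mb ≤ -(-σ + A3 * (-1 / 2 + 3 / 2 * σ) + 1 / 2 * A5 * (1 - σ)) * Mb :=
        mul_le_mul_of_nonneg_right (by linarith) J.Mb_nonneg
      linarith
  have m7 : |(-1 + 3 / 2 * A3 - 1 / 2 * A5) * (Lψ - σ * (Lb - Mb))| ≤ 2 * ε * M := by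
    rw [abs_mul]
    refine (mul_le_of_le_one_left (abs_nonneg _) ?_).trans hLψ
    rw [abs_le]; constructor <;> linarith
  rw [abs_le] at E3 E5 m7
  have hMe := J.M_eq
  have key : A3 * (La - Ma - 1 / 2 * (Lb - Mb + (Lc - Mc)) + 3 / 2 * Lψ)
      + A5 * (1 / 2 * (Lb - Mb - (Lc - Mc) - Lψ)) + (Lb + Lc + Ma - Lψ)
      = A3 * La + (1 - σ + A3 * (-1 / 2 + 3 / 2 * σ) + 1 / 2 * A5 * (1 - σ)) * Lb
        + (1 - A3 / 2 - A5 / 2) * Lc + (1 - A3) * Ma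
        + -(-σ + A3 * (-1 / 2 + 3 / 2 * σ) + 1 / 2 * A5 * (1 - σ)) * Mb + (A3 / 2 + A5 / 2) * Mc
        + (-1 + 3 / 2 * A3 - 1 / 2 * A5) * (Lψ - σ * (Lb - Mb)) := by ring
  linarith [J.le_La, J.le_Lb, E3.1, E5.1, m7.1]

/-- On the part of the polydisc over `|v₀| ≤ T ^ l`, the Levi form of the potential is positive on
the kernel of `dv₀`. -/
theorem levi_pos (h : Setup α T p l ε) (hε : ε ≤ 1 / 10 ^ 9) (hε0 : 0 ≤ ε)
    (hq : ‖v0 q‖ ≤ T ^ l) (hq1 : ∀ i, ‖(T : ℂ) * q i‖ ≤ 1) (hv : v ≠ 0)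
    (hker : fderiv ℂ v0 q v = 0) :
    0 < iddbar (potential α T p l) q v (Complex.I • v) := by
  have hTl : 0 < T ^ l := Real.rpow_pos_of_pos h.pos l
  have hΩ : q ∈ bigDomain T l := ⟨by linarith, fun i => (hq1 i).trans_lt (by norm_num)⟩
  have hA : ∀ i, nsq T i q ≤ 1 := fun i => by
    unfold nsq
    have := hq1 i
    nlinarith [norm_nonneg ((T : ℂ) * q i)]
  obtain ⟨a, b, c, hab, hac, hbc, hBA, hCB, hreg⟩ := h.exists_region hΩ
  have hker' : q b * q c * v a + q a * q c * v b + q a * q b * v c = 0 := by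
    have e1 : v0 = fun x : C3 => x a * x b * x c := by
      funext x; exact (prod_of_ne x hab hac hbc).symm
    have := (((hasFDerivAt_apply (𝕜 := ℂ) a q).mul (hasFDerivAt_apply (𝕜 := ℂ) b q)).mul
      (hasFDerivAt_apply (𝕜 := ℂ) c q)).fderiv
    rw [e1] at hker
    erw [this] at hker
    simp at hker
    linear_combination hker
  have hu : nsq T a q * nsq T b q * nsq T c q ≤ T ^ (6 + 2 * l) := by
    rw [nsq_prod q hab hac hbc, rpow_six_add h.pos]
    have := h.pos
    gcongr
  obtain ⟨Ra, Rb, M, pa, pb, pc, qa, qb, qc, La, Lb, Lc, Ma, Mb, Mc, J⟩ :=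
    exists_jets T a b c q v (hA a) hBA hCB
  have hs := h.scales.s₀_pos
  have finish : ∀ {f : C3 → ℝ} {P : ℂ} {L : ℝ}, potential α T p l =ᶠ[𝓝 q] f → HasLevi f q v P L →
      0 < L → 0 < iddbar (potential α T p l) q v (Complex.I • v) := by
    intro f P L h1 h2 h3
    rw [(h2.congr h1).4]; exact h3
  rcases hreg with h1 | ⟨ha, ⟨hB, h1⟩ | ⟨hb, hB, h1⟩ | ⟨hB, h1⟩⟩
  · obtain ⟨P, L, H, hL⟩ := J.fVII_pos hv h.pos hab hac hbc
    exact finish h1 H hL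
  · obtain ⟨P, L, H, hL, hL'⟩ := h.fI_bound hε hε0 J (hA a) hB.le hCB ha hu
    refine finish h1 H ?_
    rcases hL' with hb | hL'
    · exact pos_of_kernel h.pos hab hac hbc hb hBA hCB hv hker' hL
    · have h2 := nsq_nonneg T a v
      have h3 := nsq_nonneg T b v
      have h4 := nsq_nonneg T c v
      have h5 : 0 < nsq T a v + nsq T b v + nsq T c v := by
        by_contra! hn
        apply hv
        funext i
        have : ∀ i, ¬ (0 < nsq T i v) :=
          forall_of_ne hab hac hbc (by linarith) (by linarith) (by linarith)
        simpa [nsq_pos_iff h.pos] using this i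
      linarith
  · obtain ⟨P, L, H, hL⟩ := h.fIIA_bound hε hε0 J (hA a) hb hB.le hCB
    exact finish h1 H (pos_of_kernel h.pos hab hac hbc hb hBA hCB hv hker' hL)
  · have ha0 : 0 < nsq T a q := by linarith
    have hb : 0 < nsq T b q := lt_of_lt_of_le (mul_pos (pow_pos h.scales.k₂_pos 2) ha0) hB
    -- `Γ` is the smallest of the three, so `Γ³ ≤ ABΓ`, which is tiny.
    have hC : nsq T c q ≤ 1 / 16 := by
      by_contra! hn
      have e1 : (1 / 16 : ℝ) * (1 / 16) * (1 / 16) ≤ nsq T a q * nsq T b q * nsq T c q := by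
        have := hn.le.trans hCB
        have := this.trans hBA
        gcongr
      have hS := h.scales
      have e2 := hS.u_le
      have e3 : S₀ * (T ^ (2 + 3 * l / 4 - 2 * l / p)) ^ 2 ≤ 1 := by
        have i1 : S₀ ≤ 1 := by linarith [hS.s₀_le, hS.s₁_le]
        have i2 : T ^ (2 + 3 * l / 4 - 2 * l / p) ≤ 1 := by
          rw [hS.r₁_eq]
          have := hS.sq_le
          have := pow_pos hS.k₁_pos 2
          nlinarith
        have i3 : 0 < T ^ (2 + 3 * l / 4 - 2 * l / p) := Real.rpow_pos_of_pos h.pos _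
        have i4 : (T ^ (2 + 3 * l / 4 - 2 * l / p)) ^ 2 ≤ 1 := by nlinarith
        nlinarith
      linarith
    obtain ⟨P, L, H, hL⟩ := h.fIIB_bound hε J (hA a) ha0 hBA hCB hC
    exact finish h1 H (pos_of_kernel h.pos hab hac hbc hb hBA hCB hv hker' hL)

end Setup
end BananaMirror
end

/-! ### Strict plurisubharmonicity after adding a multiple of `|v₀|²` -/

noncomputable section

namespace BananaMirror

open scoped ContDiff Topology ComplexConjugate
open Filter

/-- Where `f > 0`, any `C ≥ 0` works. The rest of `K` is compact, and on it `g` has a positive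
minimum and `f` a finite one. -/
theorem _root_.IsCompact.exists_forall_pos_add_mul {X : Type*} [TopologicalSpace X] [T2Space X]
    {K : Set X} (hK : IsCompact K) {f g : X → ℝ} (hf : ContinuousOn f K) (hg : ContinuousOn g K)
    (hg0 : ∀ x ∈ K, 0 ≤ g x) (hfg : ∀ x ∈ K, g x = 0 → 0 < f x) :
    ∃ C₀ : ℝ, ∀ C ≥ C₀, ∀ x ∈ K, 0 < f x + C * g x := by
  have hK' : IsCompact (K ∩ f ⁻¹' Set.Iic 0) :=
    hK.of_isClosed_subset (hf.preimage_isClosed_of_isClosed hK.isClosed isClosed_Iic)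
      Set.inter_subset_left
  rcases (K ∩ f ⁻¹' Set.Iic 0).eq_empty_or_nonempty with he | hne
  · refine ⟨0, fun C hC x hx => ?_⟩
    have : 0 < f x := by
      by_contra! hn
      exact (Set.eq_empty_iff_forall_notMem.1 he) x ⟨hx, hn⟩
    have := mul_nonneg hC.le (hg0 x hx)
    linarith
  · obtain ⟨y, hy, hym⟩ := hK'.exists_isMinOn hne (hg.mono Set.inter_subset_left)
    obtain ⟨z, hz, hzm⟩ := hK'.exists_isMinOn hne (hf.mono Set.inter_subset_left)
    have hm : 0 < g y := (hg0 y hy.1).lt_of_ne' fun h0 => absurd (hfg y hy.1 h0) (not_lt.2 hy.2)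
    have hz0 : f z ≤ 0 := hz.2
    refine ⟨(1 - f z) / g y, fun C hC x hx => ?_⟩
    have hC0 : 0 ≤ C := le_trans (div_nonneg (by linarith) hm.le) hC
    rcases lt_or_ge 0 (f x) with h | h
    · have := mul_nonneg hC0 (hg0 x hx)
      linarith
    · have h1 : g y ≤ g x := hym ⟨hx, h⟩
      have h2 : f z ≤ f x := hzm ⟨hx, h⟩
      have h3 : 1 - f z ≤ C * g y := (div_le_iff₀ hm).1 hC
      have h4 : C * g y ≤ C * g x := by gcongr
      linarith

theorem contDiff_v0 {n : WithTop ℕ∞} : ContDiff ℂ n v0 := by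
  unfold v0
  fun_prop

theorem _root_.ContDiffAt.continuousAt_iddbar {F : C3 → ℝ} {q v : C3} (hF : ContDiffAt ℝ ∞ F q) :
    ContinuousAt (fun x : C3 × C3 => iddbar F x.1 x.2 (Complex.I • x.2)) (q, v) := by
  have h2 : ContinuousAt (fderiv ℝ (fderiv ℝ F)) q :=
    ((hF.fderiv_right (m := ∞) (by simp)).fderiv_right (m := ∞) (by simp)).continuousAt
  have h3 : ContinuousAt (fun x : C3 × C3 => fderiv ℝ (fderiv ℝ F) x.1) (q, v) :=
    ContinuousAt.comp (f := Prod.fst) (x := (q, v)) h2 continuousAt_fst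
  have hI : ContinuousAt (fun x : C3 × C3 => Complex.I • x.2) (q, v) :=
    by fun_prop
  have hII : ContinuousAt (fun x : C3 × C3 => Complex.I • Complex.I • x.2) (q, v) :=
    by fun_prop
  unfold iddbar
  exact (((h3.clm_apply hI).clm_apply hI).sub
    ((h3.clm_apply continuousAt_snd).clm_apply hII)).div_const 2

theorem iddbar_smul (F : C3 → ℝ) (q v : C3) (r : ℝ) :
    iddbar F q (r • v) (Complex.I • r • v) = r ^ 2 * iddbar F q v (Complex.I • v) := by
  rw [smul_comm Complex.I r v]
  simp only [iddbar, smul_comm Complex.I r, map_smul, smul_apply, smul_eq_mul]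
  ring

/-- With a large multiple of `|v₀|²` added, the potential is strictly plurisubharmonic. -/
theorem Setup.exists_const {α : Bumps} {T p l ε : ℝ} (h : Setup α T p l ε) (hε : ε ≤ 1 / 10 ^ 9)
    (hε0 : 0 ≤ ε) : ∃ C₀ : ℝ, ∀ C ≥ C₀, ∀ q, ‖v0 q‖ ≤ T ^ l → (∀ i, ‖(T : ℂ) * q i‖ ≤ 1) →
      ∀ v ≠ 0, 0 < iddbar (fun x => potential α T p l x + C * ‖v0 x‖ ^ 2) q v (Complex.I • v) := by
  have hTl : 0 < T ^ l := Real.rpow_pos_of_pos h.pos l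
  have hΩ : ∀ q, ‖v0 q‖ ≤ T ^ l → (∀ i, ‖(T : ℂ) * q i‖ ≤ 1) → q ∈ bigDomain T l :=
    fun q h1 h2 => ⟨by linarith, fun i => (h2 i).trans_lt (by norm_num)⟩
  set D : Set C3 := {q | ‖v0 q‖ ≤ T ^ l ∧ ∀ i, ‖(T : ℂ) * q i‖ ≤ 1} with hD
  have hDc : IsCompact D := by
    refine Metric.isCompact_of_isClosed_isBounded ?_ ?_
    · refine (isClosed_le continuous_v0.norm continuous_const).inter ?_
      have : {q : C3 | ∀ i, ‖(T : ℂ) * q i‖ ≤ 1} = ⋂ i, {q | ‖(T : ℂ) * q i‖ ≤ 1} := by ext; simp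
      change IsClosed {q : C3 | ∀ i, ‖(T : ℂ) * q i‖ ≤ 1}
      rw [this]
      exact isClosed_iInter fun i => isClosed_le (by fun_prop) continuous_const
    · refine (Metric.isBounded_closedBall (x := (0 : C3)) (r := 1 / T)).subset fun q hq => ?_
      have hT := h.pos
      rw [mem_closedBall_zero_iff, pi_norm_le_iff_of_nonneg (by positivity)]
      intro i
      have := hq.2 i
      rw [norm_mul, Complex.norm_real, Real.norm_eq_abs, abs_of_pos hT] at this
      rwa [le_div_iff₀ hT, mul_comm]
  -- The Levi form is homogeneous of degree two in the direction, so unit vectors suffice. The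
  -- closed condition `‖v0 q‖ ≤ T ^ l` is admissible because the potential is smooth on the larger
  -- `bigDomain`.
  have hK := hDc.prod (isCompact_sphere (0 : C3) 1)
  have hL : ∀ C : ℝ, ∀ q ∈ D, ∀ v, iddbar (fun x => potential α T p l x + C * ‖v0 x‖ ^ 2) q v
      (Complex.I • v) = iddbar (potential α T p l) q v (Complex.I • v)
        + C * (2 * ‖fderiv ℂ v0 q v‖ ^ 2) := by
    intro C q hq v
    have hF := (h.contDiffAt_potential (hΩ q hq.1 hq.2)).of_le two_le_infty
    have j : HasLevi (potential α T p l) q v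
        ((fderiv ℝ (potential α T p l) q v : ℂ)
          - Complex.I * fderiv ℝ (potential α T p l) q (Complex.I • v)) _ :=
      ⟨hF, by simp, by simp, rfl⟩
    exact (j.add ((hasLevi_norm_sq contDiff_v0.contDiffAt v).const_mul C)).4
  obtain ⟨C₀, hC₀⟩ := hK.exists_forall_pos_add_mul
    (f := fun x => iddbar (potential α T p l) x.1 x.2 (Complex.I • x.2))
    (g := fun x => 2 * ‖fderiv ℂ v0 x.1 x.2‖ ^ 2)
    (fun x hx => (h.contDiffAt_potential
      (hΩ x.1 hx.1.1 hx.1.2)).continuousAt_iddbar.continuousWithinAt)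
    (by
      have : Continuous (fderiv ℂ v0) := contDiff_v0.continuous_fderiv (n := 1) (by simp)
      exact (((this.comp continuous_fst).clm_apply continuous_snd).norm.pow 2).const_mul 2
        |>.continuousOn)
    (fun x _ => by positivity)
    (fun x hx h0 => h.levi_pos hε hε0 hx.1.1 hx.1.2
      (by
        rintro h0
        have := mem_sphere_zero_iff_norm.1 hx.2
        rw [h0, norm_zero] at this
        exact zero_ne_one this)
      (by simpa using h0))
  refine ⟨C₀, fun C hC q hq hq1 v hv => ?_⟩
  have hv' : 0 < ‖v‖ := norm_pos_iff.2 hv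
  have e : v = ‖v‖ • (‖v‖⁻¹ • v) := by rw [smul_smul, mul_inv_cancel₀ hv'.ne', one_smul]
  rw [e, iddbar_smul]
  refine mul_pos (by positivity) ?_
  rw [hL C q ⟨hq, hq1⟩]
  exact hC₀ C hC (q, ‖v‖⁻¹ • v) ⟨⟨hq, hq1⟩, by simp [norm_smul, hv'.ne']⟩

end BananaMirror
end

noncomputable section

namespace BananaMirror

open scoped ContDiff Topology ComplexConjugate
open Filter

/-! ### Compositions of transition maps -/

/-- The coordinate functions `T x_i`. -/
def scaled (T : ℝ) (q : C3) (i : Fin 3) : ℂ := T * q i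

/-- The function `T³ v₀`, the product of the functions `T x_i`. -/
def scaledV0 (T : ℝ) (q : C3) : ℂ := (T : ℂ) ^ 3 * v0 q

section Scaled

variable {T : ℝ} {q q' : C3} {i j k : Fin 3}

theorem scaled_mul (T : ℝ) (q : C3) (hij : i ≠ j) (hik : i ≠ k) (hjk : j ≠ k) :
    scaled T q i * scaled T q j * scaled T q k = scaledV0 T q := by
  rw [prod_of_ne (scaled T q) hij hik hjk]
  simp only [scaled, scaledV0, v0]
  ring

theorem scaled_eq_zero (hT : 0 < T) : scaled T q i = 0 ↔ q i = 0 := by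
  have : (T : ℂ) ≠ 0 := by exact_mod_cast hT.ne'
  simp [scaled, this]

theorem scaledV0_eq_zero (hT : 0 < T) : scaledV0 T q = 0 ↔ v0 q = 0 := by
  have : (T : ℂ) ≠ 0 := by exact_mod_cast hT.ne'
  simp [scaledV0, this]

theorem ext_of_scaled (hT : 0 < T) (hij : i ≠ j) (hik : i ≠ k) (hjk : j ≠ k)
    (hi : scaled T q i = scaled T q' i) (hj : scaled T q j = scaled T q' j)
    (hk : scaled T q k = scaled T q' k) : q = q' := by
  have hT' : (T : ℂ) ≠ 0 := by exact_mod_cast hT.ne'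
  funext m
  have := forall_of_ne (R := fun m => scaled T q m = scaled T q' m) hij hik hjk hi hj hk m
  exact mul_left_cancel₀ hT' this

theorem scaled_edgeMap_self (hT : 0 < T) (i : Fin 3) (q : C3) :
    scaled T (edgeMap T i q) i = (scaled T q i)⁻¹ := by
  have hT' : (T : ℂ) ≠ 0 := by exact_mod_cast hT.ne'
  rw [scaled, Setup.edgeMap_self, scaled]
  rcases eq_or_ne (q i) 0 with h | h
  · simp [h]
  · field_simp

theorem scaled_edgeMap_of_ne (q : C3) (hij : i ≠ j) (hik : i ≠ k) (hjk : j ≠ k) :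
    scaled T (edgeMap T i q) j = scaled T q i * scaled T q k := by
  rw [scaled, Setup.edgeMap_of_ne T hij hik hjk, scaled, scaled]
  ring

theorem ne_zero_of_v0 (h : v0 q ≠ 0) (i : Fin 3) : q i ≠ 0 := by
  intro h0
  apply h
  fin_cases i <;> simp_all [v0]

theorem exists_others (i : Fin 3) : ∃ j k, i ≠ j ∧ i ≠ k ∧ j ≠ k := by
  revert i; decide

theorem exists_third (i j : Fin 3) : ∃ k, i ≠ k ∧ j ≠ k := by
  revert i j; decide

/-- For `v₀ ≠ 0` the product of two scaled coordinates is `u` divided by the third, so every edge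
inverts all coordinates up to a power of `u`. This is what makes compositions computable. -/
theorem scaled_edgeMap (hT : 0 < T) (h : v0 q ≠ 0) (i j : Fin 3) : scaled T (edgeMap T i q) j =
    scaledV0 T q ^ (if j = i then 0 else 1 : ℤ) * (scaled T q j)⁻¹ := by
  split_ifs with hij
  · rw [hij, scaled_edgeMap_self hT]; simp
  · obtain ⟨k, hik, hjk⟩ := exists_third i j
    have hj : scaled T q j ≠ 0 := (scaled_eq_zero hT).not.2 (ne_zero_of_v0 h j)
    rw [scaled_edgeMap_of_ne q (Ne.symm hij) hik hjk, ← scaled_mul T q (Ne.symm hij) hik hjk]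
    field_simp

theorem edgeMap_apply_ne_zero (hT : 0 < T) (hi : q i ≠ 0) : edgeMap T i q i ≠ 0 := by
  rw [Ne, ← scaled_eq_zero hT, scaled_edgeMap_self hT]
  simpa [scaled_eq_zero hT] using hi

theorem edgeMap_edgeMap (hT : 0 < T) (hi : q i ≠ 0) : edgeMap T i (edgeMap T i q) = q := by
  obtain ⟨j, k, hij, hik, hjk⟩ := exists_others i
  have h0 : scaled T q i ≠ 0 := (scaled_eq_zero hT).not.2 hi
  refine ext_of_scaled hT hij hik hjk ?_ ?_ ?_
  · rw [scaled_edgeMap_self hT, scaled_edgeMap_self hT, inv_inv]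
  · rw [scaled_edgeMap_of_ne _ hij hik hjk, scaled_edgeMap_self hT,
      scaled_edgeMap_of_ne _ hik hij hjk.symm]
    field_simp
  · rw [scaled_edgeMap_of_ne _ hik hij hjk.symm, scaled_edgeMap_self hT,
      scaled_edgeMap_of_ne _ hij hik hjk]
    field_simp

theorem contDiffAt_edgeMap {n : WithTop ℕ∞} (hT : 0 < T) (hi : q i ≠ 0) :
    ContDiffAt ℂ n (edgeMap T i) q := by
  have hT' : (T : ℂ) ≠ 0 := by exact_mod_cast hT.ne'
  have h0 : (T : ℂ) ^ 2 * q i ≠ 0 := mul_ne_zero (pow_ne_zero 2 hT') hi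
  rw [contDiffAt_pi]
  intro j
  by_cases hij : i = j
  · subst hij
    have : (fun x => edgeMap T i x i) = fun x : C3 => ((T : ℂ) ^ 2 * x i)⁻¹ :=
      funext fun x => Setup.edgeMap_self T i x
    rw [this]
    exact ContDiffAt.inv (by fun_prop) h0
  · obtain ⟨k, hik, hjk⟩ := exists_third i j
    have : (fun x => edgeMap T i x j) = fun x : C3 => T * x i * x k :=
      funext fun x => Setup.edgeMap_of_ne T hij hik hjk x
    rw [this]
    fun_prop

end Scaled

/-- The composition of the transition maps along a path of edges with the given directions. -/
def run (T : ℝ) : List (Fin 3) → C3 → C3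
  | [], q => q
  | i :: w, q => run T w (edgeMap T i q)

/-- The transition maps along the path are defined at `q`. -/
def Valid (T : ℝ) : List (Fin 3) → C3 → Prop
  | [], _ => True
  | i :: w, q => q i ≠ 0 ∧ Valid T w (edgeMap T i q)

/-- The sign `(-1) ^ n` of a path of length `n`. -/
def par : List (Fin 3) → ℤ
  | [] => 1
  | _ :: w => -par w

/-- The exponents of `T³ v₀` in the monomial map `run T w`. -/
def expo : List (Fin 3) → Fin 3 → ℤ
  | [], _ => 0
  | i :: w, j => expo w j + par w * (if j = i then 0 else 1)

section Run

variable {T : ℝ} {q q' : C3} {i j k : Fin 3} {w w' : List (Fin 3)}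

theorem par_eq (w : List (Fin 3)) : par w = 1 ∨ par w = -1 := by
  induction w with
  | nil => exact Or.inl rfl
  | cons i w ih => rcases ih with h | h <;> simp [par, h]

theorem par_append (w w' : List (Fin 3)) : par (w ++ w') = par w * par w' := by
  induction w with
  | nil => simp [par]
  | cons i w ih => simp [par, ih]

theorem run_append (w w' : List (Fin 3)) (q : C3) : run T (w ++ w') q = run T w' (run T w q) := by
  induction w generalizing q with
  | nil => rfl
  | cons i w ih => exact ih _

theorem valid_append : Valid T (w ++ w') q ↔ Valid T w q ∧ Valid T w' (run T w q) := by
  induction w generalizing q with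
  | nil => simp [Valid, run]
  | cons i w ih => simp [Valid, run, ih, and_assoc]

theorem v0_run (hT : 0 < T) (h : Valid T w q) : v0 (run T w q) = v0 q := by
  induction w generalizing q with
  | nil => rfl
  | cons i w ih => exact (ih h.2).trans (v0_edgeMap hT i q h.1)

theorem valid_of_v0_ne_zero (hT : 0 < T) (h : v0 q ≠ 0) : Valid T w q := by
  induction w generalizing q with
  | nil => trivial
  | cons i w ih =>
    have hi := ne_zero_of_v0 h i
    exact ⟨hi, ih (by rwa [v0_edgeMap hT i q hi])⟩

theorem par_reverse (w : List (Fin 3)) : par w.reverse = par w := by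
  induction w with
  | nil => rfl
  | cons i w ih => rw [List.reverse_cons, par_append, ih]; simp [par]

theorem reverse_spec (hT : 0 < T) (h : Valid T w q) :
    Valid T w.reverse (run T w q) ∧ run T w.reverse (run T w q) = q := by
  induction w generalizing q with
  | nil => exact ⟨trivial, rfl⟩
  | cons i w ih =>
    obtain ⟨h1, h2⟩ := ih h.2
    rw [List.reverse_cons, valid_append, run_append]
    change (_ ∧ Valid T [i] (run T w.reverse (run T w (edgeMap T i q)))) ∧
      run T [i] (run T w.reverse (run T w (edgeMap T i q))) = q
    rw [h2]
    exact ⟨⟨h1, edgeMap_apply_ne_zero hT h.1, trivial⟩, edgeMap_edgeMap hT h.1⟩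

theorem contDiffAt_run {n : WithTop ℕ∞} (hT : 0 < T) (h : Valid T w q) :
    ContDiffAt ℂ n (run T w) q := by
  induction w generalizing q with
  | nil => exact contDiffAt_id
  | cons i w ih => exact ContDiffAt.comp q (ih h.2) (contDiffAt_edgeMap hT h.1)

theorem continuousAt_run (hT : 0 < T) (h : Valid T w q) : ContinuousAt (run T w) q :=
  (contDiffAt_run (n := 0) hT h).continuousAt

theorem eventually_valid (hT : 0 < T) (h : Valid T w q) : ∀ᶠ x in 𝓝 q, Valid T w x := by
  induction w generalizing q with
  | nil => exact Eventually.of_forall fun _ => trivial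
  | cons i w ih =>
    have h1 : ∀ᶠ x : C3 in 𝓝 q, x i ≠ 0 := (continuous_apply i).continuousAt.eventually_ne h.1
    filter_upwards [h1, (contDiffAt_edgeMap (n := 0) hT h.1).continuousAt.eventually (ih h.2)]
      with x hx hx'
    exact ⟨hx, hx'⟩

theorem scaled_run (hT : 0 < T) (h : v0 q ≠ 0) (w : List (Fin 3)) (j : Fin 3) :
    scaled T (run T w q) j = scaledV0 T q ^ expo w j * scaled T q j ^ par w := by
  induction w generalizing q with
  | nil => simp [run, expo, par]
  | cons i w ih =>
    have hi := ne_zero_of_v0 h i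
    have hv := v0_edgeMap hT i q hi
    have hu : scaledV0 T q ≠ 0 := (scaledV0_eq_zero hT).not.2 h
    change scaled T (run T w (edgeMap T i q)) j = _
    rw [ih (by rwa [hv]), scaled_edgeMap hT h, show scaledV0 T (edgeMap T i q) = scaledV0 T q by
      rw [scaledV0, hv, scaledV0], mul_zpow, ← zpow_mul, inv_zpow', ← mul_assoc, ← zpow_add₀ hu]
    simp only [expo, par, mul_comm (par w)]

theorem run_eq_run (hT : 0 < T) (h : v0 q ≠ 0) (he : expo w = expo w') (hp : par w = par w') :
    run T w q = run T w' q := by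
  have : ∀ j, scaled T (run T w q) j = scaled T (run T w' q) j := fun j => by
    rw [scaled_run hT h, scaled_run hT h, he, hp]
  exact ext_of_scaled hT (i := 0) (j := 1) (k := 2) (by decide) (by decide) (by decide)
    (this 0) (this 1) (this 2)

/-- The constraint reflects that the product of the scaled coordinates is `u` before and after the
map. -/
theorem sum_expo (w : List (Fin 3)) : expo w 0 + expo w 1 + expo w 2 = 1 - par w := by
  induction w with
  | nil => simp [expo, par]
  | cons i w ih =>
    have : expo (i :: w) 0 + expo (i :: w) 1 + expo (i :: w) 2
        = expo w 0 + expo w 1 + expo w 2 + 2 * par w := by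
      fin_cases i <;> simp [expo] <;> ring
    rw [this, ih, par]; ring

/-- Prepending the two edges `i`, `j` to an even word adds `e_i - e_j` to its exponents. -/
theorem exists_word_add (w : List (Fin 3)) (hw : par w = 1) (i j : Fin 3) (m : ℕ) :
    ∃ w', par w' = 1 ∧ ∀ k, expo w' k
      = expo w k + m * ((if k = i then 1 else 0) - (if k = j then 1 else 0)) := by
  induction m with
  | zero => exact ⟨w, hw, by simp⟩
  | succ m ih =>
    obtain ⟨w', h1, h2⟩ := ih
    refine ⟨i :: j :: w', by simp [par, h1], fun k => ?_⟩
    simp only [expo, par, h2, h1]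
    push_cast
    split_ifs <;> ring

theorem exists_word_add' (w : List (Fin 3)) (hw : par w = 1) (i j : Fin 3) (m : ℤ) :
    ∃ w', par w' = 1 ∧ ∀ k, expo w' k
      = expo w k + m * ((if k = i then 1 else 0) - (if k = j then 1 else 0)) := by
  rcases le_total 0 m with h | h
  · lift m to ℕ using h
    exact exists_word_add w hw i j m
  · obtain ⟨m', rfl⟩ : ∃ m' : ℕ, m = -m' := ⟨m.natAbs, by omega⟩
    obtain ⟨w', h1, h2⟩ := exists_word_add w hw j i m'
    refine ⟨w', h1, fun k => ?_⟩
    rw [h2]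
    ring

/-- All exponents that satisfy the obvious constraint occur. -/
theorem exists_word {s : ℤ} (hs : s = 1 ∨ s = -1) (n : Fin 3 → ℤ)
    (hn : n 0 + n 1 + n 2 = 1 - s) : ∃ w, par w = s ∧ expo w = n := by
  have even : ∀ n : Fin 3 → ℤ, n 0 + n 1 + n 2 = 0 → ∃ w, par w = 1 ∧ expo w = n := by
    intro n hn
    obtain ⟨w₁, h1, h2⟩ := exists_word_add' [] rfl 0 2 (n 0)
    obtain ⟨w₂, h3, h4⟩ := exists_word_add' w₁ h1 1 2 (n 1)
    refine ⟨w₂, h3, funext fun k => ?_⟩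
    rw [h4, h2]
    fin_cases k <;> simp [expo]
    omega
  rcases hs with rfl | rfl
  · exact even n (by omega)
  · obtain ⟨w, h1, h2⟩ := even (fun k => n k - if k = 2 then 0 else 1) (by simp; omega)
    refine ⟨2 :: w, by simp [par, h1], funext fun k => ?_⟩
    simp [expo, h1, h2]

/-- Together with `odd_cases` this leaves four shapes, the exponents of the words `[]`, `[i, j]`,
`[k]` and `[i, k, j]`. -/
theorem even_cases {n : Fin 3 → ℤ} (hn : n 0 + n 1 + n 2 = 0) (h1 : ∀ i, -1 ≤ n i)
    (h2 : ∀ i, n i ≤ 1) : n = 0 ∨ ∃ i j k, i ≠ j ∧ i ≠ k ∧ j ≠ k ∧ n i = 1 ∧ n j = -1 ∧ n k = 0 := by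
  have a0 := h1 0; have a1 := h1 1; have a2 := h1 2
  have b0 := h2 0; have b1 := h2 1; have b2 := h2 2
  have c0 : n 0 = -1 ∨ n 0 = 0 ∨ n 0 = 1 := by omega
  have c1 : n 1 = -1 ∨ n 1 = 0 ∨ n 1 = 1 := by omega
  rcases c0 with c0 | c0 | c0 <;> rcases c1 with c1 | c1 | c1
  · omega
  · exact Or.inr ⟨2, 0, 1, by decide, by decide, by decide, by omega, c0, c1⟩
  · exact Or.inr ⟨1, 0, 2, by decide, by decide, by decide, c1, c0, by omega⟩
  · exact Or.inr ⟨2, 1, 0, by decide, by decide, by decide, by omega, c1, c0⟩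
  · refine Or.inl (funext fun i => ?_)
    fin_cases i
    · exact c0
    · exact c1
    · change n 2 = 0; omega
  · exact Or.inr ⟨1, 2, 0, by decide, by decide, by decide, c1, by omega, c0⟩
  · exact Or.inr ⟨0, 1, 2, by decide, by decide, by decide, c0, c1, by omega⟩
  · exact Or.inr ⟨0, 2, 1, by decide, by decide, by decide, c0, by omega, c1⟩
  · omega

theorem odd_cases {n : Fin 3 → ℤ} (hn : n 0 + n 1 + n 2 = 2) (h1 : ∀ i, 0 ≤ n i) :
    ∃ i j k, i ≠ j ∧ i ≠ k ∧ j ≠ k ∧ n j = n i ∧ (n i = 1 ∧ n k = 0 ∨ n i = 0 ∧ n k = 2) := by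
  have a0 := h1 0; have a1 := h1 1; have a2 := h1 2
  have : (n 0 = n 1 ∨ n 0 = n 2 ∨ n 1 = n 2) := by omega
  rcases this with h | h | h
  · exact ⟨0, 1, 2, by decide, by decide, by decide, by omega, by omega⟩
  · exact ⟨0, 2, 1, by decide, by decide, by decide, by omega, by omega⟩
  · exact ⟨1, 2, 0, by decide, by decide, by decide, by omega, by omega⟩

theorem exists_sorted (f : Fin 3 → ℝ) : ∃ a b c, a ≠ b ∧ a ≠ c ∧ b ≠ c ∧ f b ≤ f a ∧ f c ≤ f b := by
  rcases le_total (f 0) (f 1) with h1 | h1 <;> rcases le_total (f 1) (f 2) with h2 | h2 <;>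
    rcases le_total (f 0) (f 2) with h3 | h3
  · exact ⟨2, 1, 0, by decide, by decide, by decide, h2, h1⟩
  · exact ⟨2, 1, 0, by decide, by decide, by decide, h2, h1⟩
  · exact ⟨1, 2, 0, by decide, by decide, by decide, h2, h3⟩
  · exact ⟨1, 0, 2, by decide, by decide, by decide, h1, h3⟩
  · exact ⟨2, 0, 1, by decide, by decide, by decide, h3, h1⟩
  · exact ⟨0, 2, 1, by decide, by decide, by decide, h3, h2⟩
  · exact ⟨0, 1, 2, by decide, by decide, by decide, h1, h2⟩
  · exact ⟨0, 1, 2, by decide, by decide, by decide, h1, h2⟩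

/-- Every point over `|v₀| < T ^ l` is equivalent to one of the closed polydisc. -/
theorem exists_run_mem_polydisc (hT : 0 < T) (hu : ‖scaledV0 T q‖ < 1) :
    ∃ w, Valid T w q ∧ ∀ i, ‖scaled T (run T w q) i‖ ≤ 1 := by
  -- For `v₀ = 0` the smallest coordinate vanishes, and at most three edges suffice, each along a
  -- coordinate of modulus greater than `1`. For `v₀ ≠ 0` powers of `u` bring the coordinates `0`
  -- and `1` into `(|u|, 1]`; if the last one then exceeds `1`, one edge in direction `2` finishes.
  rcases eq_or_ne (v0 q) 0 with h0 | h0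
  · obtain ⟨a, b, c, hab, hac, hbc, hba, hcb⟩ := exists_sorted (fun i => ‖scaled T q i‖)
    set X := scaled T q with hX
    have hc : X c = 0 := by
      have h := scaled_mul T q hab hac hbc
      rw [(scaledV0_eq_zero hT).2 h0, mul_eq_zero, mul_eq_zero] at h
      have : ∀ i, X c ≠ 0 → ‖X c‖ ≤ ‖X i‖ → X i ≠ 0 := fun i h1 h2 h3 => by
        rw [h3, norm_zero] at h2
        exact h1 (norm_le_zero_iff.1 h2)
      by_contra hn
      rcases h with (h | h) | h
      · exact this a hn (hcb.trans hba) h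
      · exact this b hn hcb h
      · exact hn h
    rcases le_or_gt ‖X a‖ 1 with ha | ha
    · exact ⟨[], trivial, forall_of_ne hab hac hbc ha (hba.trans ha) (hcb.trans (hba.trans ha))⟩
    have ha0 : X a ≠ 0 := norm_pos_iff.1 (by linarith)
    have hqa : q a ≠ 0 := (scaled_eq_zero hT).not.1 ha0
    have ea := scaled_edgeMap_self hT a q
    have eb := scaled_edgeMap_of_ne (T := T) q hab hac hbc
    have ec := scaled_edgeMap_of_ne (T := T) q hac hab hbc.symm
    set q₁ := edgeMap T a q
    rw [← hX] at ea eb ec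
    rw [hc, mul_zero] at eb
    have ha' : ‖(X a)⁻¹‖ ≤ 1 := by rw [norm_inv]; exact inv_le_one_of_one_le₀ ha.le
    rcases le_or_gt ‖X a * X b‖ 1 with hab1 | hab1
    · exact ⟨[a], ⟨hqa, trivial⟩, forall_of_ne hab hac hbc (by rw [run, run, ea]; exact ha')
        (by rw [run, run, eb]; simp) (by rw [run, run, ec]; exact hab1)⟩
    have hab0 : X a * X b ≠ 0 := norm_pos_iff.1 (by linarith)
    have hb0 : X b ≠ 0 := right_ne_zero_of_mul hab0
    have hqc : q₁ c ≠ 0 := (scaled_eq_zero hT).not.1 (by rw [ec]; exact hab0)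
    have fc := scaled_edgeMap_self hT c q₁
    have fa := scaled_edgeMap_of_ne (T := T) q₁ hac.symm hbc.symm hab
    have fb := scaled_edgeMap_of_ne (T := T) q₁ hbc.symm hac.symm hab.symm
    set q₂ := edgeMap T c q₁
    rw [ec] at fc
    rw [ec, eb, mul_zero] at fa
    rw [ec, ea, mul_right_comm, mul_inv_cancel₀ ha0, one_mul] at fb
    have hab' : ‖(X a * X b)⁻¹‖ ≤ 1 := by rw [norm_inv]; exact inv_le_one_of_one_le₀ hab1.le
    rcases le_or_gt ‖X b‖ 1 with hb1 | hb1
    · exact ⟨[a, c], ⟨hqa, hqc, trivial⟩, forall_of_ne hab hac hbc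
        (by rw [run, run, run, fa]; simp) (by rw [run, run, run, fb]; exact hb1)
        (by rw [run, run, run, fc]; exact hab')⟩
    have hqb : q₂ b ≠ 0 := (scaled_eq_zero hT).not.1 (by rw [fb]; exact hb0)
    have gb := scaled_edgeMap_self hT b q₂
    have ga := scaled_edgeMap_of_ne (T := T) q₂ hab.symm hbc hac
    have gc := scaled_edgeMap_of_ne (T := T) q₂ hbc hab.symm hac.symm
    rw [fb] at gb
    rw [fb, fc, mul_inv, mul_left_comm, mul_inv_cancel₀ hb0, mul_one] at ga
    rw [fa, mul_zero] at gc
    refine ⟨[a, c, b], ⟨hqa, hqc, hqb, trivial⟩, forall_of_ne hab hac hbc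
        (by rw [run, run, run, run, ga]; exact ha') (by rw [run, run, run, run, gb, norm_inv];
                                                        exact inv_le_one_of_one_le₀ hb1.le)
        (by rw [run, run, run, run, gc]; simp)⟩
  · have hu0 : 0 < ‖scaledV0 T q‖ := norm_pos_iff.2 ((scaledV0_eq_zero hT).not.2 h0)
    have hX0 : ∀ i, 0 < ‖scaled T q i‖ := fun i =>
      norm_pos_iff.2 ((scaled_eq_zero hT).not.2 (ne_zero_of_v0 h0 i))
    have norm : ∀ i, ∃ n : ℤ, ‖scaledV0 T q‖ < ‖scaledV0 T q‖ ^ n * ‖scaled T q i‖ ∧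
        ‖scaledV0 T q‖ ^ n * ‖scaled T q i‖ ≤ 1 := by
      intro i
      obtain ⟨n, h1, h2⟩ := exists_mem_Ioc_zpow (hX0 i) ((one_lt_inv₀ hu0).2 hu)
      refine ⟨n + 1, ?_, ?_⟩
      · rw [inv_zpow, inv_lt_iff_one_lt_mul₀ (zpow_pos hu0 n)] at h1
        rw [zpow_add_one₀ hu0.ne', mul_right_comm]
        exact lt_mul_of_one_lt_left hu0 (by rwa [mul_comm])
      · rw [inv_zpow, ← one_div, le_div_iff₀ (zpow_pos hu0 _)] at h2
        rwa [mul_comm]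
    obtain ⟨n₀, l0, u0⟩ := norm 0
    obtain ⟨n₁, l1, u1⟩ := norm 1
    obtain ⟨w, hw, he⟩ := exists_word (s := 1) (Or.inl rfl) ![n₀, n₁, -n₀ - n₁] (by simp)
    have hr := fun j => congrArg (‖·‖) (scaled_run hT h0 w j)
    simp only [he, hw, zpow_one, norm_mul, norm_zpow] at hr
    have hv := v0_run hT (valid_of_v0_ne_zero (w := w) hT h0)
    have r0 := hr 0
    have r1 := hr 1
    simp only [Matrix.cons_val_zero, Matrix.cons_val_one] at r0 r1
    rw [← r0] at l0 u0
    rw [← r1] at l1 u1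
    rcases le_or_gt ‖scaled T (run T w q) 2‖ 1 with h2 | h2
    · exact ⟨w, valid_of_v0_ne_zero hT h0, fun i => by fin_cases i <;> assumption⟩
    · have hv0 : v0 (run T w q) ≠ 0 := by rwa [hv]
      have hu' : scaledV0 T (run T w q) = scaledV0 T q := by rw [scaledV0, scaledV0, hv]
      refine ⟨w ++ [2], valid_of_v0_ne_zero hT h0, fun i => ?_⟩
      rw [run_append]
      change ‖scaled T (edgeMap T 2 (run T w q)) i‖ ≤ 1
      rw [scaled_edgeMap hT hv0, hu', norm_mul, norm_inv, norm_zpow, ← div_eq_mul_inv]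
      fin_cases i
      · simpa using (div_le_one (hu0.trans l0)).2 l0.le
      · simpa using (div_le_one (hu0.trans l1)).2 l1.le
      · simpa using inv_le_one_of_one_le₀ h2.le

end Run

end BananaMirror
end

noncomputable section

namespace BananaMirror

open scoped ContDiff Topology ComplexConjugate
open Filter

/-! ### The topology of `Y` -/

/-- The relation `X' = u ^ m * X ^ s` for `s = ± 1` and `u = X * Z`, written without negative
powers. -/
def MonoRel (s m : ℤ) (u X X' Z : ℂ) : Prop :=
  if s = 1 then
    if 0 ≤ m then X' = u ^ m.toNat * X else X' * u ^ (-m - 1).toNat * Z = 1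
  else
    if 1 ≤ m then X' = u ^ (m - 1).toNat * Z else X * X' * u ^ (-m).toNat = 1

/-- Negative powers of `u = X Z` are traded for `X` and `Z`. Nothing changes for `u ≠ 0`, but
`MonoRel` remains a closed condition across `u = 0`. -/
theorem monoRel_iff {s m : ℤ} (hs : s = 1 ∨ s = -1) {u X X' Z : ℂ} (hu : u ≠ 0) (h : X * Z = u) :
    MonoRel s m u X X' Z ↔ X' = u ^ m * X ^ s := by
  have hX : X ≠ 0 := by rintro rfl; simp at h; exact hu h.symm
  have hZ : Z ≠ 0 := by rintro rfl; simp at h; exact hu h.symm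
  unfold MonoRel
  rcases hs with rfl | rfl
  · rw [if_pos rfl, zpow_one]
    split_ifs with hm
    · lift m to ℕ using hm
      simp
    · obtain ⟨k, rfl⟩ : ∃ k : ℕ, m = -(k + 1) := ⟨(-m - 1).toNat, by omega⟩
      rw [show (-(-((k : ℤ) + 1)) - 1).toNat = k by omega, zpow_neg,
        show ((k : ℤ) + 1) = ((k + 1 : ℕ) : ℤ) by push_cast; ring, zpow_natCast]
      have hk : u ^ k ≠ 0 := pow_ne_zero k hu
      rw [inv_mul_eq_div, eq_div_iff (pow_ne_zero _ hu), pow_succ, ← h]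
      rw [h]
      constructor
      · intro e
        linear_combination X * e - X' * u ^ k * h
      · intro e
        apply mul_left_cancel₀ hX
        linear_combination e + X' * u ^ k * h
  · rw [if_neg (by norm_num), zpow_neg_one]
    split_ifs with hm
    · obtain ⟨k, rfl⟩ : ∃ k : ℕ, m = k + 1 := ⟨(m - 1).toNat, by omega⟩
      rw [show ((k : ℤ) + 1 - 1).toNat = k by omega, zpow_add_one₀ hu, zpow_natCast]
      have : u ^ k * u * X⁻¹ = u ^ k * Z := by rw [← h]; field_simp
      rw [this]
    · obtain ⟨k, rfl⟩ : ∃ k : ℕ, m = -k := ⟨(-m).toNat, by omega⟩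
      rw [neg_neg, Int.toNat_natCast, zpow_neg, zpow_natCast, ← mul_inv]
      constructor
      · intro e
        exact eq_inv_of_mul_eq_one_left (by linear_combination e)
      · rintro rfl
        have := pow_ne_zero k hu
        field_simp

/-- For very negative `m` the relation would equate `1` with a bounded quantity times a high power
of `u`. -/
theorem MonoRel.lower_bound {s m : ℤ} {u X X' Z : ℂ} {M δ : ℝ} {N : ℕ}
    (h : MonoRel s m u X X' Z) (hM : 1 ≤ M) (hX : ‖X‖ ≤ M) (hX' : ‖X'‖ ≤ M) (hZ : ‖Z‖ ≤ M ^ 2)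
    (hu : ‖u‖ ≤ δ) (hδ : δ < 1) (hN : M ^ 3 * δ ^ N < 1) : -(N : ℤ) ≤ m := by
  have hδ0 : 0 ≤ δ := (norm_nonneg u).trans hu
  by_contra! hn
  have hpow : ∀ k : ℕ, N ≤ k → ‖u‖ ^ k ≤ δ ^ N := fun k hk =>
    (pow_le_pow_left₀ (norm_nonneg u) hu k).trans (pow_le_pow_of_le_one hδ0 hδ.le hk)
  unfold MonoRel at h
  split_ifs at h with h1 h2 h2
  · omega
  · have e := congrArg (‖·‖) h
    simp only [norm_mul, norm_pow, norm_one] at e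
    have : ‖X'‖ * ‖u‖ ^ (-m - 1).toNat * ‖Z‖ ≤ M * δ ^ N * M ^ 2 := by
      gcongr
      exact hpow _ (by omega)
    nlinarith
  · omega
  · have e := congrArg (‖·‖) h
    simp only [norm_mul, norm_pow, norm_one] at e
    have : ‖X‖ * ‖X'‖ * ‖u‖ ^ (-m).toNat ≤ M * M * δ ^ N := by
      gcongr
      exact hpow _ (by omega)
    have : M * M * δ ^ N ≤ M ^ 3 * δ ^ N := by
      gcongr
      nlinarith [mul_nonneg (mul_nonneg (show 0 ≤ M by linarith) (show 0 ≤ M by linarith))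
        (show 0 ≤ M - 1 by linarith)]
    linarith

@[fun_prop]
theorem continuous_scaled (T : ℝ) (i : Fin 3) : Continuous (fun q => scaled T q i) := by
  unfold scaled; fun_prop

@[fun_prop]
theorem continuous_scaledV0 (T : ℝ) : Continuous (scaledV0 T) :=
  continuous_const.mul continuous_v0

/-- The closure of the graph of a monomial map `q ↦ q'` of the form `x'_i = u ^ n_i * x_i ^ s` in
coordinates multiplied with `T`, restricted to `|u| ≤ δ`; here `u = T³ v₀`. -/
def monoGraph (T δ : ℝ) (s : ℤ) (n : Fin 3 → ℤ) : Set (C3 × C3) :=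
  {x | n 0 + n 1 + n 2 = 1 - s ∧ ‖scaledV0 T x.1‖ ≤ δ ∧ ∀ i j k, i ≠ j → i ≠ k → j ≠ k →
    MonoRel s (n i) (scaledV0 T x.1) (scaled T x.1 i) (scaled T x.2 i)
      (scaled T x.1 j * scaled T x.1 k)}

section Graph

variable {T δ l : ℝ} {q q' : C3} {s : ℤ} {n : Fin 3 → ℤ} {w : List (Fin 3)}

theorem isClosed_monoGraph (T δ : ℝ) (s : ℤ) (n : Fin 3 → ℤ) : IsClosed (monoGraph T δ s n) := by
  have hu : Continuous fun x : C3 × C3 => scaledV0 T x.1 := by fun_prop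
  have h1 : ∀ i, Continuous fun x : C3 × C3 => scaled T x.1 i := fun i =>
    (continuous_scaled T i).comp continuous_fst
  have h2 : ∀ i, Continuous fun x : C3 × C3 => scaled T x.2 i := fun i =>
    (continuous_scaled T i).comp continuous_snd
  have key : monoGraph T δ s n = {_x | n 0 + n 1 + n 2 = 1 - s} ∩
      ({x | ‖scaledV0 T x.1‖ ≤ δ} ∩ ⋂ i, ⋂ j, ⋂ k, ⋂ _ : i ≠ j, ⋂ _ : i ≠ k, ⋂ _ : j ≠ k,
        {x | MonoRel s (n i) (scaledV0 T x.1) (scaled T x.1 i) (scaled T x.2 i)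
          (scaled T x.1 j * scaled T x.1 k)}) := by
    ext x
    simp [monoGraph]
  rw [key]
  refine isClosed_const.inter ((isClosed_le hu.norm continuous_const).inter ?_)
  refine isClosed_iInter fun i => isClosed_iInter fun j => isClosed_iInter fun k =>
    isClosed_iInter fun _ => isClosed_iInter fun _ => isClosed_iInter fun _ => ?_
  unfold MonoRel
  split_ifs
  · exact isClosed_eq (h2 i) ((hu.pow _).mul (h1 i))
  · exact isClosed_eq (((h2 i).mul (hu.pow _)).mul ((h1 j).mul (h1 k))) continuous_const
  · exact isClosed_eq (h2 i) ((hu.pow _).mul ((h1 j).mul (h1 k)))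
  · exact isClosed_eq (((h1 i).mul (h2 i)).mul (hu.pow _)) continuous_const

/-- On bounded sets the exponents are bounded below; as their sum is fixed, they are bounded above
too. -/
theorem locallyFinite_monoGraph (T : ℝ) (hδ0 : 0 ≤ δ) (hδ : δ < 1) (s : ℤ) :
    LocallyFinite (monoGraph T δ s) := by
  rintro ⟨q, q'⟩
  set M : ℝ := 1 + ∑ i, (‖scaled T q i‖ + ‖scaled T q' i‖) with hMdef
  have hle : ∀ i, ‖scaled T q i‖ < M ∧ ‖scaled T q' i‖ < M := fun i => by
    have := Finset.single_le_sum (f := fun i => ‖scaled T q i‖ + ‖scaled T q' i‖)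
      (fun i _ => by positivity) (Finset.mem_univ i)
    constructor <;> linarith [norm_nonneg (scaled T q i), norm_nonneg (scaled T q' i)]
  have hM : 1 ≤ M := by
    have : 0 ≤ ∑ i, (‖scaled T q i‖ + ‖scaled T q' i‖) := by positivity
    linarith
  obtain ⟨N, hN⟩ : ∃ N : ℕ, M ^ 3 * δ ^ N < 1 := by
    have := (tendsto_pow_atTop_nhds_zero_of_lt_one hδ0 hδ).const_mul (M ^ 3)
    rw [mul_zero] at this
    exact (this.eventually_lt_const one_pos).exists
  refine ⟨{x | ∀ i, ‖scaled T x.1 i‖ < M ∧ ‖scaled T x.2 i‖ < M}, ?_, ?_⟩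
  · have hc : ∀ i, ∀ᶠ x : C3 × C3 in 𝓝 (q, q'), ‖scaled T x.1 i‖ < M ∧ ‖scaled T x.2 i‖ < M :=
      fun i => by
        have h1 : Continuous fun x : C3 × C3 => ‖scaled T x.1 i‖ :=
          ((continuous_scaled T i).comp continuous_fst).norm
        have h2 : Continuous fun x : C3 × C3 => ‖scaled T x.2 i‖ :=
          ((continuous_scaled T i).comp continuous_snd).norm
        exact (h1.continuousAt.eventually (gt_mem_nhds (hle i).1)).and
          (h2.continuousAt.eventually (gt_mem_nhds (hle i).2))
    exact eventually_all.2 hc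
  · refine (Set.finite_Icc (fun _ : Fin 3 => -(N : ℤ)) (fun _ => 1 - s + 2 * N)).subset ?_
    rintro n ⟨x, ⟨h1, h2, h3⟩, h4⟩
    have lb : ∀ i, -(N : ℤ) ≤ n i := fun i => by
      obtain ⟨j, k, hij, hik, hjk⟩ := exists_others i
      refine (h3 i j k hij hik hjk).lower_bound hM (h4 i).1.le (h4 i).2.le ?_ h2 hδ hN
      rw [norm_mul, sq]
      exact mul_le_mul (h4 j).1.le (h4 k).1.le (norm_nonneg _) (by linarith)
    have l0 := lb 0
    have l1 := lb 1
    have l2 := lb 2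
    refine ⟨lb, fun i => ?_⟩
    fin_cases i
    · change n 0 ≤ 1 - s + 2 * N; omega
    · change n 1 ≤ 1 - s + 2 * N; omega
    · change n 2 ≤ 1 - s + 2 * N; omega

theorem dense_v0_ne_zero : Dense {q : C3 | v0 q ≠ 0} := by
  have h : Dense (Set.pi Set.univ fun _ : Fin 3 => ({0}ᶜ : Set ℂ)) :=
    dense_pi _ fun _ _ => dense_compl_singleton 0
  refine h.mono fun q hq => ?_
  have : ∀ i, q i ≠ 0 := fun i => hq i trivial
  simp [v0, this]

/-- For `v₀ ≠ 0` this is `scaled_run`; the rest follows by density and closedness. -/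
theorem mem_monoGraph_run (hT : 0 < T) (hu : ‖scaledV0 T q‖ < δ) (h : Valid T w q) :
    (q, run T w q) ∈ monoGraph T δ (par w) (expo w) := by
  have hne : ∀ x, v0 x ≠ 0 → ‖scaledV0 T x‖ < δ →
      (x, run T w x) ∈ monoGraph T δ (par w) (expo w) := fun x hx hx' => by
    refine ⟨sum_expo w, hx'.le, fun i j k hij hik hjk => ?_⟩
    exact (monoRel_iff (par_eq w) ((scaledV0_eq_zero hT).not.2 hx)
      (by rw [← mul_assoc, scaled_mul T x hij hik hjk])).2 (scaled_run hT hx w i)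
  have hfr : ∃ᶠ x in 𝓝 q, (x, run T w x) ∈ monoGraph T δ (par w) (expo w) := by
    have h1 : ∃ᶠ x in 𝓝 q, v0 x ≠ 0 := mem_closure_iff_frequently.1 (dense_v0_ne_zero q)
    refine (h1.and_eventually ((continuous_scaledV0 T).norm.continuousAt.eventually_lt_const
      hu)).mono fun x hx => hne x hx.1 hx.2
  exact (isClosed_monoGraph T δ _ _).mem_of_frequently_of_tendsto hfr
    (continuousAt_id.prodMk (continuousAt_run hT h))

theorem exists_others' {i j : Fin 3} (hij : i ≠ j) : ∃ k, i ≠ k ∧ j ≠ k := by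
  revert i j; decide

/-- At `u = 0` an equation with right side `1` admits no positive power of `u`, so `n i ≥ -1`. If `n
i = -1`, the two other coordinates are nonzero, and since some coordinate vanishes this happens for
at most one index. -/
theorem even_of_mem_monoGraph (hu : scaledV0 T q = 0) (h : (q, q') ∈ monoGraph T δ 1 n) :
    n = 0 ∨ ∃ i j k, i ≠ j ∧ i ≠ k ∧ j ≠ k ∧ n i = 1 ∧ n j = -1 ∧ n k = 0 := by
  obtain ⟨hn, -, h⟩ := h
  simp only [MonoRel, if_true, hu] at h
  have h1 : ∀ i, -1 ≤ n i := fun i => by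
    by_contra! hi
    obtain ⟨j, k, hij, hik, hjk⟩ := exists_others i
    have := h i j k hij hik hjk
    rw [if_neg (by omega), zero_pow (by omega)] at this
    simp at this
  have h1' : ∀ i j k, i ≠ j → i ≠ k → j ≠ k → n i = -1 →
      scaled T q j ≠ 0 ∧ scaled T q k ≠ 0 := fun i j k hij hik hjk hi => by
    have := h i j k hij hik hjk
    rw [if_neg (by omega)] at this
    constructor <;> intro h0 <;> simp [h0] at this
  have h2 : ∀ i j, i ≠ j → n i = -1 → n j = -1 → False := fun i j hij hi hj => by
    obtain ⟨k, hik, hjk⟩ := exists_others' hij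
    obtain ⟨a, b⟩ := h1' i j k hij hik hjk hi
    obtain ⟨c, -⟩ := h1' j i k hij.symm hjk hik hj
    rw [← scaled_mul T q hij hik hjk] at hu
    simp [a, b, c] at hu
  have a0 := h1 0; have a1 := h1 1; have a2 := h1 2
  have b0 := h2 0 1 (by decide); have b1 := h2 0 2 (by decide); have b2 := h2 1 2 (by decide)
  refine even_cases (by omega) h1 fun i => ?_
  fin_cases i
  · change n 0 ≤ 1
    by_contra! hi
    exact b2 (by omega) (by omega)
  · change n 1 ≤ 1
    by_contra! hi
    exact b1 (by omega) (by omega)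
  · change n 2 ≤ 1
    by_contra! hi
    exact b0 (by omega) (by omega)

theorem eq_of_mem_monoGraph_zero (hT : 0 < T) (h : (q, q') ∈ monoGraph T δ 1 0) : q = q' := by
  have : ∀ i, scaled T q i = scaled T q' i := fun i => by
    obtain ⟨j, k, hij, hik, hjk⟩ := exists_others i
    have := h.2.2 i j k hij hik hjk
    simp [MonoRel] at this
    exact this.symm
  exact ext_of_scaled hT (i := 0) (j := 1) (k := 2) (by decide) (by decide) (by decide)
    (this 0) (this 1) (this 2)

/-- A fixed point forces `u ^ n_i = 1`, excluded by `|u| < 1` unless `n = 0`; over `u = 0`, an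
exponent `-1` would give `u = 1`. This is the source of local injectivity of the projection. -/
theorem eq_zero_of_mem_monoGraph_self (hT : 0 < T) (hδ : δ < 1)
    (h : (q, q) ∈ monoGraph T δ 1 n) : n = 0 := by
  rcases eq_or_ne (scaledV0 T q) 0 with hu | hu
  · refine (even_of_mem_monoGraph hu h).resolve_right ?_
    rintro ⟨i, j, k, hij, hik, hjk, hi, hj, hk⟩
    have e := h.2.2 j i k hij.symm hjk hik
    simp only [MonoRel, if_true, hj] at e
    rw [if_neg (by norm_num)] at e
    have e' : scaledV0 T q = 1 := by
      rw [← scaled_mul T q hij.symm hjk hik]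
      simpa [mul_assoc] using e
    rw [hu] at e'
    exact zero_ne_one e'
  · have hv : v0 q ≠ 0 := (scaledV0_eq_zero hT).not.1 hu
    funext i
    obtain ⟨j, k, hij, hik, hjk⟩ := exists_others i
    have e := (monoRel_iff (Or.inl rfl) hu (by rw [← mul_assoc, scaled_mul T q hij hik hjk])).1
      (h.2.2 i j k hij hik hjk)
    rw [zpow_one, eq_comm, mul_eq_right₀ ((scaled_eq_zero hT).not.2 (ne_zero_of_v0 hv i))] at e
    have e' := congrArg (‖·‖) e
    simp only [norm_zpow, norm_one] at e'
    have h0 := norm_pos_iff.2 hu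
    exact (zpow_eq_one_iff_right₀ h0.le (by linarith [h.2.1])).1 e'

/-- Passing to closed relations adds no identifications: at `u = 0` they determine which coordinates
are nonzero, and one of the four short words is defined there and realises the pair. -/
theorem exists_word_of_mem_monoGraph (hT : 0 < T) (hs : s = 1 ∨ s = -1)
    (h : (q, q') ∈ monoGraph T δ s n) : ∃ w, Valid T w q ∧ par w = s ∧ run T w q = q' := by
  rcases eq_or_ne (scaledV0 T q) 0 with hu | hu
  · rcases hs with rfl | rfl
    · rcases even_of_mem_monoGraph hu h with rfl | ⟨i, j, k, hij, hik, hjk, hi, hj, hk⟩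
      · exact ⟨[], trivial, rfl, eq_of_mem_monoGraph_zero hT h⟩
      · have ei := h.2.2 i j k hij hik hjk
        have ej := h.2.2 j i k hij.symm hjk hik
        have ek := h.2.2 k i j hik.symm hjk.symm hij
        simp only [MonoRel, if_true, hi, hj, hk, hu] at ei ej ek
        norm_num at ei ej ek
        have hi0 : scaled T q i ≠ 0 := by rintro h0; simp [h0] at ej
        have hk0 : scaled T q k ≠ 0 := by rintro h0; simp [h0] at ej
        have hj0 : scaled T q j = 0 := by
          rw [← scaled_mul T q hij hik hjk] at hu
          simpa [hi0, hk0] using hu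
        have fi := scaled_edgeMap_self hT i q
        have fj := scaled_edgeMap_of_ne (T := T) q hij hik hjk
        have fk := scaled_edgeMap_of_ne (T := T) q hik hij hjk.symm
        have hj1 : edgeMap T i q j ≠ 0 := by
          rw [Ne, ← scaled_eq_zero hT, fj]
          exact mul_ne_zero hi0 hk0
        refine ⟨[i, j], ⟨(scaled_eq_zero hT).not.1 hi0, hj1, trivial⟩, rfl, ?_⟩
        change edgeMap T j (edgeMap T i q) = q'
        refine ext_of_scaled hT hij hik hjk ?_ ?_ ?_
        · rw [scaled_edgeMap_of_ne _ hij.symm hjk hik, fj, fk, ei, hj0]; ring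
        · rw [scaled_edgeMap_self hT, fj]
          exact (eq_inv_of_mul_eq_one_left ej).symm
        · rw [scaled_edgeMap_of_ne _ hjk hij.symm hik.symm, fj, fi, ek]; field_simp
    · obtain ⟨hn, -, h⟩ := h
      simp only [MonoRel, show ¬ ((-1 : ℤ) = 1) by norm_num, if_false, hu] at h
      have h1 : ∀ i, 0 ≤ n i := fun i => by
        by_contra! hi
        obtain ⟨j, k, hij, hik, hjk⟩ := exists_others i
        have := h i j k hij hik hjk
        rw [if_neg (by omega), zero_pow (by omega)] at this
        simp at this
      obtain ⟨i, j, k, hij, hik, hjk, hji, hc⟩ := odd_cases (by omega) h1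
      have ei := h i j k hij hik hjk
      have ej := h j i k hij.symm hjk hik
      have ek := h k i j hik.symm hjk.symm hij
      rw [hji] at ej
      rcases hc with ⟨hi, hk⟩ | ⟨hi, hk⟩
      · simp only [hi, hk] at ei ej ek
        norm_num at ei ej ek
        have hk0 : scaled T q k ≠ 0 := left_ne_zero_of_mul_eq_one ek
        refine ⟨[k], ⟨(scaled_eq_zero hT).not.1 hk0, trivial⟩, rfl, ?_⟩
        change edgeMap T k q = q'
        refine ext_of_scaled hT hij hik hjk ?_ ?_ ?_
        · rw [scaled_edgeMap_of_ne _ hik.symm hjk.symm hij, ei]; ring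
        · rw [scaled_edgeMap_of_ne _ hjk.symm hik.symm hij.symm, ej]; ring
        · rw [scaled_edgeMap_self hT]
          exact (eq_inv_of_mul_eq_one_right ek).symm
      · simp only [hi, hk] at ei ej ek
        norm_num at ei ej ek
        have hi0 : scaled T q i ≠ 0 := left_ne_zero_of_mul_eq_one ei
        have hj0 : scaled T q j ≠ 0 := left_ne_zero_of_mul_eq_one ej
        have hk0 : scaled T q k = 0 := by
          rw [← scaled_mul T q hij hik hjk] at hu
          simpa [hi0, hj0] using hu
        have fi := scaled_edgeMap_self hT i q
        have fj := scaled_edgeMap_of_ne (T := T) q hij hik hjk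
        have fk := scaled_edgeMap_of_ne (T := T) q hik hij hjk.symm
        rw [hk0, mul_zero] at fj
        have hk1 : edgeMap T i q k ≠ 0 := by
          rw [Ne, ← scaled_eq_zero hT, fk]
          exact mul_ne_zero hi0 hj0
        have gk := scaled_edgeMap_self hT k (edgeMap T i q)
        have gi := scaled_edgeMap_of_ne (T := T) (edgeMap T i q) hik.symm hjk.symm hij
        have gj := scaled_edgeMap_of_ne (T := T) (edgeMap T i q) hjk.symm hik.symm hij.symm
        rw [fk] at gk
        rw [fj, mul_zero] at gi
        rw [fk, fi, mul_right_comm, mul_inv_cancel₀ hi0, one_mul] at gj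
        have hj2 : edgeMap T k (edgeMap T i q) j ≠ 0 := by
          rwa [Ne, ← scaled_eq_zero hT, gj]
        refine ⟨[i, k, j], ⟨(scaled_eq_zero hT).not.1 hi0, hk1, hj2, trivial⟩, rfl, ?_⟩
        change edgeMap T j (edgeMap T k (edgeMap T i q)) = q'
        refine ext_of_scaled hT hij hik hjk ?_ ?_ ?_
        · rw [scaled_edgeMap_of_ne _ hij.symm hjk hik, gj, gk,
            eq_inv_of_mul_eq_one_right ei]; field_simp
        · rw [scaled_edgeMap_self hT, gj]
          exact (eq_inv_of_mul_eq_one_right ej).symm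
        · rw [scaled_edgeMap_of_ne _ hjk hij.symm hik.symm, gi, mul_zero, ek]
  · have hv : v0 q ≠ 0 := (scaledV0_eq_zero hT).not.1 hu
    obtain ⟨w, hw, he⟩ := exists_word hs n h.1
    refine ⟨w, valid_of_v0_ne_zero hT hv, hw, ?_⟩
    have : ∀ i, scaled T (run T w q) i = scaled T q' i := fun i => by
      obtain ⟨j, k, hij, hik, hjk⟩ := exists_others i
      rw [scaled_run hT hv, he, hw]
      exact ((monoRel_iff hs hu (by rw [← mul_assoc, scaled_mul T q hij hik hjk])).1
        (h.2.2 i j k hij hik hjk)).symm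
    exact ext_of_scaled hT (i := 0) (j := 1) (k := 2) (by decide) (by decide) (by decide)
      (this 0) (this 1) (this 2)

end Graph

end BananaMirror
end

/-! ### The gluing relation and the quotient topology -/

noncomputable section

namespace BananaMirror

open scoped ContDiff Topology ComplexConjugate
open Filter

section Quotient

variable {T l : ℝ}

theorem norm_scaledV0_lt (hT : 0 < T) {q : C3} (hq : q ∈ chartDomain T l) :
    ‖scaledV0 T q‖ < T ^ 3 * T ^ l := by
  rw [scaledV0, norm_mul, norm_pow, Complex.norm_real, Real.norm_eq_abs, abs_of_pos hT]
  have : ‖v0 q‖ < T ^ l := hq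
  gcongr

theorem rpow_bound (hT0 : 0 < T) (hT1 : T < 1) (hl : 0 ≤ l) :
    0 ≤ T ^ 3 * T ^ l ∧ T ^ 3 * T ^ l < 1 := by
  have h1 : T ^ l ≤ 1 := Real.rpow_le_one hT0.le hT1.le hl
  have h2 : 0 < T ^ l := Real.rpow_pos_of_pos hT0 l
  have h3 : T ^ 3 < 1 := pow_lt_one₀ hT0.le hT1 (by norm_num)
  have h4 : 0 < T ^ 3 := by positivity
  exact ⟨by positivity, by nlinarith⟩

theorem isOpen_chartDomain (T l : ℝ) : IsOpen (chartDomain T l) :=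
  isOpen_lt continuous_v0.norm continuous_const

theorem run_mem_chartDomain (hT : 0 < T) {q : C3} {w : List (Fin 3)} (hq : q ∈ chartDomain T l)
    (h : Valid T w q) : run T w q ∈ chartDomain T l := by
  simpa only [chartDomain, Set.mem_ofPred_eq, v0_run hT h] using hq

/-- The sign that says whether a path leads from a vertex of type `b` to one of type `b'`. -/
def sgn (b b' : Bool) : ℤ := if b = b' then 1 else -1

theorem sgn_eq (b b' : Bool) : sgn b b' = 1 ∨ sgn b b' = -1 := by
  unfold sgn; split_ifs <;> simp

theorem sgn_not (b b' : Bool) : sgn (!b) b' = -sgn b b' := by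
  revert b b'; decide

/-- `Γ_B` identifies all vertices of one type, so the vertex where a path ends is irrelevant and
only its parity counts. -/
theorem mk_eq_of_run (hT : 0 < T) {w : List (Fin 3)} {m m' : ℤ × ℤ} {b b' : Bool} {q q' : C3}
    (hq : q ∈ chartDomain T l) (hq' : q' ∈ chartDomain T l) (hw : Valid T w q)
    (hr : run T w q = q') (hp : par w = sgn b b') :
    (Y.mk ⟨((m, b), q), hq⟩ : Y T l) = Y.mk ⟨((m', b'), q'), hq'⟩ := by
  induction w generalizing m b q with
  | nil =>
    have hb : b = b' := by
      by_contra hne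
      simp [sgn, par, hne] at hp
    obtain rfl : q = q' := hr
    subst hb
    have := Quot.sound (Glue.deck (T := T) (l := l) (m' - m) m b q hq)
    rw [Y.mk, Y.mk, this]
    congr
    simp
  | cons i w ih =>
    have hq1 : edgeMap T i q ∈ chartDomain T l :=
      run_mem_chartDomain (w := [i]) hT hq ⟨hw.1, trivial⟩
    have hp' : par w = sgn (!b) b' := by
      rw [sgn_not, ← hp, par, neg_neg]
    have step : (Y.mk ⟨((m, b), q), hq⟩ : Y T l)
        = Y.mk ⟨((if b then m - edgeShift i else m + edgeShift i, !b), edgeMap T i q), hq1⟩ := by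
      cases b with
      | false => exact Quot.sound (Glue.edge m i q hq hw.1 hq1)
      | true =>
        have e := edgeMap_edgeMap hT hw.1
        have := Quot.sound (Glue.edge (T := T) (l := l) (m - edgeShift i) i (edgeMap T i q) hq1
          (edgeMap_apply_ne_zero hT hw.1) (by rwa [e]))
        simp only [e, sub_add_cancel] at this
        exact this.symm
    rw [step]
    exact ih hq1 hw.2 hr hp'

theorem mk_eq_iff (hT : 0 < T) (P P' : ChartPoint T l) :
    Y.mk P = Y.mk P' ↔ ∃ w, Valid T w P.1.2 ∧ run T w P.1.2 = P'.1.2 ∧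
      par w = sgn P.1.1.2 P'.1.1.2 := by
  constructor
  · intro h
    have h' := Quot.eqvGen_exact h
    clear h
    induction h' with
    | rel x y h =>
      cases h with
      | edge m i q hq hi hq' => exact ⟨[i], ⟨hi, trivial⟩, rfl, by simp [par, sgn]⟩
      | deck γ m b q hq => exact ⟨[], trivial, rfl, by simp [par, sgn]⟩
    | refl x => exact ⟨[], trivial, rfl, by simp [par, sgn]⟩
    | symm x y _ ih =>
      obtain ⟨w, h1, h2, h3⟩ := ih
      obtain ⟨h4, h5⟩ := reverse_spec hT h1
      rw [h2] at h4 h5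
      refine ⟨w.reverse, h4, h5, ?_⟩
      rw [par_reverse, h3, sgn, sgn]
      simp only [eq_comm]
    | trans x y z _ _ ih1 ih2 =>
      obtain ⟨w, h1, h2, h3⟩ := ih1
      obtain ⟨w', h1', h2', h3'⟩ := ih2
      refine ⟨w ++ w', valid_append.2 ⟨h1, by rwa [h2]⟩, by rw [run_append, h2, h2'], ?_⟩
      rw [par_append, h3, h3']
      generalize x.1.1.2 = b
      generalize y.1.1.2 = b'
      generalize z.1.1.2 = b''
      revert b b' b''
      decide
  · rintro ⟨w, h1, h2, h3⟩
    exact mk_eq_of_run hT P.2 P'.2 h1 h2 h3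

theorem mk_eq_iff_monoGraph (hT : 0 < T) (P P' : ChartPoint T l) :
    Y.mk P = Y.mk P' ↔ (P.1.2, P'.1.2) ∈
      ⋃ n, monoGraph T (T ^ 3 * T ^ l) (sgn P.1.1.2 P'.1.1.2) n := by
  rw [mk_eq_iff hT, Set.mem_iUnion]
  constructor
  · rintro ⟨w, h1, h2, h3⟩
    have := mem_monoGraph_run hT (norm_scaledV0_lt hT P.2) h1
    rw [h2, h3] at this
    exact ⟨_, this⟩
  · rintro ⟨n, hn⟩
    obtain ⟨w, h1, h2, h3⟩ := exists_word_of_mem_monoGraph hT (sgn_eq _ _) hn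
    exact ⟨w, h1, h3, h2⟩

theorem continuous_mk : Continuous (Y.mk : ChartPoint T l → Y T l) := continuous_quot_mk

/-- A word that identifies two points stays valid and continuous nearby, so the saturation of an
open set is open. -/
theorem isOpenMap_mk (hT : 0 < T) : IsOpenMap (Y.mk : ChartPoint T l → Y T l) := by
  intro O hO
  change IsOpen (Quot.mk _ ⁻¹' (Y.mk '' O))
  rw [isOpen_iff_mem_nhds]
  rintro ⟨⟨v, q⟩, hq⟩ ⟨⟨⟨v', q'⟩, hq'⟩, hO', he⟩
  obtain ⟨w, h1, h2, h3⟩ := (mk_eq_iff hT _ _).1 he.symm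
  obtain ⟨V, hV, rfl⟩ := isOpen_induced_iff.1 hO
  change Valid T w q at h1
  change run T w q = q' at h2
  change par w = sgn v.2 v'.2 at h3
  have c1 : ContinuousAt (fun P : ChartPoint T l => P.1.2) ⟨(v, q), hq⟩ :=
    (continuous_snd.comp continuous_subtype_val).continuousAt
  have c2 : ContinuousAt (fun P : ChartPoint T l => (v', run T w P.1.2)) ⟨(v, q), hq⟩ :=
    continuousAt_const.prodMk (ContinuousAt.comp (f := fun P : ChartPoint T l => P.1.2)
      (continuousAt_run hT h1) c1)
  have c3 : ∀ᶠ P : ChartPoint T l in 𝓝 ⟨(v, q), hq⟩, P.1.1 = v := by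
    have : ContinuousAt (fun P : ChartPoint T l => P.1.1) ⟨(v, q), hq⟩ :=
      (continuous_fst.comp continuous_subtype_val).continuousAt
    exact this.eventually (IsOpen.mem_nhds (isOpen_discrete {v}) rfl)
  have hmem : V ∈ 𝓝 (v', run T w q) := hV.mem_nhds (by rw [h2]; exact hO')
  filter_upwards [c2.eventually hmem, c1.eventually (eventually_valid hT h1), c3]
  rintro ⟨⟨v₁, x⟩, hx⟩ hxV hxw hxv
  obtain rfl : v₁ = v := hxv
  exact ⟨⟨(v', run T w x), run_mem_chartDomain hT hx hxw⟩, hxV,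
    ((mk_eq_iff hT _ _).2 ⟨w, hxw, rfl, h3⟩).symm⟩

theorem isOpenQuotientMap_mk (hT : 0 < T) :
    IsOpenQuotientMap (Y.mk : ChartPoint T l → Y T l) :=
  ⟨Quot.mk_surjective, continuous_mk, isOpenMap_mk hT⟩

/-- For an open quotient map, Hausdorff means that the relation is closed; here it is built from
locally finite unions of closed graphs. -/
theorem t2Space_Y (hT0 : 0 < T) (hT1 : T < 1) (hl : 0 ≤ l) : T2Space (Y T l) := by
  rw [t2Space_iff_of_isOpenQuotientMap (isOpenQuotientMap_mk hT0)]
  obtain ⟨h0, h1⟩ := rpow_bound hT0 hT1 hl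
  have hcl : ∀ s, IsClosed {x : ChartPoint T l × ChartPoint T l |
      (x.1.1.2, x.2.1.2) ∈ ⋃ n, monoGraph T (T ^ 3 * T ^ l) s n} := fun s =>
    ((locallyFinite_monoGraph T h0 h1 s).isClosed_iUnion fun n =>
      isClosed_monoGraph T _ s n).preimage
      ((continuous_snd.comp (continuous_subtype_val.comp continuous_fst)).prodMk
        (continuous_snd.comp (continuous_subtype_val.comp continuous_snd)))
  have hs : Continuous fun x : ChartPoint T l × ChartPoint T l => sgn x.1.1.1.2 x.2.1.1.2 :=
    (continuous_of_discreteTopology (f := fun b : Bool × Bool => sgn b.1 b.2)).comp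
      ((continuous_snd.comp (continuous_fst.comp (continuous_subtype_val.comp
        continuous_fst))).prodMk (continuous_snd.comp (continuous_fst.comp
          (continuous_subtype_val.comp continuous_snd))))
  have key : {x : ChartPoint T l × ChartPoint T l | Y.mk x.1 = Y.mk x.2} =
      ({x | sgn x.1.1.1.2 x.2.1.1.2 = 1} ∩ {x : ChartPoint T l × ChartPoint T l |
      (x.1.1.2, x.2.1.2) ∈ ⋃ n, monoGraph T (T ^ 3 * T ^ l) 1 n}) ∪
      ({x | sgn x.1.1.1.2 x.2.1.1.2 = -1} ∩ {x : ChartPoint T l × ChartPoint T l |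
      (x.1.1.2, x.2.1.2) ∈ ⋃ n, monoGraph T (T ^ 3 * T ^ l) (-1) n}) := by
    ext x
    simp only [Set.mem_ofPred_eq, mk_eq_iff_monoGraph hT0, Set.mem_union, Set.mem_inter_iff]
    rcases sgn_eq x.1.1.1.2 x.2.1.1.2 with h | h <;> simp [h]
  rw [key]
  exact ((isClosed_eq hs continuous_const).inter (hcl 1)).union
    ((isClosed_eq hs continuous_const).inter (hcl (-1)))

/-- By local finiteness `(q, q)` has a neighbourhood that misses all graphs with `s = 1` and `n ≠
0`; on a corresponding set in one chart the open map `Y.mk` is injective. -/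
theorem isLocalHomeomorph_mk (hT0 : 0 < T) (hT1 : T < 1) (hl : 0 ≤ l) :
    IsLocalHomeomorph (Y.mk : ChartPoint T l → Y T l) := by
  rw [isLocalHomeomorph_iff_isOpenEmbedding_restrict]
  rintro ⟨⟨v, q⟩, hq⟩
  obtain ⟨h0, h1⟩ := rpow_bound hT0 hT1 hl
  set δ := T ^ 3 * T ^ l
  have hcl : IsClosed (⋃ n : {n : Fin 3 → ℤ // n ≠ 0}, monoGraph T δ 1 n) :=
    ((locallyFinite_monoGraph T h0 h1 1).comp_injective
      Subtype.val_injective).isClosed_iUnion fun n => isClosed_monoGraph T _ 1 n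
  have hmem : (⋃ n : {n : Fin 3 → ℤ // n ≠ 0}, monoGraph T δ 1 n)ᶜ ∈ 𝓝 (q, q) := by
    refine hcl.isOpen_compl.mem_nhds fun h => ?_
    obtain ⟨⟨n, hn⟩, h⟩ := Set.mem_iUnion.1 h
    exact hn (eq_zero_of_mem_monoGraph_self hT0 h1 h)
  obtain ⟨V₁, V₂, o1, m1, o2, m2, hV⟩ := mem_nhds_prod_iff'.1 hmem
  have hU : IsOpen {P : ChartPoint T l | P.1 ∈ ({v} : Set Vertex) ×ˢ (V₁ ∩ V₂)} :=
    ((isOpen_discrete _).prod (o1.inter o2)).preimage continuous_subtype_val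
  refine ⟨_, hU.mem_nhds ⟨rfl, m1, m2⟩, ?_⟩
  refine Topology.IsOpenEmbedding.of_continuous_injective_isOpenMap
    (continuous_mk.comp continuous_subtype_val) ?_ ((isOpenMap_mk hT0).domRestrict hU)
  rintro ⟨⟨⟨v₁, x⟩, hx⟩, hv1, hx1⟩ ⟨⟨⟨v₂, y⟩, hy⟩, hv2, hy1⟩ he
  obtain rfl : v₁ = v := hv1
  obtain rfl : v₂ = v₁ := hv2
  have he' := (mk_eq_iff_monoGraph hT0 _ _).1 he
  obtain ⟨n, hn⟩ := Set.mem_iUnion.1 he'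
  simp only [sgn, if_true] at hn
  have hn0 : n = 0 := by
    by_contra hne
    exact hV ⟨hx1.1, hy1.2⟩ (Set.mem_iUnion.2 ⟨⟨n, hne⟩, hn⟩)
  subst hn0
  have := eq_of_mem_monoGraph_zero hT0 hn
  subst this
  rfl

theorem isManifoldQuotient (hT0 : 0 < T) (hT1 : T < 1) (hl : 0 ≤ l) : IsManifoldQuotient T l where
  isLocalHomeomorph := isLocalHomeomorph_mk hT0 hT1 hl
  hausdorff := t2Space_Y hT0 hT1 hl
  secondCountable :=
    have : SecondCountableTopology (ChartPoint T l) :=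
      inferInstanceAs (SecondCountableTopology {P : Vertex × C3 | P.2 ∈ chartDomain T l})
    (isOpenQuotientMap_mk hT0).isQuotientMap.secondCountableTopology (isOpenMap_mk hT0)

end Quotient

end BananaMirror
end

noncomputable section

namespace BananaMirror

open scoped ContDiff Topology ComplexConjugate
open Filter

/-! ### Invariance of the potential up to pluriharmonic functions -/

/-- Polarisation of the quadratic form `x ↦ iddbar F q x (i x)` at the vectors `a` and `-i b`. -/
theorem iddbar_polarization {F : C3 → ℝ} {q : C3} (hF : ContDiffAt ℝ 2 F q) (a b : C3) :
    iddbar F q a b = (iddbar F q (a - Complex.I • b) (Complex.I • (a - Complex.I • b))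
      - iddbar F q a (Complex.I • a)
      - iddbar F q (-Complex.I • b) (Complex.I • (-Complex.I • b))) / 2 := by
  have hs : ∀ x y : C3, fderiv ℝ (fderiv ℝ F) q x y = fderiv ℝ (fderiv ℝ F) q y x :=
    (hF.isSymmSndFDerivAt (by simp)).eq
  simp only [iddbar, smul_sub, smul_smul, neg_smul, smul_neg, Complex.I_mul_I, one_smul, map_sub,
    map_neg, sub_apply, neg_apply, neg_neg]
  rw [hs b (Complex.I • a), hs (Complex.I • b) a]
  ring

theorem alternating_ext {f g : C3 [⋀^Fin 2]→L[ℝ] ℝ} (h : ∀ a b, f ![a, b] = g ![a, b]) :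
    f = g := by
  ext v
  have : v = ![v 0, v 1] := by
    funext i; fin_cases i <;> rfl
  rw [this]
  exact h _ _

/-- The form `i ∂∂̄ F` is determined by its values on complex lines. -/
theorem iddbarForm_eq_of_diag {F G : C3 → ℝ} {q : C3} (hF : ContDiffAt ℝ 2 F q)
    (hG : ContDiffAt ℝ 2 G q)
    (h : ∀ a, iddbar F q a (Complex.I • a) = iddbar G q a (Complex.I • a)) :
    iddbarForm F q = iddbarForm G q := by
  refine alternating_ext fun a b => ?_
  rw [iddbarForm_apply hF, iddbarForm_apply hG, iddbar_polarization hF, iddbar_polarization hG,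
    h, h, h]

/-- The potential `F + C |xyz|²`. -/
def fullPotential (α : Bumps) (T p l C : ℝ) (q : C3) : ℝ :=
  potential α T p l q + C * ‖v0 q‖ ^ 2

/-- All points of a path of edges stay in the domain where the potential is smooth. -/
def StaysIn (T l : ℝ) : List (Fin 3) → C3 → Prop
  | [], q => q ∈ bigDomain T l
  | i :: w, q => q ∈ bigDomain T l ∧ q i ≠ 0 ∧ StaysIn T l w (edgeMap T i q)

section Paths

variable {T l : ℝ} {q : C3} {w w' : List (Fin 3)}

theorem StaysIn.mem (h : StaysIn T l w q) : q ∈ bigDomain T l := by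
  cases w with
  | nil => exact h
  | cons i w => exact h.1

/-- The chart over `|v₀| < T ^ l` intersected with the polydisc of radius `2`. -/
def polydisc (T l : ℝ) : Set C3 := {q | q ∈ chartDomain T l ∧ ∀ i, ‖scaled T q i‖ < 2}

theorem isOpen_polydisc (T l : ℝ) : IsOpen (polydisc T l) := by
  have : polydisc T l = chartDomain T l ∩ ⋂ i, {q | ‖scaled T q i‖ < 2} := by
    ext q; simp [polydisc]
  rw [this]
  exact (isOpen_chartDomain T l).inter (isOpen_iInter_of_finite fun i =>
    isOpen_lt (continuous_scaled T i).norm continuous_const)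

theorem mem_bigDomain_of_lt (hT : 0 < T) (hq : q ∈ chartDomain T l)
    (h : ∀ i, ‖scaled T q i‖ < 8) : q ∈ bigDomain T l := by
  have h1 : ‖v0 q‖ < T ^ l := hq
  have h2 := Real.rpow_pos_of_pos hT l
  exact ⟨by linarith, h⟩

theorem mem_bigDomain_of_mem_polydisc (hT : 0 < T) (hq : q ∈ polydisc T l) : q ∈ bigDomain T l :=
  mem_bigDomain_of_lt hT hq.1 fun i => (hq.2 i).trans (by norm_num)

theorem edgeMap_mem_chartDomain (hT : 0 < T) (hq : q ∈ chartDomain T l) {i : Fin 3} (hi : q i ≠ 0) :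
    edgeMap T i q ∈ chartDomain T l := by
  simpa only [chartDomain, Set.mem_ofPred_eq, v0_edgeMap hT i q hi] using hq

theorem edgeMap_mem_bigDomain (hT : 0 < T) (hq : q ∈ polydisc T l) {i : Fin 3}
    (hi : 1 / 8 < ‖scaled T q i‖) : q i ≠ 0 ∧ edgeMap T i q ∈ bigDomain T l := by
  have h0 : scaled T q i ≠ 0 := norm_pos_iff.1 (by linarith)
  have hi0 := (scaled_eq_zero hT).not.1 h0
  refine ⟨hi0, mem_bigDomain_of_lt hT (edgeMap_mem_chartDomain hT hq.1 hi0) ?_⟩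
  obtain ⟨j, k, hij, hik, hjk⟩ := exists_others i
  have a := hq.2 i
  have b := hq.2 j
  have c := hq.2 k
  refine forall_of_ne hij hik hjk ?_ ?_ ?_
  · rw [scaled_edgeMap_self hT, norm_inv, inv_lt_comm₀ (by linarith) (by norm_num)]
    linarith
  · rw [scaled_edgeMap_of_ne _ hij hik hjk, norm_mul]
    nlinarith [norm_nonneg (scaled T q i), norm_nonneg (scaled T q k)]
  · rw [scaled_edgeMap_of_ne _ hik hij hjk.symm, norm_mul]
    nlinarith [norm_nonneg (scaled T q i), norm_nonneg (scaled T q j)]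

set_option maxHeartbeats 400000 in
/-- In the part `v₀ ≠ 0`, monomial maps between points of the polydisc can be written in a short
way. -/
theorem exists_staysIn (hT : 0 < T) (hsmall : T ^ 3 * T ^ l ≤ 1 / 100) (hv : v0 q ≠ 0)
    (hq : q ∈ polydisc T l) (hq' : run T w q ∈ polydisc T l) :
    ∃ w', StaysIn T l w' q ∧ par w' = par w ∧ expo w' = expo w := by
  have hval : Valid T w q := valid_of_v0_ne_zero hT hv
  have hv' := v0_run hT hval
  have hU0 : 0 < ‖scaledV0 T q‖ := norm_pos_iff.2 ((scaledV0_eq_zero hT).not.2 hv)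
  have hU1 := (norm_scaledV0_lt hT hq.1).trans_le hsmall
  have hX0 : ∀ i, 0 < ‖scaled T q i‖ := fun i =>
    norm_pos_iff.2 ((scaled_eq_zero hT).not.2 (ne_zero_of_v0 hv i))
  have hX0' : ∀ i, 0 < ‖scaled T (run T w q) i‖ := fun i =>
    norm_pos_iff.2 ((scaled_eq_zero hT).not.2 (ne_zero_of_v0 (by rwa [hv']) i))
  have hprod : ∀ i j k, i ≠ j → i ≠ k → j ≠ k →
      ‖scaled T q i‖ * ‖scaled T q j‖ * ‖scaled T q k‖ = ‖scaledV0 T q‖ :=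
    fun i j k hij hik hjk => by rw [← norm_mul, ← norm_mul, scaled_mul T q hij hik hjk]
  have hprod' : ∀ i j k, i ≠ j → i ≠ k → j ≠ k → ‖scaled T (run T w q) i‖
      * ‖scaled T (run T w q) j‖ * ‖scaled T (run T w q) k‖ = ‖scaledV0 T q‖ :=
    fun i j k hij hik hjk => by
      rw [← norm_mul, ← norm_mul, scaled_mul T _ hij hik hjk, scaledV0, hv', scaledV0]
  have hr : ∀ j, ‖scaled T (run T w q) j‖ = ‖scaledV0 T q‖ ^ expo w j * ‖scaled T q j‖ ^ par w :=
    fun j => by rw [scaled_run hT hv, norm_mul, norm_zpow, norm_zpow]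
  have hlt := hq.2
  have hlt' := hq'.2
  have hsum := sum_expo w
  have hfin : ∀ w', par w' = par w → expo w' = expo w → run T w' q ∈ bigDomain T l :=
    fun w' h1 h2 => by
      rw [run_eq_run hT hv h2 h1]
      exact mem_bigDomain_of_mem_polydisc hT hq'
  have hΩ := mem_bigDomain_of_mem_polydisc hT hq
  have hbig : ∀ x y z : ℝ, 0 < x → 0 < y → 0 < z → y < 2 → z < 2 →
      x * y * z = ‖scaledV0 T q‖ → ‖scaledV0 T q‖ < 4 * x := fun x y z hx hy hz h1 h2 h => by
    have e1 : y * z < 2 * 2 := mul_lt_mul'' h1 h2 hy.le hz.le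
    nlinarith
  set U := ‖scaledV0 T q‖
  rcases par_eq w with hp | hp
  · simp only [hp, zpow_one] at hr
    -- As the other coordinates are below `2`, `|u| < 4 |X_i|`. An exponent at most `-2` would send
    -- `X_i` to modulus greater than `1 / (4 |u|)`, which exceeds `2` as `|u| < 1 / 100`.
    have h1 : ∀ i, -1 ≤ expo w i := fun i => by
      by_contra! hn
      obtain ⟨j, k, hij, hik, hjk⟩ := exists_others i
      have e := hbig _ _ _ (hX0 i) (hX0 j) (hX0 k) (hlt j) (hlt k) (hprod i j k hij hik hjk)
      have e2 : U ^ (-2 : ℤ) ≤ U ^ expo w i :=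
        zpow_le_zpow_right_of_le_one₀ hU0 (by linarith) (by omega)
      have e3 := hlt' i
      rw [hr] at e3
      have e4 : U ^ (-2 : ℤ) * ‖scaled T q i‖ < 2 := lt_of_le_of_lt (by gcongr) e3
      rw [zpow_neg, inv_mul_eq_div, div_lt_iff₀ (by positivity)] at e4
      norm_cast at e4
      nlinarith
    have h2 : ∀ i, expo w i ≤ 1 := fun i => by
      by_contra! hn
      obtain ⟨j, k, hij, hik, hjk⟩ := exists_others i
      have e := hbig _ _ _ (hX0' i) (hX0' j) (hX0' k) (hlt' j) (hlt' k) (hprod' i j k hij hik hjk)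
      have e2 : U ^ expo w i ≤ U ^ (2 : ℤ) :=
        zpow_le_zpow_right_of_le_one₀ hU0 (by linarith) (by omega)
      have e3 : ‖scaled T (run T w q) i‖ ≤ U ^ (2 : ℤ) * 2 := by
        rw [hr]
        have := (hlt i).le
        gcongr
      norm_cast at e3
      nlinarith
    rcases even_cases (by omega) h1 h2 with h0 | ⟨i, j, k, hij, hik, hjk, hi, hj, hk⟩
    · exact ⟨[], hΩ, hp.symm, by rw [h0]; rfl⟩
    · have hpar : par [i, j] = par w := by rw [hp]; rfl
      have hexp : expo [i, j] = expo w := by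
        funext m
        refine forall_of_ne (R := fun m => expo [i, j] m = expo w m) hij hik hjk ?_ ?_ ?_ m <;>
          simp [expo, par, hij, hik.symm, hjk.symm, hij.symm, hi, hj, hk]
      have hxj : ‖scaled T q j‖ < 2 * U := by
        have e3 := hlt' j
        rw [hr, hj, zpow_neg_one, inv_mul_eq_div, div_lt_iff₀ hU0] at e3
        exact e3
      -- This keeps the inverted coordinate below `8`, so the intermediate point stays in
      -- `bigDomain`.
      have hxi : 1 / 8 < ‖scaled T q i‖ := by
        by_contra! hn
        have e1 := hprod i j k hij hik hjk
        have e2 : ‖scaled T q i‖ * ‖scaled T q j‖ * ‖scaled T q k‖ ≤ 1 / 8 * (2 * U) * 2 := by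
          have := (hlt k).le
          gcongr
        linarith
      obtain ⟨g1, g2⟩ := edgeMap_mem_bigDomain hT hq hxi
      have g3 := ne_zero_of_v0 (q := edgeMap T i q) (by rwa [v0_edgeMap hT i q g1]) j
      have g4 := hfin _ hpar hexp
      simp only [run] at g4
      refine ⟨[i, j], ?_, hpar, hexp⟩
      simp only [StaysIn]
      exact ⟨hΩ, g1, g2, g3, g4⟩
  · simp only [hp, zpow_neg_one] at hr
    have hr' : ∀ i, ‖scaled T (run T w q) i‖ * ‖scaled T q i‖ = U ^ expo w i := fun i => by
      rw [hr, inv_mul_cancel_right₀ (hX0 i).ne']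
    have h1 : ∀ i, 0 ≤ expo w i := fun i => by
      by_contra! hn
      have e2 : U ^ (-1 : ℤ) ≤ U ^ expo w i :=
        zpow_le_zpow_right_of_le_one₀ hU0 (by linarith) (by omega)
      have e3 : ‖scaled T (run T w q) i‖ * ‖scaled T q i‖ < 2 * 2 :=
        mul_lt_mul'' (hlt' i) (hlt i) (hX0' i).le (hX0 i).le
      rw [← hr', zpow_neg_one, inv_le_iff_one_le_mul₀ hU0] at e2
      nlinarith
    obtain ⟨i, j, k, hij, hik, hjk, hji, ⟨hi, hk⟩ | ⟨hi, hk⟩⟩ := odd_cases (by omega) h1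
    · rw [hi] at hji
      have hpar : par [k] = par w := by rw [hp]; rfl
      have hexp : expo [k] = expo w := by
        funext m
        refine forall_of_ne (R := fun m => expo [k] m = expo w m) hij hik hjk ?_ ?_ ?_ m <;>
          simp [expo, par, hik, hjk, hi, hji, hk]
      have g4 := hfin _ hpar hexp
      simp only [run] at g4
      refine ⟨[k], ?_, hpar, hexp⟩
      simp only [StaysIn]
      exact ⟨hΩ, ne_zero_of_v0 hv k, g4⟩
    · rw [hi] at hji
      have hpar : par [i, k, j] = par w := by rw [hp]; rfl
      have hexp : expo [i, k, j] = expo w := by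
        funext m
        refine forall_of_ne (R := fun m => expo [i, k, j] m = expo w m) hij hik hjk ?_ ?_ ?_ m <;>
          simp [expo, par, hik, hjk, hij, hij.symm, hik.symm, hjk.symm, hi, hji, hk]
      have ri := hr' i
      have rj := hr' j
      rw [hi, zpow_zero] at ri
      rw [hji, zpow_zero] at rj
      have hxi : 1 / 8 < ‖scaled T q i‖ := by
        by_contra! hn
        nlinarith [hlt' i, hX0 i, hX0' i]
      obtain ⟨g1, g2⟩ := edgeMap_mem_bigDomain hT hq hxi
      have hv1 : v0 (edgeMap T i q) ≠ 0 := by rwa [v0_edgeMap hT i q g1]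
      have g3 := ne_zero_of_v0 hv1 k
      have hv2 : v0 (edgeMap T k (edgeMap T i q)) ≠ 0 := by rwa [v0_edgeMap hT k _ g3]
      have fi := congrArg (‖·‖) (scaled_edgeMap_self hT i q)
      have fj := congrArg (‖·‖) (scaled_edgeMap_of_ne (T := T) q hij hik hjk)
      have fk := congrArg (‖·‖) (scaled_edgeMap_of_ne (T := T) q hik hij hjk.symm)
      simp only [norm_mul, norm_inv] at fi fj fk
      have g4 : edgeMap T k (edgeMap T i q) ∈ bigDomain T l := by
        refine mem_bigDomain_of_lt hT (edgeMap_mem_chartDomain hT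
          (edgeMap_mem_chartDomain hT hq.1 g1) g3) (forall_of_ne hij hik hjk ?_ ?_ ?_)
        · rw [scaled_edgeMap_of_ne _ hik.symm hjk.symm hij, norm_mul, fk, fj]
          have e : ‖scaled T q i‖ * ‖scaled T q j‖ * (‖scaled T q i‖ * ‖scaled T q k‖)
              = ‖scaled T q i‖ * U := by
            rw [← hprod i j k hij hik hjk]; ring
          rw [e]
          nlinarith [hlt i, hX0 i]
        · rw [scaled_edgeMap_of_ne _ hjk.symm hik.symm hij.symm, norm_mul, fk, fi,
            mul_right_comm, mul_inv_cancel₀ (hX0 i).ne', one_mul]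
          exact (hlt j).trans (by norm_num)
        · rw [scaled_edgeMap_self hT, norm_inv, fk]
          have e : (‖scaled T q i‖ * ‖scaled T q j‖)⁻¹
              = ‖scaled T (run T w q) i‖ * ‖scaled T (run T w q) j‖ := by
            rw [mul_inv, eq_inv_of_mul_eq_one_left ri, eq_inv_of_mul_eq_one_left rj]
          rw [e]
          have : ‖scaled T (run T w q) i‖ * ‖scaled T (run T w q) j‖ < 2 * 2 :=
            mul_lt_mul'' (hlt' i) (hlt' j) (hX0' i).le (hX0' j).le
          linarith
      have g5 := ne_zero_of_v0 hv2 j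
      have g6 := hfin _ hpar hexp
      simp only [run] at g6
      refine ⟨[i, k, j], ?_, hpar, hexp⟩
      simp only [StaysIn]
      exact ⟨hΩ, g1, g2, g3, g4, g5, g6⟩

end Paths

namespace Setup

variable {α : Bumps} {T p l ε : ℝ} {q : C3} {i : Fin 3} {w w' : List (Fin 3)}

theorem contDiffAt_fullPotential (h : Setup α T p l ε) (C : ℝ) (hq : q ∈ bigDomain T l) :
    ContDiffAt ℝ ∞ (fullPotential α T p l C) q := by
  have h1 : ContDiffAt ℝ ∞ v0 q := (contDiff_v0 (n := ∞)).contDiffAt.restrict_scalars ℝ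
  exact (h.contDiffAt_potential hq).add (contDiffAt_const.mul (h1.norm_sq ℝ))

theorem fullPotential_edgeMap (h : Setup α T p l ε) (C : ℝ) (hq : q ∈ bigDomain T l) (hi : q i ≠ 0)
    (hq' : edgeMap T i q ∈ bigDomain T l) : fullPotential α T p l C (edgeMap T i q)
      = fullPotential α T p l C q - Real.log (nsq T i q) := by
  rw [fullPotential, fullPotential, h.potential_edgeMap hq hi hq', v0_edgeMap h.pos i q hi]
  ring

/-- The two potentials differ by `2 log T + 2 log |x_i|`, which is pluriharmonic. -/
theorem iddbarForm_comp_edgeMap (h : Setup α T p l ε) (C : ℝ) (hq : q ∈ bigDomain T l)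
    (hi : q i ≠ 0) (hq' : edgeMap T i q ∈ bigDomain T l) :
    iddbarForm (fullPotential α T p l C ∘ edgeMap T i) q
      = iddbarForm (fullPotential α T p l C) q := by
  have hE : ContDiffAt ℂ ∞ (edgeMap T i) q := contDiffAt_edgeMap h.pos hi
  have hEv : fullPotential α T p l C ∘ edgeMap T i =ᶠ[𝓝 q]
      fun x => fullPotential α T p l C x - (2 * Real.log T + 2 * Real.log ‖x i‖) := by
    have h1 : ∀ᶠ x : C3 in 𝓝 q, x i ≠ 0 := (continuous_apply i).continuousAt.eventually_ne hi
    filter_upwards [h1, (isOpen_bigDomain T l).mem_nhds hq,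
      hE.continuousAt.eventually ((isOpen_bigDomain T l).mem_nhds hq')] with x a b c
    rw [Function.comp_apply, h.fullPotential_edgeMap C b a c, nsq_eq h.pos, Real.log_pow,
      Real.log_mul h.pos.ne' (by simpa using a)]
    push_cast
    ring
  have hF := (h.contDiffAt_fullPotential C hq).of_le two_le_infty
  refine iddbarForm_eq_of_diag (((h.contDiffAt_fullPotential C hq').comp q
    (hE.restrict_scalars ℝ)).of_le two_le_infty) hF fun a => ?_
  have j : HasLevi (fullPotential α T p l C) q a
      ((fderiv ℝ (fullPotential α T p l C) q a : ℂ)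
        - Complex.I * fderiv ℝ (fullPotential α T p l C) q (Complex.I • a)) _ :=
    ⟨hF, by simp, by simp, rfl⟩
  have j2 := (j.sub ((HasLevi.const (2 * Real.log T)).add
    ((hasLevi_log_norm hi a).const_mul 2))).congr hEv
  rw [j2.4]
  ring

theorem iddbarForm_comp_of_staysIn (h : Setup α T p l ε) (C : ℝ) (hw : StaysIn T l w q) :
    Valid T w q ∧ run T w q ∈ bigDomain T l ∧
    iddbarForm (fullPotential α T p l C ∘ run T w) q
      = iddbarForm (fullPotential α T p l C) q := by
  induction w generalizing q with
  | nil => exact ⟨trivial, hw, rfl⟩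
  | cons i w ih =>
    obtain ⟨h1, h2, h3⟩ := hw
    obtain ⟨a, b, c⟩ := ih h3
    have hE : ContDiffAt ℂ ∞ (edgeMap T i) q := contDiffAt_edgeMap h.pos h2
    refine ⟨⟨h2, a⟩, b, ?_⟩
    change iddbarForm ((fullPotential α T p l C ∘ run T w) ∘ edgeMap T i) q = _
    rw [iddbarForm_comp ((h.contDiffAt_fullPotential C b).comp _
      ((contDiffAt_run h.pos a).restrict_scalars ℝ)) hE, c,
      ← iddbarForm_comp (h.contDiffAt_fullPotential C h3.mem) hE,
      h.iddbarForm_comp_edgeMap C h1 h2 h3.mem]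

/-- Where `v₀ ≠ 0`, the word can be replaced by a short one staying in `bigDomain`, along which each
edge preserves the form. Both sides are continuous, so density of `v₀ ≠ 0` gives the rest. -/
theorem iddbarForm_comp_run_of_mem (h : Setup α T p l ε) (C : ℝ)
    (hsmall : T ^ 3 * T ^ l ≤ 1 / 100) (hq : q ∈ polydisc T l) (hw : Valid T w q)
    (hq' : run T w q ∈ polydisc T l) :
    iddbarForm (fullPotential α T p l C ∘ run T w) q
      = iddbarForm (fullPotential α T p l C) q := by
  have hne : ∀ x, v0 x ≠ 0 → x ∈ polydisc T l → run T w x ∈ polydisc T l →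
      iddbarForm (fullPotential α T p l C ∘ run T w) x
        = iddbarForm (fullPotential α T p l C) x := fun x h1 h2 h3 => by
    obtain ⟨w', a, b, c⟩ := exists_staysIn h.pos hsmall h1 h2 h3
    rw [← (h.iddbarForm_comp_of_staysIn C a).2.2]
    refine iddbarForm_congr ?_
    filter_upwards [(continuous_v0.continuousAt).eventually_ne h1] with y hy
    rw [Function.comp_apply, Function.comp_apply, run_eq_run h.pos hy c b]
  have c1 : ContinuousAt (iddbarForm (fullPotential α T p l C ∘ run T w)) q :=
    (contDiffAt_iddbarForm ((h.contDiffAt_fullPotential C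
      (mem_bigDomain_of_mem_polydisc h.pos hq')).comp q
        ((contDiffAt_run h.pos hw).restrict_scalars ℝ))).continuousAt
  have c2 : ContinuousAt (iddbarForm (fullPotential α T p l C)) q :=
    (contDiffAt_iddbarForm (h.contDiffAt_fullPotential C
      (mem_bigDomain_of_mem_polydisc h.pos hq))).continuousAt
  refine tendsto_nhds_unique_of_frequently_eq c1 c2 ?_
  have h1 : ∃ᶠ x in 𝓝 q, v0 x ≠ 0 := mem_closure_iff_frequently.1 (dense_v0_ne_zero q)
  have h2 : ∀ᶠ x in 𝓝 q, x ∈ polydisc T l := (isOpen_polydisc T l).mem_nhds hq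
  have h3 : ∀ᶠ x in 𝓝 q, run T w x ∈ polydisc T l :=
    (continuousAt_run h.pos hw).eventually ((isOpen_polydisc T l).mem_nhds hq')
  exact (h1.and_eventually (h2.and h3)).mono fun x hx => hne x hx.1 hx.2.1 hx.2.2

/-- Independence of the path: `w.reverse ++ w'` joins the two end points in the polydisc, and the
invariance there is pulled back along `w`. -/
theorem iddbarForm_comp_run_eq (h : Setup α T p l ε) (C : ℝ)
    (hsmall : T ^ 3 * T ^ l ≤ 1 / 100) (hw : Valid T w q) (hw' : Valid T w' q)
    (hq : run T w q ∈ polydisc T l) (hq' : run T w' q ∈ polydisc T l) :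
    iddbarForm (fullPotential α T p l C ∘ run T w) q
      = iddbarForm (fullPotential α T p l C ∘ run T w') q := by
  obtain ⟨r1, r2⟩ := reverse_spec h.pos hw
  have hval : Valid T (w.reverse ++ w') (run T w q) := valid_append.2 ⟨r1, by rwa [r2]⟩
  have hrun : run T (w.reverse ++ w') (run T w q) = run T w' q := by rw [run_append, r2]
  have hE : ContDiffAt ℂ ∞ (run T w) q := contDiffAt_run h.pos hw
  have hev : fullPotential α T p l C ∘ run T w' =ᶠ[𝓝 q]
      (fullPotential α T p l C ∘ run T (w.reverse ++ w')) ∘ run T w := by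
    filter_upwards [eventually_valid h.pos hw] with x hx
    simp only [Function.comp_apply, run_append, (reverse_spec h.pos hx).2]
  have hm : run T (w.reverse ++ w') (run T w q) ∈ polydisc T l := by rwa [hrun]
  rw [iddbarForm_congr hev, iddbarForm_comp (h.contDiffAt_fullPotential C
    (mem_bigDomain_of_mem_polydisc h.pos hq)) hE, iddbarForm_comp
    ((h.contDiffAt_fullPotential C (mem_bigDomain_of_mem_polydisc h.pos hm)).comp _
      ((contDiffAt_run h.pos hval).restrict_scalars ℝ)) hE,
    h.iddbarForm_comp_run_of_mem C hsmall hq hval hm]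

end Setup

end BananaMirror
end

noncomputable section

namespace BananaMirror

open scoped ContDiff Topology ComplexConjugate
open Filter

/-! ### The Kähler form -/

open Classical in
/-- The form with potential `F + C |xyz|²` around each vertex: at `q`, the potential is transported
along some path that leads from `q` to the polydisc. -/
def kahlerForm (α : Bumps) (T p l C : ℝ) (q : C3) : C3 [⋀^Fin 2]→L[ℝ] ℝ :=
  if h : ∃ w, Valid T w q ∧ run T w q ∈ polydisc T l then
    (1 / (2 * Real.pi)) • iddbarForm (fullPotential α T p l C ∘ run T h.choose) q
  else 0

theorem fderiv_comp_inverse {f g : C3 → C3} {q : C3} (hf : DifferentiableAt ℝ f q)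
    (hg : DifferentiableAt ℝ g (f q)) (hgf : ∀ᶠ x in 𝓝 q, g (f x) = x) :
    (fderiv ℝ g (f q)).comp (fderiv ℝ f q) = ContinuousLinearMap.id ℝ C3 := by
  rw [← fderiv_comp q hg hf, EventuallyEq.fderiv_eq (f₁ := g ∘ f) (f := id) hgf, fderiv_id]

section Forms

variable {T l : ℝ} {q : C3} {w : List (Fin 3)} {i : Fin 3}

theorem differentiableAt_run (hT : 0 < T) (h : Valid T w q) : DifferentiableAt ℝ (run T w) q :=
  ((contDiffAt_run (n := 1) hT h).differentiableAt (by simp)).restrictScalars ℝ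

theorem fderiv_run_reverse (hT : 0 < T) (h : Valid T w q) :
    (fderiv ℝ (run T w.reverse) (run T w q)).comp (fderiv ℝ (run T w) q)
      = ContinuousLinearMap.id ℝ C3 :=
  fderiv_comp_inverse (differentiableAt_run hT h) (differentiableAt_run hT (reverse_spec hT h).1)
    ((eventually_valid hT h).mono fun _ hx => (reverse_spec hT hx).2)

theorem fderiv_run_ne_zero (hT : 0 < T) (h : Valid T w q) {a : C3} (ha : a ≠ 0) :
    fderiv ℝ (run T w) q a ≠ 0 := by
  intro h0
  have := DFunLike.congr_fun (fderiv_run_reverse hT h) a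
  rw [ContinuousLinearMap.comp_apply, h0, map_zero] at this
  exact ha this.symm

theorem fderiv_run_smul (hT : 0 < T) (h : Valid T w q) (c : ℂ) (a : C3) :
    fderiv ℝ (run T w) q (c • a) = c • fderiv ℝ (run T w) q a := by
  have hd := (contDiffAt_run (n := 1) hT h).differentiableAt (by simp)
  rw [(hd.hasFDerivAt.restrictScalars ℝ).fderiv]
  exact map_smul (fderiv ℂ (run T w) q) c a

theorem exists_run_mem (hT0 : 0 < T) (hT1 : T < 1) (hl : 0 ≤ l) (hq : q ∈ chartDomain T l) :
    ∃ w, Valid T w q ∧ run T w q ∈ chartDomain T l ∧ ∀ i, ‖scaled T (run T w q) i‖ ≤ 1 := by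
  obtain ⟨w, h1, h2⟩ := exists_run_mem_polydisc hT0
    ((norm_scaledV0_lt hT0 hq).trans (rpow_bound hT0 hT1 hl).2)
  exact ⟨w, h1, run_mem_chartDomain hT0 hq h1, h2⟩

theorem mem_polydisc_of_le (hq : q ∈ chartDomain T l) (h : ∀ i, ‖scaled T q i‖ ≤ 1) :
    q ∈ polydisc T l := ⟨hq, fun i => (h i).trans_lt (by norm_num)⟩

/-- The values of a two-form on `Y` at the two ends of an edge determine each other. -/
theorem exists_vertex_edge (hT : 0 < T) (hq : q ∈ chartDomain T l) (hi : q i ≠ 0) (v : Vertex) :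
    ∃ v', ∀ η : FormFamily, IsTwoForm T l η →
      η v q = (η v' (edgeMap T i q)).compContinuousLinearMap (fderiv ℝ (edgeMap T i) q) := by
  obtain ⟨m, b⟩ := v
  cases b with
  | false => exact ⟨(m + edgeShift i, true), fun η hη => hη.edge m i q hq hi⟩
  | true =>
    refine ⟨(m - edgeShift i, false), fun η hη => ?_⟩
    have h1 : Valid T [i] q := ⟨hi, trivial⟩
    have hd : (fderiv ℝ (edgeMap T i) (edgeMap T i q)).comp (fderiv ℝ (edgeMap T i) q)
        = ContinuousLinearMap.id ℝ C3 := fderiv_run_reverse hT h1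
    rw [hη.edge (m - edgeShift i) i (edgeMap T i q) (edgeMap_mem_chartDomain hT hq hi)
      (edgeMap_apply_ne_zero hT hi), edgeMap_edgeMap hT hi, sub_add_cancel]
    refine alternating_ext fun a b => ?_
    have e : ∀ x, fderiv ℝ (edgeMap T i) (edgeMap T i q) (fderiv ℝ (edgeMap T i) q x) = x :=
      fun x => DFunLike.congr_fun hd x
    simp only [ContinuousAlternatingMap.compContinuousLinearMap_apply]
    congr 1
    funext j
    fin_cases j
    · exact (e a).symm
    · exact (e b).symm

theorem eq_of_eq_run (hT : 0 < T) {η η' : FormFamily} (hη : IsTwoForm T l η)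
    (hη' : IsTwoForm T l η') (hq : q ∈ chartDomain T l) (hw : Valid T w q)
    (h : ∀ v, η v (run T w q) = η' v (run T w q)) (v : Vertex) : η v q = η' v q := by
  induction w generalizing q v with
  | nil => exact h v
  | cons i w ih =>
    obtain ⟨v', hv'⟩ := exists_vertex_edge hT hq hw.1 v
    rw [hv' η hη, hv' η' hη', ih (edgeMap_mem_chartDomain hT hq hw.1) hw.2 h v']

end Forms

theorem HasPotential.unique {α : Bumps} {T p l C : ℝ} {η η' : FormFamily} (hT0 : 0 < T)
    (hT1 : T < 1) (hl : 0 ≤ l) (hη : HasPotential α T p l C η) (hη' : HasPotential α T p l C η')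
    (v : Vertex) {q : C3} (hq : q ∈ chartDomain T l) : η v q = η' v q := by
  obtain ⟨w, h1, h2, h3⟩ := exists_run_mem hT0 hT1 hl hq
  refine eq_of_eq_run hT0 hη.isTwoForm hη'.isTwoForm hq h1 (fun v => ?_) v
  refine alternating_ext fun a b => ?_
  rw [hη.eq v _ h2 h3, hη'.eq v _ h2 h3]

namespace Setup

variable {α : Bumps} {T p l ε C : ℝ} {q : C3} {w : List (Fin 3)}

theorem small (h : Setup α T p l ε) (hT1 : T < 1) (hl : 0 ≤ l) : T ^ 3 * T ^ l ≤ 1 / 100 := by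
  have hS := h.scales
  have h1 : T ^ 3 * T ^ l ≤ T ^ (2 + l / 2) := by
    rw [← Real.rpow_natCast, ← Real.rpow_add h.pos]
    exact Real.rpow_le_rpow_of_exponent_ge h.pos hT1.le (by push_cast; linarith)
  linarith [hS.s₀_le, hS.s₁_le]

theorem kahlerForm_eq (h : Setup α T p l ε) (hT1 : T < 1) (hl : 0 ≤ l) (hw : Valid T w q)
    (hq : run T w q ∈ polydisc T l) : kahlerForm α T p l C q
      = (1 / (2 * Real.pi)) • iddbarForm (fullPotential α T p l C ∘ run T w) q := by
  have hex : ∃ w, Valid T w q ∧ run T w q ∈ polydisc T l := ⟨w, hw, hq⟩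
  rw [kahlerForm, dif_pos hex, h.iddbarForm_comp_run_eq C (h.small hT1 hl) hex.choose_spec.1 hw
    hex.choose_spec.2 hq]

theorem kahlerForm_eventuallyEq (h : Setup α T p l ε) (hT1 : T < 1) (hl : 0 ≤ l)
    (hw : Valid T w q) (hq : run T w q ∈ polydisc T l) : kahlerForm α T p l C =ᶠ[𝓝 q]
      fun x => (1 / (2 * Real.pi)) • iddbarForm (fullPotential α T p l C ∘ run T w) x := by
  filter_upwards [eventually_valid h.pos hw, (continuousAt_run h.pos hw).eventually
    ((isOpen_polydisc T l).mem_nhds hq)] with x h1 h2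
  exact h.kahlerForm_eq hT1 hl h1 h2

theorem contDiffAt_fullPotential_run (h : Setup α T p l ε) (C : ℝ) (hw : Valid T w q)
    (hq : run T w q ∈ polydisc T l) : ContDiffAt ℝ ∞ (fullPotential α T p l C ∘ run T w) q :=
  (h.contDiffAt_fullPotential C (mem_bigDomain_of_mem_polydisc h.pos hq)).comp q
    ((contDiffAt_run h.pos hw).restrict_scalars ℝ)

theorem isTwoForm_kahlerForm (h : Setup α T p l ε) (hT1 : T < 1) (hl : 0 ≤ l) (C : ℝ) :
    IsTwoForm T l (fun _ => kahlerForm α T p l C) where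
  smooth _ q hq := by
    obtain ⟨w, h1, h2, h3⟩ := exists_run_mem h.pos hT1 hl hq
    have h4 := mem_polydisc_of_le h2 h3
    exact (((contDiffAt_iddbarForm (h.contDiffAt_fullPotential_run C h1 h4)).const_smul
      _).congr_of_eventuallyEq (h.kahlerForm_eventuallyEq hT1 hl h1 h4)).contDiffWithinAt
  edge m i q hq hi := by
    obtain ⟨w, h1, h2, h3⟩ := exists_run_mem h.pos hT1 hl (edgeMap_mem_chartDomain h.pos hq hi)
    have h4 := mem_polydisc_of_le h2 h3
    have hw : Valid T (i :: w) q := ⟨hi, h1⟩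
    have e : fullPotential α T p l C ∘ run T (i :: w)
        = (fullPotential α T p l C ∘ run T w) ∘ edgeMap T i := rfl
    rw [h.kahlerForm_eq hT1 hl hw h4, h.kahlerForm_eq hT1 hl h1 h4, e, iddbarForm_comp
      (h.contDiffAt_fullPotential_run C h1 h4) (contDiffAt_edgeMap h.pos hi)]
    rfl
  deck _ _ _ _ _ := rfl

theorem hasPotential_kahlerForm (h : Setup α T p l ε) (hT1 : T < 1) (hl : 0 ≤ l) (C : ℝ) :
    HasPotential α T p l C (fun _ => kahlerForm α T p l C) where
  isTwoForm := h.isTwoForm_kahlerForm hT1 hl C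
  eq _ q hq hq1 a b := by
    have hw : Valid T [] q := trivial
    have h4 : run T [] q ∈ polydisc T l := mem_polydisc_of_le hq hq1
    rw [h.kahlerForm_eq hT1 hl hw h4, ContinuousAlternatingMap.smul_apply, smul_eq_mul]
    congr 1
    exact iddbarForm_apply ((h.contDiffAt_fullPotential_run C hw h4).of_le two_le_infty) a b

theorem extDeriv_kahlerForm (h : Setup α T p l ε) (hT1 : T < 1) (hl : 0 ≤ l) (C : ℝ)
    (hq : q ∈ chartDomain T l) : extDeriv (kahlerForm α T p l C) q = 0 := by
  obtain ⟨w, h1, h2, h3⟩ := exists_run_mem h.pos hT1 hl hq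
  have h4 := mem_polydisc_of_le h2 h3
  have hF := h.contDiffAt_fullPotential_run C h1 h4
  rw [(h.kahlerForm_eventuallyEq hT1 hl h1 h4).extDeriv_eq]
  have := extDeriv_fun_smul (1 / (2 * Real.pi))
    (iddbarForm (fullPotential α T p l C ∘ run T w)) (x := q)
  exact this.trans (by rw [extDeriv_iddbarForm hF, smul_zero])

/-- The path to the polydisc is holomorphic with invertible derivative, so it carries `(a, i a)` to
a nonzero pair of the same kind. -/
theorem kahlerForm_pos (h : Setup α T p l ε) (hT1 : T < 1) (hl : 0 ≤ l)
    (hC : ∀ q, ‖v0 q‖ ≤ T ^ l → (∀ i, ‖(T : ℂ) * q i‖ ≤ 1) →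
      ∀ v ≠ 0, 0 < iddbar (fullPotential α T p l C) q v (Complex.I • v))
    (hq : q ∈ chartDomain T l) {a : C3} (ha : a ≠ 0) :
    0 < kahlerForm α T p l C q ![a, Complex.I • a] := by
  obtain ⟨w, h1, h2, h3⟩ := exists_run_mem h.pos hT1 hl hq
  have h4 := mem_polydisc_of_le h2 h3
  have hF := h.contDiffAt_fullPotential C (mem_bigDomain_of_mem_polydisc h.pos h4)
  rw [h.kahlerForm_eq hT1 hl h1 h4, iddbarForm_comp hF (contDiffAt_run h.pos h1),
    ContinuousAlternatingMap.smul_apply, smul_eq_mul,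
    ContinuousAlternatingMap.compContinuousLinearMap_apply]
  have e : fderiv ℝ (run T w) q ∘ ![a, Complex.I • a]
      = ![fderiv ℝ (run T w) q a, Complex.I • fderiv ℝ (run T w) q a] := by
    funext j
    fin_cases j
    · rfl
    · exact fderiv_run_smul h.pos h1 _ _
  rw [e, iddbarForm_apply (hF.of_le two_le_infty)]
  have h5 : ‖v0 (run T w q)‖ < T ^ l := h2
  exact mul_pos (by positivity) (hC _ h5.le h3 _ (fderiv_run_ne_zero h.pos h1 ha))

end Setup

theorem fderiv_v0_ne_zero {q : C3} (h : v0 q ≠ 0) : fderiv ℂ v0 q ≠ 0 := by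
  intro h0
  have hd : HasFDerivAt v0 _ q := ((hasFDerivAt_apply (𝕜 := ℂ) 0 q).mul
    (hasFDerivAt_apply (𝕜 := ℂ) 1 q)).mul (hasFDerivAt_apply (𝕜 := ℂ) 2 q)
  have := DFunLike.congr_fun (hd.fderiv.symm.trans h0) (Pi.single 2 1)
  simp at this
  rcases this with h1 | h1 <;> exact ne_zero_of_v0 h _ h1

end BananaMirror
end

noncomputable section

namespace BananaMirror

open scoped ContDiff Topology ComplexConjugate
open Filter

/-! ### The torus bundle -/

/-- The logarithms of the coordinates of the torus map: `Λ` is a logarithm of `T³ v₀`. -/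
def torusLog (Λ : ℂ) (t : Fin 4 → ℝ) : Fin 3 → ℂ :=
  ![2 * Real.pi * Complex.I * t 0 + Λ * t 2, 2 * Real.pi * Complex.I * t 1 + Λ * t 3,
    Λ - (2 * Real.pi * Complex.I * t 0 + Λ * t 2) - (2 * Real.pi * Complex.I * t 1 + Λ * t 3)]

/-- The universal covering of the part `v₀ = exp Λ / T³` of a chart. -/
def torusMap (T : ℝ) (Λ : ℂ) (t : Fin 4 → ℝ) : C3 := fun i => Complex.exp (torusLog Λ t i) / T

section Torus

variable {T l : ℝ} {Λ : ℂ}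

/-- As `2πi` is purely imaginary and `Λ` is not, the two form a real basis of `ℂ`;
`exists_log_basis` is the spanning half. -/
theorem log_basis_unique (hΛ : Λ.re ≠ 0) {x y : ℝ}
    (h : 2 * Real.pi * Complex.I * x + Λ * y = 0) : x = 0 ∧ y = 0 := by
  have hre := congrArg Complex.re h
  have him := congrArg Complex.im h
  simp [hΛ] at hre
  simp [hre] at him
  exact ⟨by simpa [Real.pi_ne_zero] using him, hre⟩

theorem exists_log_basis (hΛ : Λ.re ≠ 0) (z : ℂ) :
    ∃ x y : ℝ, z = 2 * Real.pi * Complex.I * x + Λ * y := by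
  have hpi := Real.pi_ne_zero
  obtain ⟨x, hx⟩ : ∃ x : ℝ, 2 * Real.pi * x + Λ.im * (z.re / Λ.re) = z.im :=
    ⟨(z.im - Λ.im * (z.re / Λ.re)) / (2 * Real.pi), by field_simp; ring⟩
  obtain ⟨y, hy⟩ : ∃ y : ℝ, y = z.re / Λ.re := ⟨_, rfl⟩
  rw [← hy] at hx
  have hy' : Λ.re * y = z.re := by rw [hy]; field_simp
  refine ⟨x, y, ?_⟩
  apply Complex.ext
  · simp [hy']
  · simp [← hx]

theorem scaled_torusMap (hT : 0 < T) (Λ : ℂ) (t : Fin 4 → ℝ) (i : Fin 3) :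
    scaled T (torusMap T Λ t) i = Complex.exp (torusLog Λ t i) := by
  have hT' : (T : ℂ) ≠ 0 := by exact_mod_cast hT.ne'
  rw [scaled, torusMap]
  field_simp

theorem scaledV0_torusMap (hT : 0 < T) (Λ : ℂ) (t : Fin 4 → ℝ) :
    scaledV0 T (torusMap T Λ t) = Complex.exp Λ := by
  rw [← scaled_mul T _ (show (0 : Fin 3) ≠ 1 by decide) (show (0 : Fin 3) ≠ 2 by decide)
    (show (1 : Fin 3) ≠ 2 by decide), scaled_torusMap hT, scaled_torusMap hT, scaled_torusMap hT,
    ← Complex.exp_add, ← Complex.exp_add]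
  congr 1
  simp [torusLog]

theorem ext_of_scaledV0 (hT : 0 < T) {q q' : C3} (hu : scaledV0 T q = scaledV0 T q')
    (h0 : scaledV0 T q ≠ 0) (h1 : scaled T q 0 = scaled T q' 0)
    (h2 : scaled T q 1 = scaled T q' 1) : q = q' := by
  refine ext_of_scaled hT (i := 0) (j := 1) (k := 2) (by decide) (by decide) (by decide) h1 h2 ?_
  have e := scaled_mul T q (show (0 : Fin 3) ≠ 1 by decide) (show (0 : Fin 3) ≠ 2 by decide)
    (show (1 : Fin 3) ≠ 2 by decide)
  have e' := scaled_mul T q' (show (0 : Fin 3) ≠ 1 by decide) (show (0 : Fin 3) ≠ 2 by decide)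
    (show (1 : Fin 3) ≠ 2 by decide)
  rw [← hu, ← e, ← h1, ← h2] at e'
  rw [← e] at h0
  exact (mul_left_cancel₀ (left_ne_zero_of_mul h0) e').symm

theorem exists_torusMap_eq (hT : 0 < T) (hΛ : Λ.re ≠ 0) {q : C3}
    (hq : scaledV0 T q = Complex.exp Λ) : ∃ t, torusMap T Λ t = q := by
  have hu : scaledV0 T q ≠ 0 := by rw [hq]; exact Complex.exp_ne_zero _
  have hv := (scaledV0_eq_zero hT).not.1 hu
  obtain ⟨x, y, h1⟩ := exists_log_basis hΛ (Complex.log (scaled T q 0))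
  obtain ⟨x', y', h2⟩ := exists_log_basis hΛ (Complex.log (scaled T q 1))
  refine ⟨![x, x', y, y'], ext_of_scaledV0 hT ?_ ?_ ?_ ?_⟩
  · rw [scaledV0_torusMap hT, hq]
  · rw [scaledV0_torusMap hT]; exact Complex.exp_ne_zero _
  · rw [scaled_torusMap hT, ← Complex.exp_log ((scaled_eq_zero hT).not.2 (ne_zero_of_v0 hv 0)), h1]
    simp [torusLog]
  · rw [scaled_torusMap hT, ← Complex.exp_log ((scaled_eq_zero hT).not.2 (ne_zero_of_v0 hv 1)), h2]
    simp [torusLog]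

/-- Two points of the covering give the same point of `Y` if and only if they differ by a lattice
vector. -/
theorem mk_torusMap_eq_iff (hT : 0 < T) (hΛ : Λ.re ≠ 0) (s t : Fin 4 → ℝ)
    (hs : torusMap T Λ s ∈ chartDomain T l) (ht : torusMap T Λ t ∈ chartDomain T l) :
    (Y.mk ⟨((0, false), torusMap T Λ s), hs⟩ : Y T l) = Y.mk ⟨((0, false), torusMap T Λ t), ht⟩ ↔
      ∃ n : Fin 4 → ℤ, ∀ j, s j - t j = n j := by
  have hu := scaledV0_torusMap hT Λ s
  have hv : v0 (torusMap T Λ s) ≠ 0 := by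
    rw [Ne, ← scaledV0_eq_zero hT, hu]; exact Complex.exp_ne_zero _
  have key : ∀ (k n : ℤ) (x y x' y' : ℝ), x - x' = k → y - y' = n →
      Complex.exp Λ ^ (-n) * Complex.exp (2 * Real.pi * Complex.I * x + Λ * y)
        = Complex.exp (2 * Real.pi * Complex.I * x' + Λ * y') := by
    intro k n x y x' y' h1 h2
    rw [← Complex.exp_int_mul, ← Complex.exp_add, Complex.exp_eq_exp_iff_exists_int]
    refine ⟨k, ?_⟩
    have h1' : (x : ℂ) - x' = k := by exact_mod_cast h1
    have h2' : (y : ℂ) - y' = n := by exact_mod_cast h2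
    push_cast
    rw [← h1', ← h2']
    ring
  rw [mk_eq_iff hT]
  constructor
  · rintro ⟨w, h1, h2, h3⟩
    change run T w (torusMap T Λ s) = torusMap T Λ t at h2
    change par w = 1 at h3
    have main : ∀ (m : ℤ) (x y x' y' : ℝ),
        Complex.exp Λ ^ m * Complex.exp (2 * Real.pi * Complex.I * x + Λ * y)
          = Complex.exp (2 * Real.pi * Complex.I * x' + Λ * y') →
        ∃ k n : ℤ, x - x' = k ∧ y - y' = n := by
      intro m x y x' y' h
      rw [← Complex.exp_int_mul, ← Complex.exp_add, Complex.exp_eq_exp_iff_exists_int] at h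
      obtain ⟨k, hk⟩ := h
      obtain ⟨e1, e2⟩ := log_basis_unique hΛ (x := x - x' - k) (y := y - y' + m) (by
        push_cast; linear_combination hk)
      exact ⟨k, -m, by linarith, by push_cast; linarith⟩
    have hr := fun j => scaled_run hT hv w j
    simp only [h2, h3, zpow_one, hu, scaled_torusMap hT] at hr
    obtain ⟨k0, n0, a0, b0⟩ := main _ _ _ _ _ (hr 0).symm
    obtain ⟨k1, n1, a1, b1⟩ := main _ _ _ _ _ (hr 1).symm
    refine ⟨![k0, k1, n0, n1], fun j => ?_⟩
    fin_cases j
    · exact a0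
    · exact a1
    · exact b0
    · exact b1
  · rintro ⟨n, hn⟩
    -- `n 0` and `n 1` change logarithms by multiples of `2πi`; `n 2` and `n 3` multiply the first
    -- two coordinates by powers of `u`, which this word undoes. The last exponent makes the sum
    -- zero.
    obtain ⟨w, h1, h2⟩ := exists_word (s := 1) (Or.inl rfl) ![-n 2, -n 3, n 2 + n 3] (by simp; ring)
    have hw : Valid T w (torusMap T Λ s) := valid_of_v0_ne_zero hT hv
    refine ⟨w, hw, ?_, h1⟩
    have hv' := v0_run hT hw
    have hr := fun j => scaled_run hT hv w j
    simp only [h1, h2, zpow_one, hu, scaled_torusMap hT] at hr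
    have hu' : scaledV0 T (run T w (torusMap T Λ s)) = Complex.exp Λ := by
      rw [scaledV0, hv', ← hu, scaledV0]
    refine ext_of_scaledV0 hT (by rw [hu', scaledV0_torusMap hT])
      (by rw [hu']; exact Complex.exp_ne_zero _) ?_ ?_
    · rw [hr 0, scaled_torusMap hT]
      exact key (n 0) (n 2) _ _ _ _ (hn 0) (hn 2)
    · rw [hr 1, scaled_torusMap hT]
      exact key (n 1) (n 3) _ _ _ _ (hn 1) (hn 3)

theorem torusLog_add (Λ : ℂ) (t d : Fin 4 → ℝ) (r : ℝ) (i : Fin 3) :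
    torusLog Λ (t + r • d) i = torusLog Λ t i + r * (torusLog Λ d i - torusLog Λ 0 i) := by
  fin_cases i <;> simp [torusLog] <;> ring

/-- The derivative of a family of torus maps is bijective. -/
theorem bijective_fderiv_torusMap (hT : 0 < T) {lam : ℂ → ℂ} {w : ℂ} (t : Fin 4 → ℝ)
    (hd : DifferentiableAt ℝ (fun x : ℂ × (Fin 4 → ℝ) => torusMap T (lam x.1) x.2) (w, t))
    (hv : ∀ᶠ x in 𝓝 (w, t), v0 (torusMap T (lam x.1) x.2) = x.1) (hΛ : (lam w).re ≠ 0) :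
    Function.Bijective
      (fderiv ℝ (fun x : ℂ × (Fin 4 → ℝ) => torusMap T (lam x.1) x.2) (w, t)) := by
  set D := fderiv ℝ (fun x : ℂ × (Fin 4 → ℝ) => torusMap T (lam x.1) x.2) (w, t) with hD
  have hT' : (T : ℂ) ≠ 0 := by exact_mod_cast hT.ne'
  have hinj : Function.Injective D := by
    rw [injective_iff_map_eq_zero]
    rintro ⟨δ, d⟩ h0
    -- `v₀` recovers the parameter of the family, so a kernel vector is tangent to the fibre.
    have hδ : δ = 0 := by
      have h1 : HasFDerivAt v0 (fderiv ℝ v0 (torusMap T (lam w) t)) (torusMap T (lam w) t) :=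
        (((contDiff_v0 (n := 1)).contDiffAt.differentiableAt
          (by simp)).restrictScalars ℝ).hasFDerivAt
      have hv' : v0 ∘ (fun x : ℂ × (Fin 4 → ℝ) => torusMap T (lam x.1) x.2) =ᶠ[𝓝 (w, t)]
          Prod.fst := hv
      have h2 := (HasFDerivAt.comp (w, t) h1 hd.hasFDerivAt).unique
        (HasFDerivAt.congr_of_eventuallyEq (f := Prod.fst) (hasFDerivAt_fst (𝕜 := ℝ)) hv')
      have h3 := DFunLike.congr_fun h2 (δ, d)
      rw [ContinuousLinearMap.comp_apply] at h3
      erw [h0] at h3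
      rw [map_zero] at h3
      exact h3.symm
    subst hδ
    -- Along this line the logarithms of the coordinates are affine, and vanishing of their slopes
    -- gives `d = 0` by `log_basis_unique`.
    have hline : HasDerivAt (fun r : ℝ => (w, t + r • d)) ((0 : ℂ), d) 0 := by
      refine HasDerivAt.prodMk (hasDerivAt_const _ _) ?_
      simpa using ((hasDerivAt_id (0 : ℝ)).smul_const d).const_add t
    have hcomp : HasDerivAt (fun r : ℝ => torusMap T (lam w) (t + r • d)) (D (0, d)) 0 := by
      have hd' : HasFDerivAt (fun x : ℂ × (Fin 4 → ℝ) => torusMap T (lam x.1) x.2) D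
          (w, t + (0 : ℝ) • d) := by
        rw [zero_smul, add_zero]; exact hd.hasFDerivAt
      exact hd'.comp_hasDerivAt (0 : ℝ) hline
    rw [h0, hasDerivAt_pi] at hcomp
    have hz : ∀ i, torusLog (lam w) d i - torusLog (lam w) 0 i = 0 := fun i => by
      have e1 : HasDerivAt (fun r : ℝ => torusLog (lam w) t i
          + r * (torusLog (lam w) d i - torusLog (lam w) 0 i))
          (torusLog (lam w) d i - torusLog (lam w) 0 i) 0 := by
        simpa using ((Complex.ofRealCLM.hasDerivAt (x := 0)).mul_const
          (torusLog (lam w) d i - torusLog (lam w) 0 i)).const_add (torusLog (lam w) t i)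
      have e2 := (e1.cexp.div_const (T : ℂ)).unique (by
        have := hcomp i
        simp only [torusMap, torusLog_add] at this
        exact this)
      have e3 : Complex.exp (torusLog (lam w) t i + ((0 : ℝ) : ℂ)
          * (torusLog (lam w) d i - torusLog (lam w) 0 i)) ≠ 0 := Complex.exp_ne_zero _
      have e4 := (div_eq_zero_iff.1 e2).resolve_right hT'
      exact (mul_eq_zero.1 e4).resolve_left e3
    have z0 := hz 0
    have z1 := hz 1
    simp only [torusLog, Matrix.cons_val_zero, Matrix.cons_val_one, Pi.zero_apply,
      Complex.ofReal_zero, mul_zero, add_zero, sub_zero] at z0 z1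
    obtain ⟨a0, a2⟩ := log_basis_unique hΛ z0
    obtain ⟨a1, a3⟩ := log_basis_unique hΛ z1
    refine Prod.ext rfl (funext fun j => ?_)
    fin_cases j <;> assumption
  refine ⟨hinj, ?_⟩
  have hfin : Module.finrank ℝ (ℂ × (Fin 4 → ℝ)) = Module.finrank ℝ C3 := by
    simp [Module.finrank_pi_fintype, Complex.finrank_real_complex]
  exact (LinearMap.injective_iff_surjective_of_finrank_eq_finrank (f := (D : _ →ₗ[ℝ] C3)) hfin).1
    hinj

/-- In the chart at `((0, false))` a fibre has the free coordinates `X₀, X₁ ∈ ℂˣ`, each modulo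
powers of `u`. Logarithms turn this into `ℂ²` modulo the lattice spanned by `2πi` and `Λ` in each
factor, where `Re Λ ≠ 0` because `|u| < 1`. -/
theorem isSmoothTorusBundle (hT0 : 0 < T) (hT1 : T < 1) (hl : 0 ≤ l) :
    IsSmoothTorusBundle hT0 l := by
  intro c hc hcl
  have hT' : (T : ℂ) ≠ 0 := by exact_mod_cast hT0.ne'
  -- On this ball `|w / c - 1| < 1`, so `log (w / c)` is holomorphic and supplies a smooth branch of
  -- the logarithm of `T³ w`.
  set W : Set ℂ := Metric.ball c ‖c‖ ∩ {w | ‖w‖ < T ^ l} with hWdef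
  have hWo : IsOpen W := Metric.isOpen_ball.inter (isOpen_lt continuous_norm continuous_const)
  set lam : ℂ → ℂ := fun w => Complex.log ((T : ℂ) ^ 3 * c) + Complex.log (w / c) with hlam
  have hslit : ∀ w ∈ W, w / c ∈ Complex.slitPlane := fun w hw => by
    refine Complex.mem_slitPlane_of_norm_lt_one (z := w / c - 1) ?_ |> fun h => by simpa using h
    have e : w / c - 1 = (w - c) / c := by field_simp
    rw [e, norm_div, div_lt_one (norm_pos_iff.2 hc), ← dist_eq_norm]
    exact hw.1
  have hexp : ∀ w ∈ W, Complex.exp (lam w) = (T : ℂ) ^ 3 * w := fun w hw => by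
    rw [hlam, Complex.exp_add, Complex.exp_log (mul_ne_zero (pow_ne_zero 3 hT') hc),
      Complex.exp_log (Complex.slitPlane_ne_zero (hslit w hw))]
    field_simp
  have hlamsm : ContDiffOn ℝ ∞ lam W := fun w hw => by
    have : ContDiffAt ℂ ∞ lam w :=
      contDiffAt_const.add ((Complex.contDiffAt_log (hslit w hw)).comp w (contDiffAt_id.div_const c))
    exact (this.restrict_scalars ℝ).contDiffWithinAt
  have hre : ∀ w ∈ W, (lam w).re ≠ 0 := fun w hw => by
    have h1 := congrArg (‖·‖) (hexp w hw)
    simp only [Complex.norm_exp, norm_mul, norm_pow, Complex.norm_real, Real.norm_eq_abs,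
      abs_of_pos hT0] at h1
    have h2 : T ^ 3 * ‖w‖ < 1 := lt_of_le_of_lt
      (mul_le_mul_of_nonneg_left hw.2.le (by positivity)) (rpow_bound hT0 hT1 hl).2
    intro h0
    rw [h0, Real.exp_zero] at h1
    linarith
  have hv : ∀ w ∈ W, ∀ t, v0 (torusMap T (lam w) t) = w := fun w hw t => by
    have := scaledV0_torusMap hT0 (lam w) t
    rw [hexp w hw] at this
    exact mul_left_cancel₀ (pow_ne_zero 3 hT') this
  have hΨ : ∀ w ∈ W, ∀ t, torusMap T (lam w) t ∈ chartDomain T l := fun w hw t => by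
    change ‖v0 _‖ < _
    rw [hv w hw]
    exact hw.2
  have hsm : ContDiffOn ℝ ∞ (fun x : ℂ × (Fin 4 → ℝ) => torusMap T (lam x.1) x.2)
      (W ×ˢ Set.univ) := by
    have h1 : ContDiffOn ℝ ∞ (fun x : ℂ × (Fin 4 → ℝ) => lam x.1) (W ×ˢ Set.univ) :=
      hlamsm.comp contDiffOn_fst fun x hx => hx.1
    have h2 : ∀ j, ContDiffOn ℝ ∞ (fun x : ℂ × (Fin 4 → ℝ) => ((x.2 j : ℝ) : ℂ))
        (W ×ˢ Set.univ) := fun j =>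
      (Complex.ofRealCLM.contDiff.comp ((contDiff_apply ℝ ℝ j).comp contDiff_snd)).contDiffOn
    have h3 : ∀ j k, ContDiffOn ℝ ∞ (fun x : ℂ × (Fin 4 → ℝ) =>
        2 * Real.pi * Complex.I * (x.2 j : ℂ) + lam x.1 * (x.2 k : ℂ)) (W ×ˢ Set.univ) :=
      fun j k => (contDiffOn_const.mul (h2 j)).add (h1.mul (h2 k))
    rw [contDiffOn_pi]
    intro i
    refine ContDiffOn.div_const (ContDiffOn.cexp ?_) _
    fin_cases i
    · exact h3 0 2
    · exact h3 1 3
    · exact (h1.sub (h3 0 2)).sub (h3 1 3)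
  have hWo' : IsOpen (W ×ˢ (Set.univ : Set (Fin 4 → ℝ))) := hWo.prod isOpen_univ
  refine ⟨W, fun x => torusMap T (lam x.1) x.2, hΨ, hWo, ⟨Metric.mem_ball_self
    (norm_pos_iff.2 hc), hcl⟩, hv, hsm, fun w hw t => ?_, ?_, fun w hw s t =>
      mk_torusMap_eq_iff hT0 (hre w hw) s t (hΨ w hw s) (hΨ w hw t)⟩
  · have hmem : W ×ˢ (Set.univ : Set (Fin 4 → ℝ)) ∈ 𝓝 (w, t) := hWo'.mem_nhds ⟨hw, trivial⟩
    refine bijective_fderiv_torusMap hT0 t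
      ((hsm.contDiffAt hmem).differentiableAt (by simp)) ?_ (hre w hw)
    filter_upwards [hmem] with x hx
    exact hv x.1 hx.1 x.2
  · have main : ∀ m q (hq : q ∈ chartDomain T l), v0 q ∈ W →
        ∃ (w : ℂ) (hw : w ∈ W) (t : Fin 4 → ℝ),
          Y.mk ⟨((0, false), torusMap T (lam w) t), hΨ w hw t⟩
            = (Y.mk ⟨((m, false), q), hq⟩ : Y T l) := fun m q hq hW => by
      obtain ⟨t, ht⟩ := exists_torusMap_eq hT0 (hre _ hW) (q := q) (by rw [hexp _ hW, scaledV0])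
      exact ⟨v0 q, hW, t, mk_eq_of_run (w := []) hT0 _ _ trivial ht rfl⟩
    rintro ⟨⟨⟨m, b⟩, q⟩, hq⟩ hy
    change v0 q ∈ W at hy
    cases b with
    | false => exact main m q hq hy
    | true =>
      have hq0 : v0 q ≠ 0 := by
        intro h0
        have := hslit _ hy
        rw [h0, zero_div] at this
        exact Complex.slitPlane_ne_zero this rfl
      -- For `v₀ ≠ 0` one edge carries a point at a vertex of the other type to a vertex of type
      -- `false`.
      have h1 : Valid T [0] q := valid_of_v0_ne_zero hT0 hq0
      have hq1 := run_mem_chartDomain hT0 hq h1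
      obtain ⟨w, hw, t, e⟩ := main 0 _ hq1 (by rwa [v0_run hT0 h1])
      exact ⟨w, hw, t, e.trans (mk_eq_of_run (m := m) (b := true) hT0 hq hq1 h1 rfl rfl).symm⟩

end Torus

/-! ### Assembly: the symplectic fibration and the choice of constants -/

theorem isSymplecticFibration {α : Bumps} {T p l ε C : ℝ} (h : Setup α T p l ε) (hT1 : T < 1)
    (hl : 0 ≤ l) (hC : ∀ q, ‖v0 q‖ ≤ T ^ l → (∀ i, ‖(T : ℂ) * q i‖ ≤ 1) →
      ∀ v ≠ 0, 0 < iddbar (fullPotential α T p l C) q v (Complex.I • v)) :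
    IsSymplecticFibration h.pos l (fun _ => kahlerForm α T p l C) where
  manifold := isManifoldQuotient h.pos hT1 hl
  symplectic :=
    { isTwoForm := h.isTwoForm_kahlerForm hT1 hl C
      closed := fun _ _ hq => h.extDeriv_kahlerForm hT1 hl C hq
      nondegenerate := fun _ _ hq a ha => ⟨Complex.I • a, (h.kahlerForm_pos hT1 hl hC hq ha).ne'⟩ }
  bundle := isSmoothTorusBundle h.pos hT1 hl
  submersive := fun _ _ hv => fderiv_v0_ne_zero hv
  fibre_nondegenerate := fun _ _ hq _ a hker ha =>
    ⟨Complex.I • a, by rw [map_smul, hker, smul_zero], (h.kahlerForm_pos hT1 hl hC hq ha).ne'⟩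

end BananaMirror
end

open BananaMirror in
theorem lemma3p16 (T p : ℝ) (hT0 : 0 < T) (hT1 : T < 1) (hp : 16 < p) :
    ∃ K₀ : ℝ, ∀ K ≥ K₀, ∃ l₀ : ℝ, ∀ l ≥ l₀,
      (∃ α : Bumps, α.Admissible T p l K) ∧
      ∀ α : Bumps, α.Admissible T p l K → ∃ C₀ : ℝ, ∀ C ≥ C₀,
        ∃ ω : FormFamily, HasPotential α T p l C ω ∧
          (∀ ω' : FormFamily, HasPotential α T p l C ω' →
            ∀ v, ∀ q ∈ chartDomain T l, ω' v q = ω v q) ∧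
          IsSymplecticFibration hT0 l ω := by
  obtain ⟨K₀, hK₀, hadm⟩ := exists_admissible hT0 hT1 (show 0 < p by linarith)
  obtain ⟨l₁, hscales⟩ := exists_scales hT0 hT1 hp
  refine ⟨K₀, fun K hK => ?_⟩
  obtain ⟨l₂, hl₂⟩ := hadm K hK
  have hK0 : 0 ≤ K := hK₀.le.trans hK
  -- `l ≥ K * 10 ^ 9` gives `ε = K / l ≤ 1 / 10 ^ 9`, the smallness required by the Levi estimates.
  refine ⟨max (max l₁ l₂) (max 1 (K * 10 ^ 9)), fun l hl => ?_⟩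
  have h1 : l₁ ≤ l := (le_max_left _ _).trans ((le_max_left _ _).trans hl)
  have h2 : l₂ ≤ l := (le_max_right _ _).trans ((le_max_left _ _).trans hl)
  have h3 : 1 ≤ l := (le_max_left _ _).trans ((le_max_right _ _).trans hl)
  have h4 : K * 10 ^ 9 ≤ l := (le_max_right _ _).trans ((le_max_right _ _).trans hl)
  have hl0 : 0 ≤ l := by linarith
  refine ⟨hl₂ l h2, fun α hα => ?_⟩
  have S : Setup α T p l (K / l) := ⟨hT0, hscales l h1, hα.fits hT0 h3 hK0⟩
  have hε : K / l ≤ 1 / 10 ^ 9 := by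
    rw [div_le_div_iff₀ (by linarith) (by norm_num)]
    linarith
  obtain ⟨C₀, hC₀⟩ := S.exists_const hε (by positivity)
  refine ⟨C₀, fun C hC => ⟨fun _ => kahlerForm α T p l C, S.hasPotential_kahlerForm hT1 hl0 C, ?_,
    isSymplecticFibration S hT1 hl0 (hC₀ C hC)⟩⟩
  exact fun η hη v q hq => hη.unique hT0 hT1 hl0 (S.hasPotential_kahlerForm hT1 hl0 C) v hq
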